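/- Let $n\ge 0$. Let $\mathcal A_{2n}=\mathbb R[[y^1,\dots,y^n]][p_1,\dots,p_n][[\hbar]]$ be the algebra of formal series in $\hbar$ whose coefficients are polynomials in $p_a$ with coefficients formal power series in $y^a$, with the Moyal–Weyl product $$f*g=f\exp\Big[\tfrac{\hbar}{2}\Big(\overleftarrow{\partial}_{y^a}\overrightarrow{\partial}_{p_a}-\overleftarrow{\partial}_{p_a}\overrightarrow{\partial}_{y^a}\Big)\Big]g ,$$ and let $\hat{\mathcal A}_{2n}=\mathbb R[[y,p,\hbar]]$ be its completion with respect to the Fedosov degree $\deg y=\deg p=1$, $\deg\hbar=2$. On open subsets of $\mathbb R^n$ with coordinates $x^\mu$ consider forms with values in $\hat{\mathcal A}_{2n}$ all of whose coefficients are smooth functions of $x$ ("smooth sections" for $0$-forms). For a parameter $\lambda$, the finite gauge transformation of a connection $1$-form $A$ is $$A'=e_*^{-\lambda/\hbar}*(\hbar d+A)*e_*^{\lambda/\hbar}:=A+\sum_{k\ge0}\tfrac1{(k+1)!}\big(\tfrac1\hbar[\,\cdot\,,\lambda]_*\big)^k\big(d\lambda+\tfrac1\hbar[A,\lambda]_*\big)$$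 (coefficientwise convergence). The parameters allowed are smooth sections $\lambda$ of either of two kinds, for which the star-exponential acts: (i) $\lambda$ with values in $\hat{\mathcal A}_{2n}$ and no component of Fedosov degree $1$; (ii) $\lambda=c(x)+\lambda_a(x)y^a$, acting on $\mathcal A_{2n}$-valued $A$, the polynomial degree in $p$ at each order in $\hbar$ being bounded uniformly in $x$. Two smooth connections over $V$ are gauge equivalent over $V$ (belong to the same gauge orbit) if they are joined by a finite chain of such transformations and their inverses. Put $A^{(0)}=dx^a p_a$. 1. Let $A$ be a smooth $\mathcal A_{2n}$-valued $1$-form on an open $U\subseteq\mathbb R^n$ (with degree in $p$, at each order in $\hbar$, bounded uniformly on $U$) that is flat, $dA+\tfrac1{2\hbar}[A,A]_*=0$, and whose $p$-linear, $y$- and $\hbar$-independent part $dx^\mu e^a_\mu(x)p_a$ has $e^a_\mu(x)$ invertible for every $x\in U$. Then every $x_0\in U$ has an open neighbourhood $V\subseteq U$ over which $A$ is gauge equivalent to $A^{(0)}$. In particular, any two such connections on $U$ are gauge equivalent over some neighbourhood of each point of $U$: locally all such connections belong to one gauge orbit. 2. Let $V\subseteq\mathbb R^n$ be open. A smooth section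 $F$ over $V$ satisfies $dF+\tfrac1\hbar[A^{(0)},F]_*=0$ if and only if $$F=f(x+y,p):=\sum_\alpha\tfrac1{\alpha!}\,y^\alpha\,\partial_x^\alpha f(x,p)$$ for some smooth $y$-independent section $f=f(x,p)$ (a formal series in $p,\hbar$). Here $f$ is unconstrained: for every smooth $y$-independent $f$ the section $f(x+y,p)$ is smooth and is the unique covariantly constant $F$ with $F|_{y=0}=f$; it is $\mathcal A_{2n}$-valued (with degree in $p$, at each order in $\hbar$, bounded uniformly on $V$) if and only if $f$ is. 3. The off-shell Segal system is recovered. Let $\star$ be the Moyal–Weyl product in the variables $(x,p)$ (replace $\partial_{y^a}$ by $\partial_{x^a}$ above), and write $\tau f=f(x+y,p)$. Then, for all smooth $y$-independent $f,g,\xi,w$ over $V$, $\tau f*\tau g=\tau(f\star g)$ and $$\tfrac1\hbar[\tau f,\tau\xi]_*+\{\tau f,\tau w\}_*=\tau\big(\tfrac1\hbar[f,\xi]_\star+\{f,w\}_\star\big).$$ Thus the residual gauge transformations, whose parameters are covariantly constant with respect to $A^{(0)}$ and hence by part 2 of the form $\tau\xi,\tau w$, act on $f$ as the gauge transformations of the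 off-shell Segal system. -/

import Mathlib

open scoped ContDiff Nat

noncomputable section

namespace SegalGauge

/-! ### The formal Weyl algebra -/

/-- The formal variables: `y^a`, `p_a` for `a : Fin n`, and `ħ`. -/
abbrev WeylVar (n : ℕ) : Type := Fin n ⊕ (Fin n ⊕ Unit)

/-- The variable `y^a`. -/
abbrev yVar {n : ℕ} (a : Fin n) : WeylVar n := Sum.inl a

/-- The variable `p_a`. -/
abbrev pVar {n : ℕ} (a : Fin n) : WeylVar n := Sum.inr (Sum.inl a)

/-- The variable `ħ`. -/
abbrev hVar {n : ℕ} : WeylVar n := Sum.inr (Sum.inr ())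

/-- Exponents of monomials in `y`, `p`, `ħ`. -/
abbrev Expo (n : ℕ) : Type := WeylVar n →₀ ℕ

/-- The Weyl algebra completed with respect to the Fedosov degree, as a vector space:
formal power series in `y`, `p`, `ħ` with real coefficients. -/
abbrev Weyl (n : ℕ) : Type := MvPowerSeries (WeylVar n) ℝ

/-- The Fedosov degree of a monomial: `deg y = deg p = 1`, `deg ħ = 2`. -/
def fedosovDegree {n : ℕ} (d : Expo n) : ℕ :=
  (∑ a, d (yVar a)) + (∑ a, d (pVar a)) + 2 * d hVar

/-- The `k`-th power of the bidifferential operator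
`∑ a, (D a ⊗ E a - E a ⊗ D a)`, followed by multiplication. -/
def poissonPow {n : ℕ} {R : Type} [CommRing R] (D E : Fin n → R → R) : ℕ → R → R → R
  | 0, f, g => f * g
  | k + 1, f, g =>
      ∑ a, (poissonPow D E k (D a f) (E a g) - poissonPow D E k (E a f) (D a g))

/-- The series `∑ k, ħ ^ k * c k`. -/
def hbarSum {n : ℕ} (c : ℕ → Weyl n) : Weyl n := fun d =>
  ∑ k ∈ Finset.range (d hVar + 1), MvPowerSeries.coeff (d - Finsupp.single hVar k) (c k)

/-- The coefficient `1 / (2 ^ k * k!)` of `ħ ^ k` in `exp (ħ / 2)`. -/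
def moyalCoeff (k : ℕ) : ℝ := ((2 : ℝ) ^ k * (k ! : ℝ))⁻¹

/-- `∂/∂y^a`. -/
def dY {n : ℕ} (a : Fin n) (f : Weyl n) : Weyl n := MvPowerSeries.pderiv ℝ (yVar a) f

/-- `∂/∂p_a`. -/
def dP {n : ℕ} (a : Fin n) (f : Weyl n) : Weyl n := MvPowerSeries.pderiv ℝ (pVar a) f

/-- The fibrewise Moyal-Weyl product
`f * exp (ħ/2 (∂_y ⊗ ∂_p - ∂_p ⊗ ∂_y)) * g` in the variables `y`, `p`. -/
def star {n : ℕ} (f g : Weyl n) : Weyl n :=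
  hbarSum fun k => moyalCoeff k • poissonPow dY dP k f g

/-- Division by `ħ` (of a series divisible by `ħ`). -/
def divHbar {n : ℕ} (f : Weyl n) : Weyl n := fun d =>
  MvPowerSeries.coeff (d + Finsupp.single hVar 1) f

/-- The rescaled star commutator `(1/ħ) [f, g]`. -/
def bracket {n : ℕ} (f g : Weyl n) : Weyl n := divHbar (star f g - star g f)

/-- A star commutator is divisible by `ħ`, so that `bracket` is indeed `(1/ħ) [f, g]`. -/
theorem hbar_mul_bracket {n : ℕ} (f g : Weyl n) :
    MvPowerSeries.X hVar * bracket f g = star f g - star g f := by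
  ext d
  by_cases h : d hVar = 0
  · have h0 : ∀ u v : Weyl n, MvPowerSeries.coeff d (star u v) =
        moyalCoeff 0 * MvPowerSeries.coeff d (u * v) := by
      intro u v
      change (∑ k ∈ Finset.range (d hVar + 1), _) = _
      rw [h]
      simp [poissonPow]
    rw [map_sub, h0, h0, mul_comm g f, sub_self, MvPowerSeries.X,
      MvPowerSeries.coeff_monomial_mul, if_neg]
    intro hle
    have := hle hVar
    simp [h] at this
  · have hle : Finsupp.single hVar 1 ≤ d := by
      rw [Finsupp.single_le_iff]
      omega
    obtain ⟨e, rfl⟩ := exists_add_of_le hle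
    rw [MvPowerSeries.X, MvPowerSeries.coeff_add_monomial_mul, one_mul, add_comm]
    rfl

/-! ### Sections of the Weyl bundle and connections over a coordinate chart -/

/-- Points of the coordinate chart `ℝⁿ`. -/
abbrev Pt (n : ℕ) : Type := Fin n → ℝ

/-- Sections of the (trivialized, completed) Weyl bundle. -/
abbrev Sec (n : ℕ) : Type := Pt n → Weyl n

/-- A one-form `A = dx^μ A_μ` with values in the (completed) Weyl algebra. -/
abbrev Conn (n : ℕ) : Type := Fin n → Sec n

/-- All coefficient functions of `F` are smooth on `V`. -/
def IsSmooth {n : ℕ} (V : Set (Pt n)) (F : Sec n) : Prop :=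
  ∀ d : Expo n, ContDiffOn ℝ ∞ (fun x => MvPowerSeries.coeff d (F x)) V

/-- `F` takes values over `V` in the Weyl algebra `𝒜_{2n} = ℝ[[y]][p][[ħ]]`: at each order in `ħ`,
`F` is polynomial in `p`, with coefficients formal power series in `y`. -/
def IsPolyP {n : ℕ} (V : Set (Pt n)) (F : Sec n) : Prop :=
  ∀ m : ℕ, ∃ N : ℕ, ∀ x ∈ V, ∀ d : Expo n,
    d hVar = m → N < ∑ a, d (pVar a) → MvPowerSeries.coeff d (F x) = 0

/-- `∂g/∂x^a` for a real function `g`. -/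
def partialDeriv {n : ℕ} (a : Fin n) (g : Pt n → ℝ) : Pt n → ℝ := fun x =>
  fderiv ℝ g x (Pi.single a 1)

/-- `∂F/∂x^a` for a section `F`, coefficient by coefficient. -/
def dX {n : ℕ} (a : Fin n) (F : Sec n) : Sec n := fun x d =>
  partialDeriv a (fun z => MvPowerSeries.coeff d (F z)) x

/-- The component along `dx^μ` of `dF + (1/ħ) [A, F]`. This is also the infinitesimal gauge
variation `δ_F A` of the connection with parameter `F`. -/
def covDeriv {n : ℕ} (A : Conn n) (F : Sec n) (μ : Fin n) : Sec n := fun x =>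
  dX μ F x + bracket (A μ x) (F x)

/-- `dF + (1/ħ) [A, F] = 0` on `V`. -/
def IsCovConst {n : ℕ} (V : Set (Pt n)) (A : Conn n) (F : Sec n) : Prop :=
  ∀ μ, ∀ x ∈ V, covDeriv A F μ x = 0

/-- Zero curvature, `dA + (1/2ħ) [A, A] = 0` on `V`, in components. -/
def IsFlat {n : ℕ} (V : Set (Pt n)) (A : Conn n) : Prop :=
  ∀ μ ν, ∀ x ∈ V, dX μ (A ν) x - dX ν (A μ) x + bracket (A μ x) (A ν x) = 0

/-- The vielbein `e_μ^a (x)`: the coefficient of `p_a` in `A_μ (x)`. -/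
def vielbein {n : ℕ} (A : Conn n) (x : Pt n) : Matrix (Fin n) (Fin n) ℝ :=
  Matrix.of fun μ a => MvPowerSeries.coeff (Finsupp.single (pVar a) 1) (A μ x)

/-- Smooth flat `𝒜_{2n}`-valued connections on `U` with invertible vielbein. -/
structure IsFlatFramed {n : ℕ} (U : Set (Pt n)) (A : Conn n) : Prop where
  smooth : ∀ μ, IsSmooth U (A μ)
  polyP : ∀ μ, IsPolyP U (A μ)
  flat : IsFlat U A
  invertible : ∀ x ∈ U, IsUnit (vielbein A x).det

/-- The connection `A⁽⁰⁾ = dx^a p_a`. -/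
def segalConn (n : ℕ) : Conn n := fun μ _ => MvPowerSeries.X (pVar μ)

/-! ### Finite gauge transformations -/

/-- `A'` is, on `V`, the finite gauge transform of `A` with parameter `lam`,
`A' = e^{-lam/ħ} * (ħ d + A) * e^{lam/ħ}`. Conjugation by the star exponential is the exponential
of the operator `(1/ħ) [·, lam]`, which maps `ħ d + A` to `δA = d lam + (1/ħ) [A, lam]`; hence
`A' = A + ∑ k, (1/(k+1)!) ((1/ħ) [·, lam]) ^ k (δA)`. Convergence is coefficientwise. -/
def IsGaugeTransform {n : ℕ} (V : Set (Pt n)) (lam : Sec n) (A A' : Conn n) : Prop :=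
  ∀ μ, ∀ x ∈ V, ∀ d : Expo n,
    HasSum
      (fun k : ℕ => (((k + 1)! : ℕ) : ℝ)⁻¹ *
        MvPowerSeries.coeff d ((fun g => bracket g (lam x))^[k] (covDeriv A lam μ x)))
      (MvPowerSeries.coeff d (A' μ x) - MvPowerSeries.coeff d (A μ x))

/-- The parameter has no part of Fedosov degree one. The exponential of `(1/ħ) [·, lam]` is then
defined on the whole completed Weyl algebra. -/
def HasNoLinearPart {n : ℕ} (V : Set (Pt n)) (lam : Sec n) : Prop :=
  ∀ x ∈ V, ∀ d : Expo n, fedosovDegree d = 1 → MvPowerSeries.coeff d (lam x) = 0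

/-- The parameter is `c(x) + lam_a(x) y^a`. The exponential of `(1/ħ) [·, lam]` is then the
translation `p_a ↦ p_a - lam_a(x)`, defined on `𝒜_{2n}`. -/
def IsTranslation {n : ℕ} (V : Set (Pt n)) (lam : Sec n) : Prop :=
  ∀ x ∈ V, ∀ d : Expo n, d ≠ 0 → (∀ a, d ≠ Finsupp.single (yVar a) 1) →
    MvPowerSeries.coeff d (lam x) = 0

/-- One finite gauge transformation over `V`, between smooth connections and with a smooth
parameter whose star exponential acts on them. -/
def GaugeStep {n : ℕ} (V : Set (Pt n)) (A A' : Conn n) : Prop :=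
  (∀ μ, IsSmooth V (A μ)) ∧ (∀ μ, IsSmooth V (A' μ)) ∧
    ∃ lam : Sec n, IsSmooth V lam ∧
      (HasNoLinearPart V lam ∨ (IsTranslation V lam ∧ ∀ μ, IsPolyP V (A μ))) ∧
      IsGaugeTransform V lam A A'

/-- `A` and `A'` lie in the same orbit of finite gauge transformations over `V`: they are joined
by a finite chain of such transformations and their inverses. -/
def GaugeEquivalent {n : ℕ} (V : Set (Pt n)) (A A' : Conn n) : Prop :=
  Relation.EqvGen (GaugeStep V) A A'

/-! ### Symbols on phase space -/

/-- `f` does not depend on `y` over `V`, i.e. `f = f(x, p)` (with coefficients in `ℝ[[ħ]]`). -/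
def IsSymbol {n : ℕ} (V : Set (Pt n)) (f : Sec n) : Prop :=
  ∀ x ∈ V, ∀ d : Expo n, (∃ a, d (yVar a) ≠ 0) → MvPowerSeries.coeff d (f x) = 0

open Classical in
/-- The restriction `F|_{y=0}`. -/
def atYZero {n : ℕ} (F : Sec n) : Sec n := fun x d =>
  if ∀ a, d (yVar a) = 0 then MvPowerSeries.coeff d (F x) else 0

/-- The mixed partial derivative `∂^α g` for a multi-index `α`. -/
def mixedPartial {n : ℕ} (α : Fin n → ℕ) (g : Pt n → ℝ) : Pt n → ℝ :=
  (List.finRange n).foldr (fun a h => (partialDeriv a)^[α a] h) g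

/-- The monomial obtained from a given one by deleting the variables `y`. -/
def eraseY {n : ℕ} (d : Expo n) : Expo n := d.filter fun v => v.isRight

/-- The section `f(x + y, p) = ∑ α, (1/α!) y^α ∂_x^α f(x, p)`. -/
def taylorLift {n : ℕ} (f : Sec n) : Sec n := fun x d =>
  (∏ a, ((d (yVar a))! : ℝ))⁻¹ *
    mixedPartial (fun a => d (yVar a)) (fun z => MvPowerSeries.coeff (eraseY d) (f z)) x

/-- `∂/∂p_a` on sections. -/
def dPSec {n : ℕ} (a : Fin n) (f : Sec n) : Sec n := fun x => dP a (f x)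

/-- The Moyal-Weyl product `f ⋆ g` of phase space functions, in the variables `x`, `p`. -/
def phaseStar {n : ℕ} (f g : Sec n) : Sec n := fun x =>
  hbarSum fun k => moyalCoeff k • poissonPow dX dPSec k f g x

/-- The infinitesimal gauge transformation of the parent system,
`(1/ħ) [F, ξ] + {F, w}` for the fibrewise star product. -/
def parentVariation {n : ℕ} (F ξ w : Sec n) : Sec n := fun x =>
  bracket (F x) (ξ x) + (star (F x) (w x) + star (w x) (F x))

/-- The infinitesimal gauge transformation of the off-shell Segal system,
`(1/ħ) [f, ξ] + {f, w}` for the star product of phase space functions. -/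
def segalVariation {n : ℕ} (f ξ w : Sec n) : Sec n := fun x =>
  divHbar (phaseStar f ξ x - phaseStar ξ f x) + (phaseStar f w x + phaseStar w f x)

end SegalGauge

end

noncomputable section

namespace SegalGauge

open MvPowerSeries

/-! ### Weights of monomials -/

/-! A flat connection is brought to `dx^a p_a` by working upwards in the Fedosov degree. Degree
zero: near a point, a translation `p ↦ p + π(x)` makes the degree-zero part constant. Here `π` comes
from the implicit function theorem, whose Jacobian at `p = 0` is the vielbein, and an affine `c(x)`
then removes the constant (`IsFlatFramed.exists_centered`).

Degree one: the linear parts of the `A_μ` are `n` vectors in the symplectic space of linear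
functions of `y`, `p`, and flatness in degree zero says that they are pairwise orthogonal. Quadratic
parameters in `y` alone or in `p` alone act on them as symplectic shears. One `yy` shear removes the
`y`-components. A `yy` shear by `s` followed by a `pp` shear by `t` multiplies the vielbein by `1 -
s t`. Such factors include all the column operations needed, so Gaussian elimination reaches the
identity matrix near the point, whatever the sign of the determinant (`IsFlatAligned.exists_rows`).
Only shears are used because their gauge series is finite in every coefficient, for a suitably
skewed weight.

Degree two and above: this is Fedosov's iteration. Since `(1/ħ)[p_a, ·] = -∂/∂y^a`, flatness makes
the lowest discrepancy from `dx^a p_a` closed in the `y`-directions. It is therefore exact by the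
Poincaré lemma, and its primitive corrects the parameter one degree higher. The corrections converge
coefficientwise to a single parameter (`gaugeStep_segalConn`).

The algebra behind this is that the rescaled commutator lowers two independent weights by one, and
each of its coefficients is a finite bilinear expression (`isFinBil_bracket`). Smoothness, the
Leibniz rule and rearrangements of series thus reduce to finite sums. Associativity gives the Jacobi
identity, from which the curvature of a gauge transform is the transformed curvature
(`curvTerm_succ`), so flatness survives every step.

For covariantly constant sections the equation reads `∂_x F = ∂_y F`, which determines `F` from its
value at `y = 0` and is solved by the Taylor series. Both derivatives are derivations of the
fibrewise product, so a product of lifts is again a solution, and its value at `y = 0` is the phase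
space product because `∂_y` acts on lifts as `∂_x`. -/

/-- The weight with `y` and `ħ` of weight one and `p` of weight zero. -/
def yWt {n : ℕ} (d : Expo n) : ℕ := (∑ a, d (yVar a)) + d hVar

/-- The weight with `p` and `ħ` of weight one and `y` of weight zero. -/
def pWt {n : ℕ} (d : Expo n) : ℕ := (∑ a, d (pVar a)) + d hVar

theorem fedosovDegree_eq {n : ℕ} (d : Expo n) : fedosovDegree d = yWt d + pWt d := by
  unfold fedosovDegree yWt pWt
  omega

theorem yWt_add {n : ℕ} (d e : Expo n) : yWt (d + e) = yWt d + yWt e := by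
  simp only [yWt, Finsupp.add_apply, Finset.sum_add_distrib]
  omega

theorem pWt_add {n : ℕ} (d e : Expo n) : pWt (d + e) = pWt d + pWt e := by
  simp only [pWt, Finsupp.add_apply, Finset.sum_add_distrib]
  omega

@[simp] theorem yWt_y {n : ℕ} (a : Fin n) (k : ℕ) :
    yWt (Finsupp.single (yVar a) k) = k := by
  simp [yWt, Finsupp.single_apply]

@[simp] theorem yWt_p {n : ℕ} (a : Fin n) (k : ℕ) :
    yWt (Finsupp.single (pVar a) k) = 0 := by
  simp [yWt]

@[simp] theorem yWt_h {n : ℕ} (k : ℕ) :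
    yWt (Finsupp.single (hVar (n := n)) k) = k := by
  simp [yWt]

@[simp] theorem pWt_y {n : ℕ} (a : Fin n) (k : ℕ) :
    pWt (Finsupp.single (yVar a) k) = 0 := by
  simp [pWt]

@[simp] theorem pWt_p {n : ℕ} (a : Fin n) (k : ℕ) :
    pWt (Finsupp.single (pVar a) k) = k := by
  simp [pWt, Finsupp.single_apply]

@[simp] theorem pWt_h {n : ℕ} (k : ℕ) :
    pWt (Finsupp.single (hVar (n := n)) k) = k := by
  simp [pWt]

/-! ### Bilinear operations of finite type -/

/-- The span of the functionals `f, g ↦ f_{d₁} g_{d₂}` with `R d₁ d₂`. -/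
def pairSpan {n : ℕ} (R : Expo n → Expo n → Prop) : Submodule ℝ (Weyl n → Weyl n → ℝ) :=
  Submodule.span ℝ {θ | ∃ d₁ d₂, R d₁ d₂ ∧ θ = fun f g => coeff d₁ f * coeff d₂ g}

theorem pairSpan_mono {n : ℕ} {R R' : Expo n → Expo n → Prop}
    (h : ∀ d₁ d₂, R d₁ d₂ → R' d₁ d₂) : pairSpan R ≤ pairSpan R' := by
  refine Submodule.span_mono ?_
  rintro θ ⟨d₁, d₂, hR, rfl⟩
  exact ⟨d₁, d₂, h _ _ hR, rfl⟩

theorem pairSpan_induction {n : ℕ} {R : Expo n → Expo n → Prop}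
    {motive : (θ : Weyl n → Weyl n → ℝ) → θ ∈ pairSpan R → Prop}
    (gen : ∀ d₁ d₂, ∀ hR : R d₁ d₂, motive (fun f g => coeff d₁ f * coeff d₂ g)
      (Submodule.subset_span ⟨d₁, d₂, hR, rfl⟩))
    (zero : motive 0 (Submodule.zero_mem _))
    (add : ∀ θ η hθ hη, motive θ hθ → motive η hη → motive (θ + η) (Submodule.add_mem _ hθ hη))
    (smul : ∀ (c : ℝ) θ hθ, motive θ hθ → motive (c • θ) (Submodule.smul_mem _ c hθ))
    {θ : Weyl n → Weyl n → ℝ} (hθ : θ ∈ pairSpan R) : motive θ hθ := by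
  refine Submodule.span_induction (p := motive) ?_ zero
    (fun θ η hθ hη => add θ η hθ hη) (fun c θ hθ => smul c θ hθ) hθ
  rintro _ ⟨d₁, d₂, hR, rfl⟩
  exact gen d₁ d₂ hR

/-- A derivative reads off the next coefficient up to an integer factor, so differentiating the
arguments only shifts the exponents in a generator. -/
theorem pairSpan_comp_pderiv {n : ℕ} {R R' : Expo n → Expo n → Prop} (u v : WeylVar n)
    (h : ∀ d₁ d₂, R d₁ d₂ → R' (d₁ + Finsupp.single u 1) (d₂ + Finsupp.single v 1))
    {θ : Weyl n → Weyl n → ℝ} (hθ : θ ∈ pairSpan R) :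
    (fun f g => θ (pderiv ℝ u f) (pderiv ℝ v g)) ∈ pairSpan R' := by
  induction hθ using pairSpan_induction with
  | gen d₁ d₂ hR =>
    have : (fun f g : Weyl n => coeff d₁ (pderiv ℝ u f) * coeff d₂ (pderiv ℝ v g)) =
        ((d₁ u + 1) * (d₂ v + 1) : ℝ) • fun f g : Weyl n =>
          coeff (d₁ + Finsupp.single u 1) f * coeff (d₂ + Finsupp.single v 1) g := by
      funext f g
      simp only [coeff_pderiv, Pi.smul_apply, smul_eq_mul]
      ring
    rw [this]
    exact Submodule.smul_mem _ _ (Submodule.subset_span ⟨_, _, h _ _ hR, rfl⟩)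
  | zero => exact Submodule.zero_mem _
  | add θ η _ _ hθ hη => exact Submodule.add_mem _ hθ hη
  | smul c θ _ hθ => exact Submodule.smul_mem _ c hθ

theorem pairSpan_add_left {n : ℕ} {R : Expo n → Expo n → Prop} {θ : Weyl n → Weyl n → ℝ}
    (hθ : θ ∈ pairSpan R) (f f' g : Weyl n) : θ (f + f') g = θ f g + θ f' g := by
  induction hθ using pairSpan_induction with
  | gen d₁ d₂ hR => simp [add_mul]
  | zero => simp
  | add θ η _ _ hθ hη => simp only [Pi.add_apply, hθ, hη]; ring
  | smul c θ _ hθ => simp only [Pi.smul_apply, hθ, smul_eq_mul]; ring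

theorem pairSpan_add_right {n : ℕ} {R : Expo n → Expo n → Prop} {θ : Weyl n → Weyl n → ℝ}
    (hθ : θ ∈ pairSpan R) (f g g' : Weyl n) : θ f (g + g') = θ f g + θ f g' := by
  induction hθ using pairSpan_induction with
  | gen d₁ d₂ hR => simp [mul_add]
  | zero => simp
  | add θ η _ _ hθ hη => simp only [Pi.add_apply, hθ, hη]; ring
  | smul c θ _ hθ => simp only [Pi.smul_apply, hθ, smul_eq_mul]; ring

theorem pairSpan_smul_left {n : ℕ} {R : Expo n → Expo n → Prop} {θ : Weyl n → Weyl n → ℝ}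
    (hθ : θ ∈ pairSpan R) (r : ℝ) (f g : Weyl n) : θ (r • f) g = r * θ f g := by
  induction hθ using pairSpan_induction with
  | gen d₁ d₂ hR => simp [mul_assoc]
  | zero => simp
  | add θ η _ _ hθ hη => simp only [Pi.add_apply, hθ, hη]; ring
  | smul c θ _ hθ => simp only [Pi.smul_apply, hθ, smul_eq_mul]; ring

theorem pairSpan_smul_right {n : ℕ} {R : Expo n → Expo n → Prop} {θ : Weyl n → Weyl n → ℝ}
    (hθ : θ ∈ pairSpan R) (r : ℝ) (f g : Weyl n) : θ f (r • g) = r * θ f g := by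
  induction hθ using pairSpan_induction with
  | gen d₁ d₂ hR => simp [mul_left_comm]
  | zero => simp
  | add θ η _ _ hθ hη => simp only [Pi.add_apply, hθ, hη]; ring
  | smul c θ _ hθ => simp only [Pi.smul_apply, hθ, smul_eq_mul]; ring

/-- The domain is a general normed space, but the point is simple: finite bilinear expressions in
smooth coefficients are smooth. -/
theorem pairSpan_contDiffOn {n : ℕ} {R : Expo n → Expo n → Prop} {θ : Weyl n → Weyl n → ℝ}
    (hθ : θ ∈ pairSpan R) {E : Type*} [NormedAddCommGroup E] [NormedSpace ℝ E] {S : Set E}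
    {F G : E → Weyl n} (hF : ∀ d, ContDiffOn ℝ ∞ (fun e => coeff d (F e)) S)
    (hG : ∀ d, ContDiffOn ℝ ∞ (fun e => coeff d (G e)) S) :
    ContDiffOn ℝ ∞ (fun e => θ (F e) (G e)) S := by
  induction hθ using pairSpan_induction with
  | gen d₁ d₂ hR => exact (hF d₁).mul (hG d₂)
  | zero => exact contDiffOn_const
  | add θ η _ _ hθ hη => exact hθ.add hη
  | smul c θ _ hθ => exact (contDiffOn_const (c := c)).smul hθ

theorem pairSpan_eq_zero {n : ℕ} {R : Expo n → Expo n → Prop} {θ : Weyl n → Weyl n → ℝ}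
    (hθ : θ ∈ pairSpan R) {f g : Weyl n}
    (h : ∀ d₁ d₂, R d₁ d₂ → coeff d₁ f = 0 ∨ coeff d₂ g = 0) : θ f g = 0 := by
  induction hθ using pairSpan_induction with
  | gen d₁ d₂ hR => rcases h d₁ d₂ hR with h | h <;> simp [h]
  | zero => rfl
  | add θ η _ _ hθ hη => simp [hθ, hη]
  | smul c θ _ hθ => simp [hθ]

/-- Allows an argument to be replaced by a polynomial or by a truncated series when a single output
coefficient is computed. -/
theorem pairSpan_finite_dependence {n : ℕ} {R : Expo n → Expo n → Prop}
    {θ : Weyl n → Weyl n → ℝ} (hθ : θ ∈ pairSpan R) :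
    ∃ S : Finset (Expo n), ∀ f f' g g' : Weyl n, (∀ e ∈ S, coeff e f = coeff e f') →
      (∀ e ∈ S, coeff e g = coeff e g') → θ f g = θ f' g' := by
  classical
  induction hθ using pairSpan_induction with
  | gen d₁ d₂ hR =>
    refine ⟨{d₁, d₂}, fun f f' g g' hf hg => ?_⟩
    dsimp only
    rw [hf d₁ (by simp), hg d₂ (by simp)]
  | zero => exact ⟨∅, fun _ _ _ _ _ _ => rfl⟩
  | add θ η _ _ hθ hη =>
    obtain ⟨S, hS⟩ := hθ
    obtain ⟨T, hT⟩ := hη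
    refine ⟨S ∪ T, fun f f' g g' hf hg => ?_⟩
    simp only [Pi.add_apply]
    rw [hS f f' g g' (fun e he => hf e (Finset.mem_union_left _ he))
        (fun e he => hg e (Finset.mem_union_left _ he)),
      hT f f' g g' (fun e he => hf e (Finset.mem_union_right _ he))
        (fun e he => hg e (Finset.mem_union_right _ he))]
  | smul c θ _ hθ =>
    obtain ⟨S, hS⟩ := hθ
    refine ⟨S, fun f f' g g' hf hg => ?_⟩
    simp only [Pi.smul_apply]
    rw [hS f f' g g' hf hg]

/-- Source of the Leibniz rule in `x` for all the products: each coefficient is a finite sum of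
products of functions of `x`. Differentiability is carried along because the sum rule needs it in
the induction. -/
theorem pairSpan_partialDeriv {n : ℕ} {R : Expo n → Expo n → Prop} {θ : Weyl n → Weyl n → ℝ}
    (hθ : θ ∈ pairSpan R) (μ : Fin n) {x : Pt n} {F G : Sec n}
    (hF : ∀ d, DifferentiableAt ℝ (fun z => coeff d (F z)) x)
    (hG : ∀ d, DifferentiableAt ℝ (fun z => coeff d (G z)) x) :
    DifferentiableAt ℝ (fun z => θ (F z) (G z)) x ∧
      partialDeriv μ (fun z => θ (F z) (G z)) x =
        θ (dX μ F x) (G x) + θ (F x) (dX μ G x) := by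
  induction hθ using pairSpan_induction with
  | gen d₁ d₂ hR =>
    refine ⟨(hF d₁).mul (hG d₂), ?_⟩
    unfold partialDeriv
    rw [fderiv_fun_mul (hF d₁) (hG d₂)]
    simp only [add_apply, smul_apply, smul_eq_mul]
    change _ = partialDeriv μ _ x * _ + _ * partialDeriv μ _ x
    unfold partialDeriv
    ring
  | zero =>
    refine ⟨differentiableAt_const 0, ?_⟩
    simp [partialDeriv]
  | add θ η _ _ hθ hη =>
    refine ⟨hθ.1.add hη.1, ?_⟩
    have : partialDeriv μ (fun z => (θ + η) (F z) (G z)) x =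
        partialDeriv μ (fun z => θ (F z) (G z)) x + partialDeriv μ (fun z => η (F z) (G z)) x := by
      unfold partialDeriv
      simp only [Pi.add_apply]
      rw [fderiv_fun_add hθ.1 hη.1, add_apply]
    rw [this, hθ.2, hη.2]
    simp only [Pi.add_apply]
    ring
  | smul c θ _ hθ =>
    refine ⟨hθ.1.const_mul c, ?_⟩
    have : partialDeriv μ (fun z => (c • θ) (F z) (G z)) x =
        c * partialDeriv μ (fun z => θ (F z) (G z)) x := by
      unfold partialDeriv
      simp only [Pi.smul_apply, smul_eq_mul]
      rw [fderiv_const_mul hθ.1, smul_apply, smul_eq_mul]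
    rw [this, hθ.2]
    simp only [Pi.smul_apply, smul_eq_mul]
    ring

/-- `B` is bilinear, each coefficient of `B f g` involves finitely many coefficients of `f` and
`g`, and `B` lowers both weights by `k`. -/
def IsFinBil {n : ℕ} (k : ℕ) (B : Weyl n → Weyl n → Weyl n) : Prop :=
  ∀ d, (fun f g => coeff d (B f g)) ∈ pairSpan fun d₁ d₂ =>
    yWt d₁ + yWt d₂ = yWt d + k ∧ pWt d₁ + pWt d₂ = pWt d + k

namespace IsFinBil

variable {n k : ℕ} {B B' : Weyl n → Weyl n → Weyl n}

theorem mul : IsFinBil 0 (fun f g : Weyl n => f * g) := by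
  classical
  intro d
  have : (fun f g : Weyl n => coeff d (f * g)) =
      ∑ p ∈ Finset.HasAntidiagonal.antidiagonal d, fun f g : Weyl n => coeff p.1 f * coeff p.2 g := by
    funext f g
    simp only [coeff_mul, Finset.sum_apply]
  rw [this]
  refine Submodule.sum_mem _ fun p hp => Submodule.subset_span ⟨_, _, ?_, rfl⟩
  rw [Finset.HasAntidiagonal.mem_antidiagonal] at hp
  rw [← hp, yWt_add, pWt_add]
  exact ⟨rfl, rfl⟩

theorem sub (h : IsFinBil k B) (h' : IsFinBil k B') :
    IsFinBil k (fun f g => B f g - B' f g) := by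
  intro d
  exact Submodule.sub_mem _ (h d) (h' d)

theorem swap (h : IsFinBil k B) : IsFinBil k (fun f g => B g f) := by
  intro d
  have key : ∀ θ ∈ pairSpan (fun d₁ d₂ : Expo n =>
      yWt d₁ + yWt d₂ = yWt d + k ∧ pWt d₁ + pWt d₂ = pWt d + k),
      (fun f g => θ g f) ∈ pairSpan (fun d₁ d₂ : Expo n =>
        yWt d₁ + yWt d₂ = yWt d + k ∧ pWt d₁ + pWt d₂ = pWt d + k) := by
    intro θ hθ
    induction hθ using pairSpan_induction with
    | gen d₁ d₂ hR =>
      refine Submodule.subset_span ⟨d₂, d₁, ⟨by omega, by omega⟩, ?_⟩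
      funext f g
      exact mul_comm _ _
    | zero => exact Submodule.zero_mem _
    | add θ η _ _ hθ hη => exact Submodule.add_mem _ hθ hη
    | smul c θ _ hθ => exact Submodule.smul_mem _ c hθ
  exact key _ (h d)

theorem sum {ι : Type*} (s : Finset ι) {B : ι → Weyl n → Weyl n → Weyl n}
    (h : ∀ i ∈ s, IsFinBil k (B i)) : IsFinBil k (fun f g => ∑ i ∈ s, B i f g) := by
  intro d
  have : (fun f g : Weyl n => coeff d (∑ i ∈ s, B i f g)) =
      ∑ i ∈ s, fun f g => coeff d (B i f g) := by
    funext f g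
    simp only [map_sum, Finset.sum_apply]
  rw [this]
  exact Submodule.sum_mem _ fun i hi => h i hi d

theorem smul (c : ℝ) (h : IsFinBil k B) : IsFinBil k (fun f g => c • B f g) := by
  intro d
  exact Submodule.smul_mem _ c (h d)

/-- Removing one `y` and one `p`, wherever they are, costs one unit of each of the two weights. -/
theorem comp_dY_dP (h : IsFinBil k B) (a b : Fin n) :
    IsFinBil (k + 1) (fun f g => B (dY a f) (dP b g)) := by
  intro d
  refine pairSpan_comp_pderiv _ _ ?_ (h d)
  intro d₁ d₂ hR
  simp only [yWt_add, pWt_add, yWt_y, yWt_p, pWt_y, pWt_p]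
  omega

theorem comp_dP_dY (h : IsFinBil k B) (a b : Fin n) :
    IsFinBil (k + 1) (fun f g => B (dP a f) (dY b g)) := by
  intro d
  refine pairSpan_comp_pderiv _ _ ?_ (h d)
  intro d₁ d₂ hR
  simp only [yWt_add, pWt_add, yWt_y, yWt_p, pWt_y, pWt_p]
  omega

/-- Each factor `ħ` restores exactly the unit of both weights lost to one Poisson contraction, so
the star product preserves both weights. -/
theorem hbarSum {B : ℕ → Weyl n → Weyl n → Weyl n} (h : ∀ k, IsFinBil k (B k)) :
    IsFinBil 0 (fun f g => SegalGauge.hbarSum fun k => B k f g) := by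
  intro d
  have : (fun f g : Weyl n => coeff d (SegalGauge.hbarSum fun k => B k f g)) =
      ∑ k ∈ Finset.range (d hVar + 1), fun f g =>
        coeff (d - Finsupp.single hVar k) (B k f g) := by
    funext f g
    simp only [Finset.sum_apply]
    rfl
  rw [this]
  refine Submodule.sum_mem _ fun k hk => pairSpan_mono ?_ (h k _)
  intro d₁ d₂ hR
  have hle : Finsupp.single hVar k ≤ d := by
    rw [Finsupp.single_le_iff]
    have := Finset.mem_range.1 hk
    omega
  obtain ⟨e, rfl⟩ := exists_add_of_le hle
  rw [add_tsub_cancel_left] at hR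
  simp only [yWt_add, pWt_add, yWt_h, pWt_h]
  omega

theorem divHbar (h : IsFinBil 0 B) : IsFinBil 1 (fun f g => SegalGauge.divHbar (B f g)) := by
  intro d
  refine pairSpan_mono ?_ (h (d + Finsupp.single hVar 1))
  intro d₁ d₂ hR
  simp only [yWt_add, pWt_add, yWt_h, pWt_h] at hR
  omega

/-- The bilinear map underlying an operation of finite type. -/
def bilin (h : IsFinBil k B) : Weyl n →ₗ[ℝ] Weyl n →ₗ[ℝ] Weyl n :=
  LinearMap.mk₂ ℝ B
    (fun f f' g => by ext d; exact pairSpan_add_left (h d) f f' g)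
    (fun r f g => by ext d; exact pairSpan_smul_left (h d) r f g)
    (fun f g g' => by ext d; exact pairSpan_add_right (h d) f g g')
    (fun r f g => by ext d; exact pairSpan_smul_right (h d) r f g)

end IsFinBil

theorem isFinBil_poissonPow {n : ℕ} (k : ℕ) :
    IsFinBil k (poissonPow (n := n) (R := Weyl n) dY dP k) := by
  induction k with
  | zero => exact IsFinBil.mul
  | succ k ih => exact IsFinBil.sum _ fun a _ => (ih.comp_dY_dP a a).sub (ih.comp_dP_dY a a)

theorem isFinBil_star {n : ℕ} : IsFinBil 0 (star (n := n)) :=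
  IsFinBil.hbarSum fun k => (isFinBil_poissonPow k).smul (moyalCoeff k)

theorem isFinBil_bracket {n : ℕ} : IsFinBil 1 (bracket (n := n)) :=
  (isFinBil_star.sub isFinBil_star.swap).divHbar

/-- The star product as a bilinear map. -/
def starL {n : ℕ} : Weyl n →ₗ[ℝ] Weyl n →ₗ[ℝ] Weyl n := isFinBil_star.bilin

/-- The rescaled star commutator as a bilinear map. -/
def bracketL {n : ℕ} : Weyl n →ₗ[ℝ] Weyl n →ₗ[ℝ] Weyl n := isFinBil_bracket.bilin

/-- The powers of the Poisson bidifferential operator as bilinear maps. -/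
def poissonL {n : ℕ} (k : ℕ) : Weyl n →ₗ[ℝ] Weyl n →ₗ[ℝ] Weyl n := (isFinBil_poissonPow k).bilin

theorem star_eq {n : ℕ} (f g : Weyl n) : star f g = starL f g := rfl

theorem bracket_eq {n : ℕ} (f g : Weyl n) : bracket f g = bracketL f g := rfl

theorem poissonPow_eq {n : ℕ} (k : ℕ) (f g : Weyl n) :
    poissonPow dY dP k f g = poissonL k f g := rfl

/-! ### Series in `ħ` -/

/-- The variable `ħ` as an element of the Weyl algebra. -/
abbrev hbar {n : ℕ} : Weyl n := X hVar

theorem coeff_hbar_pow_mul {n : ℕ} (k : ℕ) (f : Weyl n) (d : Expo n) :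
    coeff d (hbar ^ k * f) =
      if k ≤ d hVar then coeff (d - Finsupp.single hVar k) f else 0 := by
  rw [X_pow_eq, coeff_monomial_mul, one_mul]
  simp only [Finsupp.single_le_iff]

theorem coeff_hbarSum {n : ℕ} (c : ℕ → Weyl n) (d : Expo n) {N : ℕ} (hN : d hVar < N) :
    coeff d (hbarSum c) = ∑ k ∈ Finset.range N, coeff d (hbar ^ k * c k) := by
  have h1 : coeff d (hbarSum c) =
      ∑ k ∈ Finset.range (d hVar + 1), coeff d (hbar ^ k * c k) := by
    change ∑ k ∈ Finset.range (d hVar + 1), coeff (d - Finsupp.single hVar k) (c k) = _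
    refine Finset.sum_congr rfl fun k hk => ?_
    rw [coeff_hbar_pow_mul, if_pos (by have := Finset.mem_range.1 hk; omega)]
  rw [h1]
  refine Finset.sum_subset (Finset.range_subset_range.2 hN) fun k _ hk => ?_
  rw [coeff_hbar_pow_mul, if_neg]
  rw [Finset.mem_range] at hk
  omega

theorem hbarSum_add {n : ℕ} (c c' : ℕ → Weyl n) :
    hbarSum (fun k => c k + c' k) = hbarSum c + hbarSum c' := by
  ext d
  rw [map_add, coeff_hbarSum _ d (Nat.lt_succ_self _), coeff_hbarSum _ d (Nat.lt_succ_self _),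
    coeff_hbarSum _ d (Nat.lt_succ_self _), ← Finset.sum_add_distrib]
  simp only [mul_add, map_add]

/-- All factors of a monomial have `ħ`-degree at most that of the monomial, so the sums can be taken
over one common range and exchanged. -/
theorem hbarSum_mul {n : ℕ} (u : Weyl n) (c : ℕ → Weyl n) :
    hbarSum (fun k => u * c k) = u * hbarSum c := by
  classical
  ext d
  rw [coeff_mul, coeff_hbarSum _ d (Nat.lt_succ_self _)]
  have : ∀ p ∈ Finset.HasAntidiagonal.antidiagonal d, coeff p.1 u * coeff p.2 (hbarSum c) =
      ∑ k ∈ Finset.range (d hVar + 1), coeff p.1 u * coeff p.2 (hbar ^ k * c k) := by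
    intro p hp
    rw [Finset.HasAntidiagonal.mem_antidiagonal] at hp
    rw [coeff_hbarSum c p.2 (N := d hVar + 1), Finset.mul_sum]
    rw [← hp, Finsupp.add_apply]
    omega
  rw [Finset.sum_congr rfl this, Finset.sum_comm]
  refine Finset.sum_congr rfl fun k _ => ?_
  rw [← coeff_mul, mul_left_comm]

theorem hbarSum_succ {n : ℕ} (c : ℕ → Weyl n) :
    hbarSum c = c 0 + hbar * hbarSum (fun k => c (k + 1)) := by
  rw [← hbarSum_mul]
  ext d
  rw [map_add (coeff d), coeff_hbarSum c d (N := d hVar + 2) (by omega), Finset.sum_range_succ',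
    coeff_hbarSum _ d (Nat.lt_succ_self _), pow_zero, one_mul, add_comm]
  congr 1
  refine Finset.sum_congr rfl fun k _ => ?_
  rw [pow_succ, mul_assoc]

theorem hbar_mul_cancel {n : ℕ} {f g : Weyl n} (h : hbar * f = hbar * g) : f = g := by
  ext d
  have := congrArg (coeff (Finsupp.single hVar 1 + d)) h
  change coeff _ (monomial _ 1 * f) = coeff _ (monomial _ 1 * g) at this
  rwa [coeff_add_monomial_mul, coeff_add_monomial_mul, one_mul, one_mul] at this

/-! ### Derivations of the star product -/

/-- A derivation that commutes with all `D a`, `E a` passes through the constant-coefficient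
bidifferential operator and meets only the final multiplication. -/
theorem poissonPow_leibniz {n : ℕ} {R : Type} [CommRing R] {D E : Fin n → R → R} {T : R → R}
    (hadd : ∀ f g, T (f + g) = T f + T g) (hT : ∀ f g, T (f * g) = T f * g + f * T g)
    (hD : ∀ a f, T (D a f) = D a (T f)) (hE : ∀ a f, T (E a f) = E a (T f)) (k : ℕ) (f g : R) :
    T (poissonPow D E k f g) = poissonPow D E k (T f) g + poissonPow D E k f (T g) := by
  have h0 : T 0 = 0 := by simpa using hadd 0 0
  have hneg : ∀ f, T (-f) = -T f := fun f => by
    have := hadd f (-f)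
    rw [add_neg_cancel, h0] at this
    exact (neg_eq_of_add_eq_zero_right this.symm).symm
  have hsum : ∀ (s : Finset (Fin n)) (F : Fin n → R), T (∑ a ∈ s, F a) = ∑ a ∈ s, T (F a) := by
    intro s F
    exact map_sum (AddMonoidHom.mk' T hadd) F s
  induction k generalizing f g with
  | zero => exact hT f g
  | succ k ih =>
    simp only [poissonPow]
    rw [hsum, ← Finset.sum_add_distrib]
    refine Finset.sum_congr rfl fun a _ => ?_
    rw [sub_eq_add_neg, hadd, hneg, ih, ih, hD, hE, hD, hE]
    ring

theorem pderiv_comm {n : ℕ} (u v : WeylVar n) (f : Weyl n) :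
    pderiv ℝ u (pderiv ℝ v f) = pderiv ℝ v (pderiv ℝ u f) := by
  classical
  ext d
  simp only [coeff_pderiv, Finsupp.add_apply]
  rw [add_right_comm]
  by_cases h : u = v
  · subst h; rfl
  · rw [Finsupp.single_eq_of_ne (Ne.symm h), Finsupp.single_eq_of_ne h]
    ring_nf

theorem pderiv_leibniz {n : ℕ} (u : WeylVar n) (f g : Weyl n) :
    pderiv ℝ u (f * g) = pderiv ℝ u f * g + f * pderiv ℝ u g := by
  rw [Derivation.leibniz, smul_eq_mul, smul_eq_mul]
  ring

theorem pderiv_hbarSum {n : ℕ} {u : WeylVar n} (hu : u ≠ hVar) (c : ℕ → Weyl n) :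
    pderiv ℝ u (hbarSum c) = hbarSum fun k => pderiv ℝ u (c k) := by
  ext d
  have hd : (d + Finsupp.single u 1 : Expo n) hVar = d hVar := by
    rw [Finsupp.add_apply, Finsupp.single_eq_of_ne hu.symm, add_zero]
  rw [coeff_pderiv, coeff_hbarSum c _ (N := d hVar + 1) (by omega),
    coeff_hbarSum _ d (Nat.lt_succ_self _), Finset.sum_mul]
  refine Finset.sum_congr rfl fun k _ => ?_
  rw [← coeff_pderiv, pderiv_leibniz, Derivation.leibniz_pow,
    pderiv_X_of_ne hu.symm]
  simp

theorem pderiv_star {n : ℕ} {u : WeylVar n} (hu : u ≠ hVar) (f g : Weyl n) :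
    pderiv ℝ u (star f g) = star (pderiv ℝ u f) g + star f (pderiv ℝ u g) := by
  unfold star
  rw [pderiv_hbarSum hu, ← hbarSum_add]
  congr 1
  funext k
  rw [Derivation.map_smul, ← smul_add, poissonPow_leibniz (D := dY) (E := dP) (T := pderiv ℝ u)
    (map_add _) (pderiv_leibniz u) (fun a f => pderiv_comm _ _ f) (fun a f => pderiv_comm _ _ f)]

theorem dY_star {n : ℕ} (a : Fin n) (f g : Weyl n) :
    dY a (star f g) = star (dY a f) g + star f (dY a g) := pderiv_star (by simp) f g

theorem dP_star {n : ℕ} (a : Fin n) (f g : Weyl n) :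
    dP a (star f g) = star (dP a f) g + star f (dP a g) := pderiv_star (by simp) f g

/-! ### Linear elements -/

/-- The Hamiltonian vector field `f ↦ {u, f}` of `u` with constant derivatives
`∂u/∂y^a = α a`, `∂u/∂p_a = β a`. -/
def linHam {n : ℕ} (α β : Fin n → ℝ) (f : Weyl n) : Weyl n :=
  ∑ a, (α a • dP a f - β a • dY a f)

theorem dP_add {n : ℕ} (a : Fin n) (f g : Weyl n) : dP a (f + g) = dP a f + dP a g := map_add _ _ _

theorem dY_smul {n : ℕ} (a : Fin n) (r : ℝ) (f : Weyl n) : dY a (r • f) = r • dY a f :=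
  Derivation.map_smul (pderiv ℝ (yVar a)) r f

theorem dP_smul {n : ℕ} (a : Fin n) (r : ℝ) (f : Weyl n) : dP a (r • f) = r • dP a f :=
  Derivation.map_smul (pderiv ℝ (pVar a)) r f

theorem dY_sum {n : ℕ} {ι : Type*} (s : Finset ι) (a : Fin n) (f : ι → Weyl n) :
    dY a (∑ i ∈ s, f i) = ∑ i ∈ s, dY a (f i) := map_sum (pderiv ℝ (yVar a)) f s

theorem dP_sum {n : ℕ} {ι : Type*} (s : Finset ι) (a : Fin n) (f : ι → Weyl n) :
    dP a (∑ i ∈ s, f i) = ∑ i ∈ s, dP a (f i) := map_sum (pderiv ℝ (pVar a)) f s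

theorem dY_sub {n : ℕ} (a : Fin n) (f g : Weyl n) : dY a (f - g) = dY a f - dY a g := map_sub _ _ _

theorem dP_sub {n : ℕ} (a : Fin n) (f g : Weyl n) : dP a (f - g) = dP a f - dP a g := map_sub _ _ _

theorem dY_linHam {n : ℕ} (α β : Fin n → ℝ) (a : Fin n) (f : Weyl n) :
    dY a (linHam α β f) = linHam α β (dY a f) := by
  simp only [linHam, dY_sum, dY_sub, dY_smul]
  refine Finset.sum_congr rfl fun b _ => ?_
  rw [show dY a (dP b f) = dP b (dY a f) from pderiv_comm _ _ f,
    show dY a (dY b f) = dY b (dY a f) from pderiv_comm _ _ f]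

theorem dP_linHam {n : ℕ} (α β : Fin n → ℝ) (a : Fin n) (f : Weyl n) :
    dP a (linHam α β f) = linHam α β (dP a f) := by
  simp only [linHam, dP_sum, dP_sub, dP_smul]
  refine Finset.sum_congr rfl fun b _ => ?_
  rw [show dP a (dP b f) = dP b (dP a f) from pderiv_comm _ _ f,
    show dP a (dY b f) = dY b (dP a f) from pderiv_comm _ _ f]

/-- `u` has constant derivatives `∂u/∂y^a = α a`, `∂u/∂p_a = β a`. -/
structure IsLin {n : ℕ} (u : Weyl n) (α β : Fin n → ℝ) : Prop where
  dY_eq : ∀ a, dY a u = C (α a)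
  dP_eq : ∀ a, dP a u = C (β a)

theorem isLin_one {n : ℕ} : IsLin (1 : Weyl n) 0 0 where
  dY_eq a := by simp [dY]
  dP_eq a := by simp [dP]

theorem isLin_y {n : ℕ} (b : Fin n) : IsLin (X (yVar b) : Weyl n) (Pi.single b 1) 0 where
  dY_eq a := by
    by_cases h : b = a
    · subst h; simp [dY]
    · simp [dY, h, Ne.symm h]
  dP_eq a := by simp [dP]

theorem isLin_p {n : ℕ} (b : Fin n) : IsLin (X (pVar b) : Weyl n) 0 (Pi.single b 1) where
  dY_eq a := by simp [dY]
  dP_eq a := by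
    by_cases h : b = a
    · subst h; simp [dP]
    · simp [dP, h, Ne.symm h]

theorem linHam_zero {n : ℕ} (f : Weyl n) : linHam 0 0 f = 0 := by simp [linHam]

theorem linHam_y {n : ℕ} (b : Fin n) (f : Weyl n) : linHam (Pi.single b 1) 0 f = dP b f := by
  simp [linHam, Pi.single_apply]

theorem linHam_p {n : ℕ} (b : Fin n) (f : Weyl n) : linHam 0 (Pi.single b 1) f = -dY b f := by
  simp [linHam, Pi.single_apply]

/-- The Poisson bidifferential operator is antisymmetric, and multiplication is commutative. -/
theorem poissonPow_swap {n : ℕ} (k : ℕ) (f g : Weyl n) :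
    poissonPow dY dP k f g = (-1) ^ k * poissonPow dY dP k g f := by
  induction k generalizing f g with
  | zero => simp [poissonPow, mul_comm]
  | succ k ih =>
    simp only [poissonPow]
    rw [Finset.mul_sum]
    refine Finset.sum_congr rfl fun a _ => ?_
    rw [ih (dY a f), ih (dP a f)]
    ring

theorem IsLin.dY_mul {n : ℕ} {u : Weyl n} {α β : Fin n → ℝ} (h : IsLin u α β) (a : Fin n)
    (f : Weyl n) : dY a (u * f) = α a • f + u * dY a f := by
  rw [smul_eq_C_mul, ← h.dY_eq]
  exact pderiv_leibniz _ _ _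

theorem IsLin.dP_mul {n : ℕ} {u : Weyl n} {α β : Fin n → ℝ} (h : IsLin u α β) (a : Fin n)
    (f : Weyl n) : dP a (u * f) = β a • f + u * dP a f := by
  rw [smul_eq_C_mul, ← h.dP_eq]
  exact pderiv_leibniz _ _ _

theorem poissonPow_linHam_right {n : ℕ} (α β : Fin n → ℝ) (k : ℕ) (f g : Weyl n) :
    poissonPow dY dP k f (linHam α β g) =
      ∑ a, (α a • poissonPow dY dP k f (dP a g) - β a • poissonPow dY dP k f (dY a g)) := by
  simp only [poissonPow_eq, linHam, map_sum, map_sub, map_smul]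

/-- Second derivatives of `u` vanish, so at most one of the `k + 1` contractions can hit `u`.
Choosing which one gives the factor `k + 1`, and that contraction leaves `linHam` on `g`. -/
theorem IsLin.poissonPow_mul_left {n : ℕ} {u : Weyl n} {α β : Fin n → ℝ} (h : IsLin u α β)
    (k : ℕ) (f g : Weyl n) :
    poissonPow dY dP (k + 1) (u * f) g = u * poissonPow dY dP (k + 1) f g +
      (k + 1 : ℝ) • poissonPow dY dP k f (linHam α β g) := by
  induction k generalizing f g with
  | zero =>
    simp only [poissonPow, h.dY_mul, h.dP_mul]
    simp only [linHam, Finset.mul_sum, zero_add, Nat.cast_zero, one_smul]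
    rw [← Finset.sum_add_distrib]
    refine Finset.sum_congr rfl fun a _ => ?_
    simp only [smul_eq_C_mul]
    ring
  | succ k ih =>
    have h1 : ∀ f' g' : Weyl n, poissonPow dY dP (k + 1) f' g' =
      ∑ a, (poissonPow dY dP k (dY a f') (dP a g') -
        poissonPow dY dP k (dP a f') (dY a g')) := fun _ _ => rfl
    have h2 : ∀ f' g' : Weyl n, poissonPow dY dP (k + 1 + 1) f' g' =
      ∑ a, (poissonPow dY dP (k + 1) (dY a f') (dP a g') -
        poissonPow dY dP (k + 1) (dP a f') (dY a g')) := fun _ _ => rfl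
    have hadd : ∀ (r : ℝ) (f' f'' g' : Weyl n), poissonPow dY dP (k + 1) (r • f' + f'') g' =
        r • poissonPow dY dP (k + 1) f' g' + poissonPow dY dP (k + 1) f'' g' := fun r f' f'' g' => by
      simp only [poissonPow_eq, map_add, map_smul, LinearMap.add_apply, LinearMap.smul_apply]
    rw [h2]
    simp only [h.dY_mul, h.dP_mul, hadd, ih]
    have h3 : ∀ a, (α a • poissonPow dY dP (k + 1) f (dP a g) +
        (u * poissonPow dY dP (k + 1) (dY a f) (dP a g) +
          (k + 1 : ℝ) • poissonPow dY dP k (dY a f) (linHam α β (dP a g))) -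
        (β a • poissonPow dY dP (k + 1) f (dY a g) +
          (u * poissonPow dY dP (k + 1) (dP a f) (dY a g) +
            (k + 1 : ℝ) • poissonPow dY dP k (dP a f) (linHam α β (dY a g))))) =
        (α a • poissonPow dY dP (k + 1) f (dP a g) - β a • poissonPow dY dP (k + 1) f (dY a g)) +
        u * (poissonPow dY dP (k + 1) (dY a f) (dP a g) -
          poissonPow dY dP (k + 1) (dP a f) (dY a g)) +
        (k + 1 : ℝ) • (poissonPow dY dP k (dY a f) (dP a (linHam α β g)) -
          poissonPow dY dP k (dP a f) (dY a (linHam α β g))) := by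
      intro a
      rw [dY_linHam, dP_linHam, mul_sub, smul_sub]
      abel
    simp only [h3]
    rw [Finset.sum_add_distrib, Finset.sum_add_distrib, ← Finset.mul_sum, ← Finset.smul_sum,
      ← h2, ← h1, ← poissonPow_linHam_right]
    push_cast
    module

theorem moyalCoeff_zero : moyalCoeff 0 = 1 := by simp [moyalCoeff]

/-- The exponential series is what turns the factor `k + 1` from the Leibniz rule into the constant
`1/2`, so that multiplication by a linear element closes up on star products. -/
theorem moyalCoeff_succ (k : ℕ) : moyalCoeff (k + 1) * (k + 1) = 2⁻¹ * moyalCoeff k := by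
  unfold moyalCoeff
  rw [Nat.factorial_succ]
  push_cast
  have : (k ! : ℝ) ≠ 0 := by positivity
  rw [pow_succ]
  field_simp

theorem hbarSum_smul {n : ℕ} (r : ℝ) (c : ℕ → Weyl n) :
    hbarSum (fun k => r • c k) = r • hbarSum c := by
  simp only [smul_eq_C_mul]
  exact hbarSum_mul _ _

theorem IsLin.star_mul_left {n : ℕ} {u : Weyl n} {α β : Fin n → ℝ} (h : IsLin u α β)
    (f g : Weyl n) :
    star (u * f) g = u * star f g + (2⁻¹ : ℝ) • (hbar * star f (linHam α β g)) := by
  have h1 : star (u * f) g = (u * f) * g + hbar * hbarSum (fun k =>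
      moyalCoeff (k + 1) • poissonPow dY dP (k + 1) (u * f) g) := by
    rw [star, hbarSum_succ, moyalCoeff_zero, one_smul]
    rfl
  have h2 : star f g = f * g + hbar * hbarSum (fun k =>
      moyalCoeff (k + 1) • poissonPow dY dP (k + 1) f g) := by
    rw [star, hbarSum_succ, moyalCoeff_zero, one_smul]
    rfl
  have h3 : (fun k => moyalCoeff (k + 1) • poissonPow dY dP (k + 1) (u * f) g) = fun k =>
      u * (moyalCoeff (k + 1) • poissonPow dY dP (k + 1) f g) +
        (2⁻¹ : ℝ) • (moyalCoeff k • poissonPow dY dP k f (linHam α β g)) := by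
    funext k
    rw [h.poissonPow_mul_left, smul_add, smul_smul, smul_smul, moyalCoeff_succ, mul_smul_comm]
  rw [h1, h3, hbarSum_add, hbarSum_mul, hbarSum_smul, h2]
  change _ = _ + (2⁻¹ : ℝ) • (hbar * hbarSum _)
  simp only [smul_eq_C_mul]
  ring

theorem IsLin.poissonPow_mul_right {n : ℕ} {u : Weyl n} {α β : Fin n → ℝ} (h : IsLin u α β)
    (k : ℕ) (f g : Weyl n) :
    poissonPow dY dP (k + 1) f (u * g) = u * poissonPow dY dP (k + 1) f g -
      (k + 1 : ℝ) • poissonPow dY dP k (linHam α β f) g := by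
  rw [poissonPow_swap, h.poissonPow_mul_left, poissonPow_swap (k + 1) f g,
    poissonPow_swap k (linHam α β f) g]
  simp only [smul_eq_C_mul]
  ring

theorem IsLin.star_mul_right {n : ℕ} {u : Weyl n} {α β : Fin n → ℝ} (h : IsLin u α β)
    (f g : Weyl n) :
    star f (u * g) = u * star f g - (2⁻¹ : ℝ) • (hbar * star (linHam α β f) g) := by
  have h1 : star f (u * g) = f * (u * g) + hbar * hbarSum (fun k =>
      moyalCoeff (k + 1) • poissonPow dY dP (k + 1) f (u * g)) := by
    rw [star, hbarSum_succ, moyalCoeff_zero, one_smul]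
    rfl
  have h2 : star f g = f * g + hbar * hbarSum (fun k =>
      moyalCoeff (k + 1) • poissonPow dY dP (k + 1) f g) := by
    rw [star, hbarSum_succ, moyalCoeff_zero, one_smul]
    rfl
  have h3 : (fun k => moyalCoeff (k + 1) • poissonPow dY dP (k + 1) f (u * g)) = fun k =>
      u * (moyalCoeff (k + 1) • poissonPow dY dP (k + 1) f g) +
        (-2⁻¹ : ℝ) • (moyalCoeff k • poissonPow dY dP k (linHam α β f) g) := by
    funext k
    rw [h.poissonPow_mul_right, smul_sub, smul_smul, smul_smul, moyalCoeff_succ, mul_smul_comm,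
      neg_mul, neg_smul, sub_eq_add_neg]
  rw [h1, h3, hbarSum_add, hbarSum_mul, hbarSum_smul, h2]
  change _ = _ - (2⁻¹ : ℝ) • (hbar * hbarSum _)
  simp only [smul_eq_C_mul, map_neg]
  ring

theorem poissonPow_succ_one_left {n : ℕ} (k : ℕ) (f : Weyl n) :
    poissonPow dY dP (k + 1) 1 f = 0 := by
  simp only [poissonPow, isLin_one.dY_eq, isLin_one.dP_eq]
  simp [poissonPow_eq]

theorem star_one_left {n : ℕ} (f : Weyl n) : star 1 f = f := by
  have : hbarSum (fun _ => (0 : Weyl n)) = 0 := by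
    have := hbarSum_smul (n := n) 0 (fun _ => 0)
    simpa using this
  rw [star, hbarSum_succ]
  simp only [poissonPow_succ_one_left, smul_zero, this, moyalCoeff_zero]
  simp [poissonPow]

theorem star_one_right {n : ℕ} (f : Weyl n) : star f 1 = f := by
  have : hbarSum (fun _ => (0 : Weyl n)) = 0 := by
    have := hbarSum_smul (n := n) 0 (fun _ => 0)
    simpa using this
  rw [star, hbarSum_succ]
  simp only [poissonPow_swap _ f 1, poissonPow_succ_one_left, smul_zero, mul_zero, this,
    moyalCoeff_zero]
  simp [poissonPow]

theorem IsLin.star_left {n : ℕ} {u : Weyl n} {α β : Fin n → ℝ} (h : IsLin u α β) (f : Weyl n) :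
    star u f = u * f + (2⁻¹ : ℝ) • (hbar * linHam α β f) := by
  have := h.star_mul_left 1 f
  rwa [mul_one, star_one_left, star_one_left] at this

theorem IsLin.star_right {n : ℕ} {u : Weyl n} {α β : Fin n → ℝ} (h : IsLin u α β) (f : Weyl n) :
    star f u = u * f - (2⁻¹ : ℝ) • (hbar * linHam α β f) := by
  have := h.star_mul_right f 1
  rwa [mul_one, star_one_right, star_one_right] at this

/-! ### The rescaled commutator with linear and quadratic elements -/

theorem bracket_eq_of {n : ℕ} {f g h : Weyl n} (e : star f g - star g f = hbar * h) :
    bracket f g = h :=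
  hbar_mul_cancel ((hbar_mul_bracket f g).trans e)

theorem bracket_swap {n : ℕ} (f g : Weyl n) : bracket f g = -bracket g f := by
  refine bracket_eq_of ?_
  rw [mul_neg, hbar_mul_bracket, neg_sub]

theorem half_add_half {n : ℕ} : C (2⁻¹ : ℝ) + C (2⁻¹ : ℝ) = (1 : Weyl n) := by
  rw [← map_add]
  norm_num

theorem IsLin.bracket_right {n : ℕ} {u : Weyl n} {α β : Fin n → ℝ} (h : IsLin u α β)
    (f : Weyl n) : bracket f u = -linHam α β f := by
  refine bracket_eq_of ?_
  rw [h.star_left, h.star_right]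
  simp only [smul_eq_C_mul]
  linear_combination (-hbar * linHam α β f) * half_add_half (n := n)

theorem IsLin.bracket_left {n : ℕ} {u : Weyl n} {α β : Fin n → ℝ} (h : IsLin u α β)
    (f : Weyl n) : bracket u f = linHam α β f := by
  rw [bracket_swap, h.bracket_right, neg_neg]

theorem bracket_y {n : ℕ} (a : Fin n) (f : Weyl n) : bracket f (X (yVar a)) = -dP a f := by
  rw [(isLin_y a).bracket_right, linHam_y]

theorem p_bracket {n : ℕ} (a : Fin n) (f : Weyl n) : bracket (X (pVar a)) f = -dY a f := by
  rw [(isLin_p a).bracket_left, linHam_p]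

theorem bracket_one {n : ℕ} (f : Weyl n) : bracket f 1 = 0 := by
  rw [isLin_one.bracket_right, linHam_zero, neg_zero]

/-- Besides the `ħ` terms, star multiplication by a quadratic element has an `ħ²` term which is
symmetric in the order of the factors. It cancels in the commutator since constant-coefficient
vector fields commute (`hcomm`). -/
theorem bracket_lin_mul_lin {n : ℕ} {u v : Weyl n} {α β α' β' : Fin n → ℝ} (hu : IsLin u α β)
    (hv : IsLin v α' β') (f : Weyl n) :
    bracket f (u * v) = -(u * linHam α' β' f + v * linHam α β f) := by
  have hcomm : linHam α' β' (linHam α β f) = linHam α β (linHam α' β' f) := by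
    have h1 : ∀ g, linHam α β g = ∑ a, (α a • dP a g - β a • dY a g) := fun _ => rfl
    rw [h1, h1 (linHam α' β' f)]
    simp only [dY_linHam, dP_linHam]
    simp only [← hv.bracket_left, bracket_eq, map_sum, map_sub, map_smul]
  refine bracket_eq_of ?_
  rw [hu.star_mul_left, hu.star_mul_right, hv.star_left, hv.star_left, hv.star_right,
    hv.star_right, hcomm]
  simp only [smul_eq_C_mul]
  linear_combination (-hbar * (u * linHam α' β' f + v * linHam α β f)) * half_add_half (n := n)

/-! ### Associativity of the star product -/

theorem star_hbar_mul_left {n : ℕ} (f g : Weyl n) : star (hbar * f) g = hbar * star f g := by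
  have h : IsLin (hbar : Weyl n) 0 0 :=
    ⟨fun a => by simp [dY], fun a => by simp [dP]⟩
  rw [h.star_mul_left, linHam_zero, star_eq f 0]
  simp

theorem star_hbar_mul_right {n : ℕ} (f g : Weyl n) : star f (hbar * g) = hbar * star f g := by
  have h : IsLin (hbar : Weyl n) 0 0 :=
    ⟨fun a => by simp [dY], fun a => by simp [dP]⟩
  rw [h.star_mul_right, linHam_zero, star_eq 0 g]
  simp

theorem linHam_star {n : ℕ} (α β : Fin n → ℝ) (f g : Weyl n) :
    linHam α β (star f g) = star (linHam α β f) g + star f (linHam α β g) := by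
  simp only [linHam, dY_star, dP_star]
  simp only [star_eq, map_sum, map_sub, map_smul, LinearMap.sum_apply, LinearMap.sub_apply,
    LinearMap.smul_apply]
  rw [← Finset.sum_add_distrib]
  refine Finset.sum_congr rfl fun a _ => ?_
  module

/-- By `IsLin.star_mul_left`, a factor `u` moves out of the first slot at the price of `linHam` on
the second, and `linHam` is a derivation of the star product. Associativity thus propagates from `f`
to `u * f`. -/
theorem star_assoc_of_lin_mul {n : ℕ} {u : Weyl n} {α β : Fin n → ℝ} (hu : IsLin u α β)
    {f : Weyl n} (hf : ∀ g h, star (star f g) h = star f (star g h)) (g h : Weyl n) :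
    star (star (u * f) g) h = star (u * f) (star g h) := by
  have e1 := hf g h
  have e2 := hf (linHam α β g) h
  rw [hu.star_mul_left, hu.star_mul_left, linHam_star]
  have e3 : star (u * star f g + (2⁻¹ : ℝ) • (hbar * star f (linHam α β g))) h =
      star (u * star f g) h + (2⁻¹ : ℝ) • star (hbar * star f (linHam α β g)) h := by
    simp only [star_eq, map_add, map_smul, LinearMap.add_apply, LinearMap.smul_apply]
  have e4 : star f (star (linHam α β g) h + star g (linHam α β h)) =
      star f (star (linHam α β g) h) + star f (star g (linHam α β h)) := by
    simp only [star_eq, map_add]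
  rw [e3, e4, hu.star_mul_left, star_hbar_mul_left, e1, e2, hf]
  simp only [smul_eq_C_mul]
  ring

theorem star_assoc_polynomial {n : ℕ} (q : MvPolynomial (WeylVar n) ℝ) (g h : Weyl n) :
    star (star (q : Weyl n) g) h = star (q : Weyl n) (star g h) := by
  induction q using MvPolynomial.induction_on generalizing g h with
  | C r =>
    rw [MvPolynomial.coe_C, ← mul_one (C r), ← smul_eq_C_mul]
    simp only [star_eq, map_smul, LinearMap.smul_apply]
    simp only [← star_eq, star_one_left]
  | add q q' hq hq' =>
    rw [MvPolynomial.coe_add]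
    simp only [star_eq, map_add, LinearMap.add_apply]
    simp only [← star_eq, hq, hq']
  | mul_X q v hq =>
    rw [MvPolynomial.coe_mul, MvPolynomial.coe_X, mul_comm]
    rcases v with a | a | ⟨⟩
    · exact star_assoc_of_lin_mul (isLin_y a) hq g h
    · exact star_assoc_of_lin_mul (isLin_p a) hq g h
    · rw [star_hbar_mul_left, star_hbar_mul_left, star_hbar_mul_left, hq]

theorem star_assoc {n : ℕ} (f g h : Weyl n) : star (star f g) h = star f (star g h) := by
  classical
  ext d
  obtain ⟨S, hS⟩ := pairSpan_finite_dependence (isFinBil_star d)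
  choose T hT using fun e => pairSpan_finite_dependence (isFinBil_star (n := n) e)
  -- The finitely many coefficients of `f` that enter either bracketing: `S` for the outer product
  -- with `f` as left factor, `T e` for the inner product at each `e ∈ S`.
  let U : Finset (Expo n) := S ∪ S.biUnion T
  let q : MvPolynomial (WeylVar n) ℝ := ∑ e ∈ U, MvPolynomial.monomial e (coeff e f)
  have hq : ∀ e ∈ U, coeff e f = coeff e (q : Weyl n) := by
    intro e he
    rw [MvPolynomial.coeff_coe, MvPolynomial.coeff_sum]
    simp only [MvPolynomial.coeff_monomial]
    rw [Finset.sum_ite_eq' U e, if_pos he]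
  have h1 : coeff d (star (star f g) h) = coeff d (star (star (q : Weyl n) g) h) := by
    refine hS _ _ _ _ (fun e he => ?_) (fun e _ => rfl)
    refine hT e _ _ _ _ (fun e' he' => hq e' ?_) (fun e' _ => rfl)
    exact Finset.mem_union_right _ (Finset.mem_biUnion.2 ⟨e, he, he'⟩)
  have h2 : coeff d (star f (star g h)) = coeff d (star (q : Weyl n) (star g h)) :=
    hS _ _ _ _ (fun e he => hq e (Finset.mem_union_left _ he)) (fun e _ => rfl)
  rw [h1, h2, star_assoc_polynomial]

theorem bracket_jacobi {n : ℕ} (a b c : Weyl n) :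
    bracket (bracket a b) c = bracket (bracket a c) b + bracket a (bracket b c) := by
  have key : ∀ a b c : Weyl n, hbar * (hbar * bracket (bracket a b) c) =
      star (star a b) c - star (star b a) c - (star c (star a b) - star c (star b a)) := by
    intro a b c
    rw [hbar_mul_bracket, mul_sub, ← star_hbar_mul_left, ← star_hbar_mul_right,
      hbar_mul_bracket]
    simp only [star_eq, map_sub, LinearMap.sub_apply]
  have h1 := key a b c
  have h2 := key a c b
  have h3 := key b c a
  refine hbar_mul_cancel (hbar_mul_cancel ?_)
  rw [bracket_swap a (bracket b c), mul_add, mul_add, mul_neg, mul_neg, h1, h2, h3]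
  simp only [star_assoc]
  abel

/-! ### Calculus of smooth sections -/

theorem IsSmooth.mono {n : ℕ} {V W : Set (Pt n)} {F : Sec n} (h : IsSmooth V F) (hW : W ⊆ V) :
    IsSmooth W F := fun d => (h d).mono hW

theorem IsSmooth.congr {n : ℕ} {V : Set (Pt n)} {F G : Sec n} (h : IsSmooth V F)
    (hFG : ∀ x ∈ V, G x = F x) : IsSmooth V G :=
  fun d => (h d).congr fun x hx => by rw [hFG x hx]

theorem IsSmooth.differentiableAt {n : ℕ} {V : Set (Pt n)} {F : Sec n} (h : IsSmooth V F)
    (hV : IsOpen V) {x : Pt n} (hx : x ∈ V) (d : Expo n) :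
    DifferentiableAt ℝ (fun z => coeff d (F z)) x :=
  ((h d).contDiffAt (hV.mem_nhds hx)).differentiableAt (by simp)

theorem IsFinBil.isSmooth {n k : ℕ} {B : Weyl n → Weyl n → Weyl n} (hB : IsFinBil k B)
    {V : Set (Pt n)} {F G : Sec n} (hF : IsSmooth V F) (hG : IsSmooth V G) :
    IsSmooth V fun x => B (F x) (G x) :=
  fun d => pairSpan_contDiffOn (hB d) hF hG

theorem IsFinBil.dX {n k : ℕ} {B : Weyl n → Weyl n → Weyl n} (hB : IsFinBil k B)
    {V : Set (Pt n)} (hV : IsOpen V) {F G : Sec n} (hF : IsSmooth V F) (hG : IsSmooth V G)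
    (μ : Fin n) {x : Pt n} (hx : x ∈ V) :
    dX μ (fun z => B (F z) (G z)) x = B (dX μ F x) (G x) + B (F x) (dX μ G x) := by
  ext d
  exact (pairSpan_partialDeriv (hB d) μ (hF.differentiableAt hV hx)
    (hG.differentiableAt hV hx)).2

theorem IsSmooth.add {n : ℕ} {V : Set (Pt n)} {F G : Sec n} (hF : IsSmooth V F)
    (hG : IsSmooth V G) : IsSmooth V fun x => F x + G x :=
  fun d => (hF d).add (hG d)

theorem IsSmooth.sub {n : ℕ} {V : Set (Pt n)} {F G : Sec n} (hF : IsSmooth V F)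
    (hG : IsSmooth V G) : IsSmooth V fun x => F x - G x :=
  fun d => (hF d).sub (hG d)

theorem IsSmooth.smul {n : ℕ} {V : Set (Pt n)} {F : Sec n} (r : ℝ) (hF : IsSmooth V F) :
    IsSmooth V fun x => r • F x :=
  fun d => (contDiffOn_const (c := r)).mul (hF d)

theorem IsSmooth.fun_smul {n : ℕ} {V : Set (Pt n)} {r : Pt n → ℝ} {F : Sec n}
    (hr : ContDiffOn ℝ ∞ r V) (hF : IsSmooth V F) : IsSmooth V fun x => r x • F x :=
  fun d => hr.mul (hF d)

theorem isSmooth_const {n : ℕ} {V : Set (Pt n)} (f : Weyl n) : IsSmooth V fun _ => f :=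
  fun _ => contDiffOn_const

theorem IsSmooth.sum {n : ℕ} {V : Set (Pt n)} {ι : Type*} (s : Finset ι) {F : ι → Sec n}
    (hF : ∀ i ∈ s, IsSmooth V (F i)) : IsSmooth V fun x => ∑ i ∈ s, F i x := by
  intro d
  simp only [map_sum]
  exact ContDiffOn.sum fun i hi => hF i hi d

theorem contDiffOn_partialDeriv {n : ℕ} {V : Set (Pt n)} (hV : IsOpen V) {g : Pt n → ℝ}
    (hg : ContDiffOn ℝ ∞ g V) (μ : Fin n) : ContDiffOn ℝ ∞ (partialDeriv μ g) V :=
  (hg.fderiv_of_isOpen hV (m := ∞) (by simp)).clm_apply contDiffOn_const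

theorem partialDeriv_congr {n : ℕ} {V : Set (Pt n)} (hV : IsOpen V) {g h : Pt n → ℝ}
    (hgh : ∀ x ∈ V, g x = h x) (μ : Fin n) {x : Pt n} (hx : x ∈ V) :
    partialDeriv μ g x = partialDeriv μ h x := by
  unfold partialDeriv
  rw [Filter.EventuallyEq.fderiv_eq]
  exact Filter.eventually_of_mem (hV.mem_nhds hx) hgh

theorem partialDeriv_comm {n : ℕ} {V : Set (Pt n)} (hV : IsOpen V) {g : Pt n → ℝ}
    (hg : ContDiffOn ℝ ∞ g V) (μ ν : Fin n) {x : Pt n} (hx : x ∈ V) :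
    partialDeriv μ (partialDeriv ν g) x = partialDeriv ν (partialDeriv μ g) x := by
  have hg' : ContDiffAt ℝ ∞ g x := hg.contDiffAt (hV.mem_nhds hx)
  have hd : DifferentiableAt ℝ (fderiv ℝ g) x :=
    (hg'.fderiv_right (m := 1)
      (WithTop.coe_le_coe.2 (le_top (a := (2 : ℕ∞))))).differentiableAt (by simp)
  have hs : IsSymmSndFDerivAt ℝ g x := hg'.isSymmSndFDerivAt (by
    rw [minSmoothness_of_isRCLikeNormedField]
    exact WithTop.coe_le_coe.2 (le_top (a := (2 : ℕ∞))))
  have key : ∀ v w : Pt n, fderiv ℝ (fun z => fderiv ℝ g z v) x w =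
      fderiv ℝ (fderiv ℝ g) x w v := by
    intro v w
    rw [fderiv_clm_apply hd (differentiableAt_const v)]
    simp
  unfold partialDeriv
  rw [key, key]
  exact hs _ _

theorem IsSmooth.dX {n : ℕ} {V : Set (Pt n)} (hV : IsOpen V) {F : Sec n} (hF : IsSmooth V F)
    (μ : Fin n) : IsSmooth V (SegalGauge.dX μ F) :=
  fun d => contDiffOn_partialDeriv hV (hF d) μ

theorem dX_comm {n : ℕ} {V : Set (Pt n)} (hV : IsOpen V) {F : Sec n} (hF : IsSmooth V F)
    (μ ν : Fin n) {x : Pt n} (hx : x ∈ V) : dX μ (dX ν F) x = dX ν (dX μ F) x := by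
  ext d
  exact partialDeriv_comm hV (hF d) μ ν hx

theorem dX_congr {n : ℕ} {V : Set (Pt n)} (hV : IsOpen V) {F G : Sec n}
    (hFG : ∀ x ∈ V, F x = G x) (μ : Fin n) {x : Pt n} (hx : x ∈ V) : dX μ F x = dX μ G x := by
  ext d
  exact partialDeriv_congr hV (fun z hz => by rw [hFG z hz]) μ hx

theorem dX_add {n : ℕ} {V : Set (Pt n)} (hV : IsOpen V) {F G : Sec n} (hF : IsSmooth V F)
    (hG : IsSmooth V G) (μ : Fin n) {x : Pt n} (hx : x ∈ V) :
    dX μ (fun z => F z + G z) x = dX μ F x + dX μ G x := by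
  ext d
  change fderiv ℝ (fun z => coeff d (F z) + coeff d (G z)) x _ = _
  rw [fderiv_fun_add (hF.differentiableAt hV hx d) (hG.differentiableAt hV hx d)]
  rfl

theorem dX_smul {n : ℕ} {V : Set (Pt n)} (hV : IsOpen V) {F : Sec n} (r : ℝ)
    (hF : IsSmooth V F) (μ : Fin n) {x : Pt n} (hx : x ∈ V) :
    dX μ (fun z => r • F z) x = r • dX μ F x := by
  ext d
  change fderiv ℝ (fun z => r * coeff d (F z)) x _ = _
  rw [fderiv_const_mul (hF.differentiableAt hV hx d)]
  rfl

theorem dX_const {n : ℕ} (f : Weyl n) (μ : Fin n) (x : Pt n) : dX μ (fun _ => f) x = 0 := by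
  ext d
  change fderiv ℝ (fun _ => coeff d f) x _ = _
  simp

theorem coeff_dX {n : ℕ} (μ : Fin n) (F : Sec n) (x : Pt n) (d : Expo n) :
    coeff d (dX μ F x) = partialDeriv μ (fun z => coeff d (F z)) x := rfl

theorem coeff_dX_eq_zero {n : ℕ} {V : Set (Pt n)} (hV : IsOpen V) {F : Sec n} {d : Expo n}
    (h : ∀ x ∈ V, coeff d (F x) = 0) (μ : Fin n) {x : Pt n} (hx : x ∈ V) :
    coeff d (dX μ F x) = 0 := by
  rw [coeff_dX, partialDeriv_congr hV (h := fun _ => 0) h μ hx]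
  simp [partialDeriv]

theorem IsSmooth.bracket {n : ℕ} {V : Set (Pt n)} {F G : Sec n} (hF : IsSmooth V F)
    (hG : IsSmooth V G) : IsSmooth V fun x => SegalGauge.bracket (F x) (G x) :=
  isFinBil_bracket.isSmooth hF hG

theorem IsSmooth.star {n : ℕ} {V : Set (Pt n)} {F G : Sec n} (hF : IsSmooth V F)
    (hG : IsSmooth V G) : IsSmooth V fun x => SegalGauge.star (F x) (G x) :=
  isFinBil_star.isSmooth hF hG

/-! ### The gauge series -/

/-- The terms of the gauge transform of `A` with parameter `lam`, of order `k` in `lam`. -/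
def gaugeTerm {n : ℕ} (lam : Sec n) (A : Conn n) : ℕ → Conn n
  | 0 => A
  | k + 1 => fun μ x =>
      (((k + 1)! : ℕ) : ℝ)⁻¹ • (fun g => bracket g (lam x))^[k] (covDeriv A lam μ x)

/-- The gauge series is finite, coefficient by coefficient, uniformly on `V`. -/
def GaugeFinite {n : ℕ} (V : Set (Pt n)) (lam : Sec n) (A : Conn n) : Prop :=
  ∀ d : Expo n, ∃ K : ℕ, ∀ k, K ≤ k → ∀ μ, ∀ x ∈ V, coeff d (gaugeTerm lam A k μ x) = 0

/-- The sum of the gauge series. -/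
def gaugeSum {n : ℕ} (lam : Sec n) (A : Conn n) : Conn n := fun μ x d =>
  ∑' k, coeff d (gaugeTerm lam A k μ x)

/-- The order-by-order form of the flow `dA/dt = dlam + (1/ħ)[A, lam]`, whose inhomogeneous term
contributes only at first order. Later arguments use this recursion instead of the iterates. -/
theorem gaugeTerm_succ {n : ℕ} (lam : Sec n) (A : Conn n) (k : ℕ) (μ : Fin n) (x : Pt n) :
    (k + 1 : ℝ) • gaugeTerm lam A (k + 1) μ x =
      bracket (gaugeTerm lam A k μ x) (lam x) + if k = 0 then dX μ lam x else 0 := by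
  rcases k with _ | k
  · simp only [gaugeTerm, if_true, covDeriv]
    simp [add_comm]
  · simp only [gaugeTerm, Nat.add_eq_zero_iff, one_ne_zero, and_false, if_false, add_zero,
      Function.iterate_succ_apply']
    rw [bracket_eq (_ • _), map_smul, LinearMap.smul_apply, ← bracket_eq, smul_smul]
    congr 1
    rw [Nat.factorial_succ (k + 1)]
    push_cast
    have : ((k + 1)! : ℝ) ≠ 0 := by positivity
    have : (k + 1 + 1 : ℝ) ≠ 0 := by positivity
    field_simp

theorem gaugeTerm_succ_eq {n : ℕ} (lam : Sec n) (A : Conn n) (k : ℕ) (μ : Fin n) (x : Pt n) :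
    gaugeTerm lam A (k + 1) μ x = (k + 1 : ℝ)⁻¹ •
      (bracket (gaugeTerm lam A k μ x) (lam x) + if k = 0 then dX μ lam x else 0) := by
  rw [← gaugeTerm_succ, smul_smul, inv_mul_cancel₀ (by positivity), one_smul]

section

variable {n : ℕ} {V : Set (Pt n)} {lam : Sec n} {A : Conn n}

theorem isSmooth_gaugeTerm (hV : IsOpen V) (hA : ∀ μ, IsSmooth V (A μ)) (hl : IsSmooth V lam)
    (k : ℕ) (μ : Fin n) : IsSmooth V (gaugeTerm lam A k μ) := by
  induction k with
  | zero => exact hA μ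
  | succ k ih =>
    have h : IsSmooth V fun x => if k = 0 then dX μ lam x else 0 := by
      split_ifs
      · exact hl.dX hV μ
      · exact isSmooth_const 0
    exact (((ih.bracket hl).add h).smul ((k + 1 : ℝ)⁻¹)).congr fun x _ =>
      gaugeTerm_succ_eq lam A k μ x

theorem coeff_gaugeSum {d : Expo n} {K : ℕ} {μ : Fin n} {x : Pt n}
    (h : ∀ k, K ≤ k → coeff d (gaugeTerm lam A k μ x) = 0) :
    coeff d (gaugeSum lam A μ x) = ∑ k ∈ Finset.range K, coeff d (gaugeTerm lam A k μ x) := by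
  change ∑' k, _ = _
  refine tsum_eq_sum fun k hk => h k ?_
  simpa using hk

theorem GaugeFinite.isSmooth (h : GaugeFinite V lam A) (hV : IsOpen V)
    (hA : ∀ μ, IsSmooth V (A μ)) (hl : IsSmooth V lam) (μ : Fin n) :
    IsSmooth V (gaugeSum lam A μ) := by
  intro d
  obtain ⟨K, hK⟩ := h d
  refine ContDiffOn.congr (f := fun x => ∑ k ∈ Finset.range K, coeff d (gaugeTerm lam A k μ x))
    (ContDiffOn.sum fun k _ => isSmooth_gaugeTerm hV hA hl k μ d) fun x hx => ?_
  exact coeff_gaugeSum fun k hk => hK k hk μ x hx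

theorem GaugeFinite.isGaugeTransform (h : GaugeFinite V lam A) :
    IsGaugeTransform V lam A (gaugeSum lam A) := by
  intro μ x hx d
  obtain ⟨K, hK⟩ := h d
  have h1 : coeff d (gaugeSum lam A μ x) - coeff d (A μ x) =
      ∑ k ∈ Finset.range K, coeff d (gaugeTerm lam A (k + 1) μ x) := by
    rw [coeff_gaugeSum (K := K + 1) fun k hk => hK k (by omega) μ x hx, Finset.sum_range_succ']
    simp [gaugeTerm]
  rw [h1]
  refine hasSum_sum_of_ne_finset_zero (f := fun k => coeff d (gaugeTerm lam A (k + 1) μ x))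
    fun k hk => hK (k + 1) ?_ μ x hx
  rw [Finset.mem_range] at hk
  omega

theorem GaugeFinite.gaugeStep (h : GaugeFinite V lam A) (hV : IsOpen V)
    (hA : ∀ μ, IsSmooth V (A μ)) (hl : IsSmooth V lam)
    (hk : HasNoLinearPart V lam ∨ (IsTranslation V lam ∧ ∀ μ, IsPolyP V (A μ))) :
    GaugeStep V A (gaugeSum lam A) :=
  ⟨hA, h.isSmooth hV hA hl, lam, hl, hk, h.isGaugeTransform⟩

/-! ### Flatness of the gauge transform -/

/-- The component of the curvature of the gauge transform of order `m` in the parameter. -/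
def curvTerm (lam : Sec n) (A : Conn n) (m : ℕ) (μ ν : Fin n) (x : Pt n) : Weyl n :=
  dX μ (gaugeTerm lam A m ν) x - dX ν (gaugeTerm lam A m μ) x +
    ∑ p ∈ Finset.HasAntidiagonal.antidiagonal m,
      bracket (gaugeTerm lam A p.1 μ x) (gaugeTerm lam A p.2 ν x)

/-- The factor `m + 1 = p.1 + p.2` is distributed over the two entries, as when differentiating a
product of power series. The recursion and the Jacobi identity then leave the bracket with `lam`
outside, plus the two inhomogeneous terms. -/
theorem sum_antidiagonal_bracket_succ (m : ℕ) (μ ν : Fin n) (x : Pt n) :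
    (m + 1 : ℝ) • ∑ p ∈ Finset.HasAntidiagonal.antidiagonal (m + 1),
      bracket (gaugeTerm lam A p.1 μ x) (gaugeTerm lam A p.2 ν x) =
    bracket (∑ p ∈ Finset.HasAntidiagonal.antidiagonal m,
      bracket (gaugeTerm lam A p.1 μ x) (gaugeTerm lam A p.2 ν x)) (lam x) +
      (bracket (dX μ lam x) (gaugeTerm lam A m ν x) +
        bracket (gaugeTerm lam A m μ x) (dX ν lam x)) := by
  set a : ℕ → Weyl n := fun k => gaugeTerm lam A k μ x with ha
  set b : ℕ → Weyl n := fun k => gaugeTerm lam A k ν x with hb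
  have hsa : ∀ k : ℕ, (k + 1 : ℝ) • a (k + 1) =
      bracket (a k) (lam x) + if k = 0 then dX μ lam x else 0 :=
    fun k => gaugeTerm_succ lam A k μ x
  have hsb : ∀ k : ℕ, (k + 1 : ℝ) • b (k + 1) =
      bracket (b k) (lam x) + if k = 0 then dX ν lam x else 0 :=
    fun k => gaugeTerm_succ lam A k ν x
  have h1 : (m + 1 : ℝ) • ∑ p ∈ Finset.HasAntidiagonal.antidiagonal (m + 1),
      bracket (a p.1) (b p.2) =
      ∑ p ∈ Finset.HasAntidiagonal.antidiagonal (m + 1), bracket ((p.1 : ℝ) • a p.1) (b p.2) +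
      ∑ p ∈ Finset.HasAntidiagonal.antidiagonal (m + 1), bracket (a p.1) ((p.2 : ℝ) • b p.2) := by
    rw [Finset.smul_sum, ← Finset.sum_add_distrib]
    refine Finset.sum_congr rfl fun p hp => ?_
    rw [Finset.HasAntidiagonal.mem_antidiagonal] at hp
    simp only [bracket_eq, map_smul, LinearMap.smul_apply]
    rw [← add_smul]
    congr 1
    exact_mod_cast hp.symm
  have h0 : ∀ f : Weyl n, bracket 0 f = 0 := fun f => by simp [bracket_eq]
  have h0' : ∀ f : Weyl n, bracket f 0 = 0 := fun f => by simp [bracket_eq]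
  rw [h1, Finset.Nat.sum_antidiagonal_succ, Finset.Nat.sum_antidiagonal_succ']
  simp only [Nat.cast_zero, zero_smul, h0, h0', zero_add, Nat.cast_add, Nat.cast_one,
    hsa, hsb]
  have h2 : ∑ p ∈ Finset.HasAntidiagonal.antidiagonal m,
      bracket (if p.1 = 0 then dX μ lam x else 0) (b p.2) = bracket (dX μ lam x) (b m) := by
    rw [Finset.sum_eq_single (0, m)]
    · simp
    · intro p hp hne
      rw [Finset.HasAntidiagonal.mem_antidiagonal] at hp
      rw [if_neg, h0]
      intro h
      exact hne (Prod.ext h (by simp only; omega))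
    · intro h
      exact absurd (by simp) h
  have h3 : ∑ p ∈ Finset.HasAntidiagonal.antidiagonal m,
      bracket (a p.1) (if p.2 = 0 then dX ν lam x else 0) = bracket (a m) (dX ν lam x) := by
    rw [Finset.sum_eq_single (m, 0)]
    · simp
    · intro p hp hne
      rw [Finset.HasAntidiagonal.mem_antidiagonal] at hp
      rw [if_neg, h0']
      intro h
      exact hne (Prod.ext (by simp only; omega) h)
    · intro h
      exact absurd (by simp) h
  have hadd : ∀ f f' g : Weyl n, bracket (f + f') g = bracket f g + bracket f' g :=
    fun f f' g => by simp [bracket_eq]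
  have hadd' : ∀ f g g' : Weyl n, bracket f (g + g') = bracket f g + bracket f g' :=
    fun f g g' => by simp [bracket_eq]
  simp only [hadd, hadd', Finset.sum_add_distrib, h2, h3]
  have h4 : bracket (∑ p ∈ Finset.HasAntidiagonal.antidiagonal m, bracket (a p.1) (b p.2)) (lam x) =
      ∑ p ∈ Finset.HasAntidiagonal.antidiagonal m, bracket (bracket (a p.1) (b p.2)) (lam x) := by
    rw [bracket_eq, map_sum, LinearMap.sum_apply]
    rfl
  rw [h4]
  simp only [bracket_jacobi _ _ (lam x), Finset.sum_add_distrib]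
  abel

/-- Infinitesimal covariance of the curvature, `dR/dt = (1/ħ)[R, lam]`, order by order. The second
derivatives of `lam` cancel by symmetry, and the terms with first derivatives of `lam` cancel
between `dA` and `[A, A]`. -/
theorem curvTerm_succ (hV : IsOpen V) (hA : ∀ μ, IsSmooth V (A μ)) (hl : IsSmooth V lam)
    (m : ℕ) (μ ν : Fin n) {x : Pt n} (hx : x ∈ V) :
    (m + 1 : ℝ) • curvTerm lam A (m + 1) μ ν x = bracket (curvTerm lam A m μ ν x) (lam x) := by
  have hd : ∀ μ ν, (m + 1 : ℝ) • dX μ (gaugeTerm lam A (m + 1) ν) x =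
      bracket (dX μ (gaugeTerm lam A m ν) x) (lam x) +
        bracket (gaugeTerm lam A m ν x) (dX μ lam x) +
        if m = 0 then dX μ (dX ν lam) x else 0 := by
    intro μ ν
    have h : IsSmooth V fun x => if m = 0 then dX ν lam x else 0 := by
      split_ifs
      · exact hl.dX hV ν
      · exact isSmooth_const 0
    rw [← dX_smul hV _ (isSmooth_gaugeTerm hV hA hl (m + 1) ν) μ hx]
    simp only [gaugeTerm_succ]
    rw [dX_add hV ((isSmooth_gaugeTerm hV hA hl m ν).bracket hl) h μ hx,
      isFinBil_bracket.dX hV (isSmooth_gaugeTerm hV hA hl m ν) hl μ hx]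
    congr 1
    split_ifs
    · rfl
    · exact dX_const 0 μ x
  unfold curvTerm
  rw [smul_add, smul_sub, hd, hd, sum_antidiagonal_bracket_succ, dX_comm hV hl μ ν hx,
    bracket_swap (dX μ lam x)]
  have hsub : ∀ f f' f'' g : Weyl n, bracket (f - f' + f'') g =
      bracket f g - bracket f' g + bracket f'' g := fun f f' f'' g => by simp [bracket_eq]
  rw [hsub]
  abel

theorem curvTerm_eq_zero (hV : IsOpen V) (hA : ∀ μ, IsSmooth V (A μ)) (hl : IsSmooth V lam)
    (hflat : IsFlat V A) (m : ℕ) (μ ν : Fin n) {x : Pt n} (hx : x ∈ V) :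
    curvTerm lam A m μ ν x = 0 := by
  induction m with
  | zero => simpa [curvTerm, gaugeTerm] using hflat μ ν x hx
  | succ m ih =>
    have h := curvTerm_succ hV hA hl m μ ν hx
    rw [ih, show bracket 0 (lam x) = 0 by simp [bracket_eq]] at h
    exact (smul_eq_zero.1 h).resolve_left (by positivity)

/-- The square `i, j < K` lies inside the triangle `i + j < 2 * K`, and `g` vanishes on the rest of
the triangle. -/
theorem sum_range_antidiagonal_eq {K : ℕ} {g : ℕ → ℕ → ℝ}
    (hg : ∀ i j, K ≤ i ∨ K ≤ j → g i j = 0) :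
    ∑ m ∈ Finset.range (2 * K), ∑ p ∈ Finset.HasAntidiagonal.antidiagonal m, g p.1 p.2 =
      ∑ i ∈ Finset.range K, ∑ j ∈ Finset.range K, g i j := by
  rw [← Finset.sum_product']
  rw [← Finset.sum_fiberwise_of_maps_to (s := Finset.range K ×ˢ Finset.range K)
    (t := Finset.range (2 * K)) (g := fun p => p.1 + p.2)]
  · refine Finset.sum_congr rfl fun m _ => (Finset.sum_subset ?_ ?_).symm
    · intro p hp
      rw [Finset.HasAntidiagonal.mem_antidiagonal]
      exact (Finset.mem_filter.1 hp).2
    · intro p hp hp'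
      rw [Finset.HasAntidiagonal.mem_antidiagonal] at hp
      rw [Finset.mem_filter, Finset.mem_product, Finset.mem_range, Finset.mem_range] at hp'
      apply hg
      by_contra hc
      push Not at hc
      exact hp' ⟨hc, hp⟩
  · intro p hp
    rw [Finset.mem_product, Finset.mem_range, Finset.mem_range] at hp
    rw [Finset.mem_range]
    omega

/-- Every coefficient of the curvature involves only finitely many coefficients of the series, all
of which terminate. It is therefore the finite sum of the `curvTerm`s, each zero. -/
theorem GaugeFinite.isFlat (h : GaugeFinite V lam A) (hV : IsOpen V)
    (hA : ∀ μ, IsSmooth V (A μ)) (hl : IsSmooth V lam) (hflat : IsFlat V A) :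
    IsFlat V (gaugeSum lam A) := by
  classical
  intro μ ν x hx
  ext d
  obtain ⟨S, hS⟩ := pairSpan_finite_dependence (isFinBil_bracket (n := n) d)
  choose K₀ hK₀ using h
  -- One cutoff for `d` and for all coefficients that enter the bracket at `d`.
  let K : ℕ := (insert d S).sup K₀
  have hK : ∀ e ∈ insert d S, ∀ k, K ≤ k → ∀ μ, ∀ x ∈ V, coeff e (gaugeTerm lam A k μ x) = 0 :=
    fun e he k hk => hK₀ e k ((Finset.le_sup (f := K₀) he).trans hk)
  have hsum : ∀ e ∈ insert d S, ∀ μ, ∀ x ∈ V, coeff e (gaugeSum lam A μ x) =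
      coeff e (∑ k ∈ Finset.range K, gaugeTerm lam A k μ x) := by
    intro e he μ x hx
    rw [map_sum, coeff_gaugeSum fun k hk => hK e he k hk μ x hx]
  have hdX : ∀ μ ν, coeff d (dX μ (gaugeSum lam A ν) x) =
      ∑ m ∈ Finset.range (2 * K), coeff d (dX μ (gaugeTerm lam A m ν) x) := by
    intro μ ν
    have h1 : ∑ m ∈ Finset.range (2 * K), coeff d (dX μ (gaugeTerm lam A m ν) x) =
        ∑ m ∈ Finset.range K, coeff d (dX μ (gaugeTerm lam A m ν) x) := by
      refine (Finset.sum_subset (Finset.range_subset_range.2 (by omega)) fun k _ hk => ?_).symm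
      refine coeff_dX_eq_zero hV (fun z hz => hK d (by simp) k ?_ ν z hz) μ hx
      simpa using hk
    rw [h1, coeff_dX, partialDeriv_congr hV (hsum d (by simp) ν) μ hx]
    simp only [map_sum]
    unfold partialDeriv
    rw [fderiv_fun_sum fun k _ => (isSmooth_gaugeTerm hV hA hl k ν).differentiableAt hV hx d,
      _root_.sum_apply]
    rfl
  have hbr : coeff d (bracket (gaugeSum lam A μ x) (gaugeSum lam A ν x)) =
      ∑ m ∈ Finset.range (2 * K), ∑ p ∈ Finset.HasAntidiagonal.antidiagonal m,
        coeff d (bracket (gaugeTerm lam A p.1 μ x) (gaugeTerm lam A p.2 ν x)) := by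
    rw [hS _ _ _ _ (fun e he => hsum e (Finset.mem_insert_of_mem he) μ x hx)
      (fun e he => hsum e (Finset.mem_insert_of_mem he) ν x hx)]
    rw [sum_range_antidiagonal_eq
      (g := fun i j => coeff d (bracket (gaugeTerm lam A i μ x) (gaugeTerm lam A j ν x)))]
    · simp only [bracket_eq, map_sum, LinearMap.sum_apply]
      rw [Finset.sum_comm]
    · rintro i j (hi | hj)
      · rw [hS _ 0 _ (gaugeTerm lam A j ν x)
          (fun e he => by rw [hK e (Finset.mem_insert_of_mem he) i hi μ x hx, map_zero])
          (fun e _ => rfl)]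
        simp [bracket_eq]
      · rw [hS _ (gaugeTerm lam A i μ x) _ 0 (fun e _ => rfl)
          (fun e he => by rw [hK e (Finset.mem_insert_of_mem he) j hj ν x hx, map_zero])]
        simp [bracket_eq]
  rw [map_add, map_sub, hdX, hdX, hbr, ← Finset.sum_sub_distrib, ← Finset.sum_add_distrib,
    map_zero]
  refine Finset.sum_eq_zero fun m _ => ?_
  have := congrArg (coeff d) (curvTerm_eq_zero hV hA hl hflat m μ ν hx)
  simpa only [curvTerm, map_add, map_sub, map_sum, map_zero] using this

end

/-! ### Filtrations by weight -/

/-- The weight with `y` of weight `i`, `p` of weight `j` and `ħ` of weight `i + j`. -/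
def wt {n : ℕ} (i j : ℕ) (d : Expo n) : ℕ := i * yWt d + j * pWt d

theorem wt_add {n : ℕ} (i j : ℕ) (d e : Expo n) : wt i j (d + e) = wt i j d + wt i j e := by
  simp only [wt, yWt_add, pWt_add]
  ring

theorem wt_one_one {n : ℕ} (d : Expo n) : wt 1 1 d = fedosovDegree d := by
  simp [wt, fedosovDegree_eq]

/-- All monomials of `f` have weight at least `m`. -/
def OrdGE {n : ℕ} (i j m : ℕ) (f : Weyl n) : Prop := ∀ d, wt i j d < m → coeff d f = 0

namespace OrdGE

variable {n i j m m' : ℕ} {f g : Weyl n}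

theorem bracket (hf : OrdGE i j m f) (hg : OrdGE i j m' g) {l : ℕ} (hl : l + (i + j) ≤ m + m') :
    OrdGE i j l (SegalGauge.bracket f g) := by
  intro d hd
  refine pairSpan_eq_zero (isFinBil_bracket d) ?_
  rintro d₁ d₂ ⟨h1, h2⟩
  by_contra hc
  push Not at hc
  have h3 : m ≤ wt i j d₁ := by
    by_contra h
    exact hc.1 (hf _ (by omega))
  have h4 : m' ≤ wt i j d₂ := by
    by_contra h
    exact hc.2 (hg _ (by omega))
  have h5 : wt i j d₁ + wt i j d₂ = wt i j d + (i + j) := by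
    simp only [wt]
    linear_combination i * h1 + j * h2
  omega

theorem add (hf : OrdGE i j m f) (hg : OrdGE i j m g) : OrdGE i j m (f + g) := by
  intro d hd
  rw [map_add, hf d hd, hg d hd, add_zero]

theorem sub (hf : OrdGE i j m f) (hg : OrdGE i j m g) : OrdGE i j m (f - g) := by
  intro d hd
  rw [map_sub, hf d hd, hg d hd, sub_zero]

theorem smul (r : ℝ) (hf : OrdGE i j m f) : OrdGE i j m (r • f) := by
  intro d hd
  rw [map_smul, hf d hd, smul_zero]

theorem mono (hf : OrdGE i j m f) (h : m' ≤ m) : OrdGE i j m' f :=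
  fun d hd => hf d (by omega)

theorem zero : OrdGE i j m (0 : Weyl n) := fun _ _ => map_zero _

end OrdGE

theorem OrdGE.dX {n i j m : ℕ} {V : Set (Pt n)} (hV : IsOpen V) {F : Sec n}
    (hF : ∀ x ∈ V, OrdGE i j m (F x)) (μ : Fin n) {x : Pt n} (hx : x ∈ V) :
    OrdGE i j m (dX μ F x) :=
  fun d hd => coeff_dX_eq_zero hV (fun z hz => hF z hz d hd) μ hx

section

variable {n : ℕ} {V : Set (Pt n)} {lam : Sec n} {A : Conn n}

/-- The bracket lowers the weight by `i + j`, so a parameter of weight at least `i + j + 1` raises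
it by at least one at each order. The choice of `i`, `j` is free: `(1, 1)` serves parameters of
degree at least three, while `(2, 1)` and `(1, 2)` serve quadratic ones. -/
theorem gaugeFinite_of_ordGE {i j : ℕ} (hl : ∀ x ∈ V, OrdGE i j (i + j + 1) (lam x)) :
    GaugeFinite V lam A := by
  have key : ∀ k μ, ∀ x ∈ V, OrdGE i j k (gaugeTerm lam A (k + 1) μ x) := by
    intro k μ x hx
    induction k with
    | zero => exact fun d hd => absurd hd (Nat.not_lt_zero _)
    | succ k ih =>
      rw [gaugeTerm_succ_eq, if_neg (Nat.succ_ne_zero k), add_zero]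
      exact (ih.bracket (hl x hx) (by omega)).smul _
  intro d
  refine ⟨wt i j d + 2, fun k hk μ x hx => ?_⟩
  obtain ⟨k, rfl⟩ : ∃ k', k = k' + 1 := ⟨k - 1, by omega⟩
  exact key k μ x hx d (by omega)

/-! ### Removing the terms of Fedosov degree at least two -/

theorem ordGE_gaugeTerm (hV : IsOpen V) (hA : ∀ μ, ∀ x ∈ V, OrdGE 1 1 1 (A μ x))
    (hl : ∀ x ∈ V, OrdGE 1 1 3 (lam x)) (k : ℕ) (μ : Fin n) {x : Pt n} (hx : x ∈ V) :
    OrdGE 1 1 2 (gaugeTerm lam A (k + 1) μ x) := by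
  induction k with
  | zero =>
    rw [gaugeTerm_succ_eq, if_pos rfl]
    exact (((hA μ x hx).bracket (hl x hx) (by omega)).add
      ((OrdGE.dX hV hl μ hx).mono (by omega))).smul _
  | succ k ih =>
    rw [gaugeTerm_succ_eq, if_neg (Nat.succ_ne_zero k), add_zero]
    exact (ih.bracket (hl x hx) (by omega)).smul _

/-- On `V`, the components of `A` of Fedosov degree less than `m` are those of `dx^a p_a`. -/
def AgreesBelow (V : Set (Pt n)) (m : ℕ) (A : Conn n) : Prop :=
  ∀ μ, ∀ x ∈ V, OrdGE 1 1 m (A μ x - X (pVar μ))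

theorem ordGE_p (μ : Fin n) : OrdGE 1 1 1 (X (pVar μ) : Weyl n) := by
  classical
  intro d hd
  rw [coeff_X, if_neg]
  rintro rfl
  simp [wt] at hd

theorem AgreesBelow.ordGE {m : ℕ} (h : AgreesBelow V m A) (hm : 1 ≤ m) (μ : Fin n) {x : Pt n}
    (hx : x ∈ V) : OrdGE 1 1 1 (A μ x) := by
  have := ((h μ x hx).mono hm).add (ordGE_p μ)
  rwa [sub_add_cancel] at this

/-- Modulo degree `m + 1`, the extra parameter `η` is seen only at first order and only through
`p_μ`, where it gives `(1/ħ)[p_μ, η] = -∂η/∂y^μ`. Everything else pairs `η`, or the change it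
caused, with a factor that raises the degree. -/
theorem gaugeTerm_add (hV : IsOpen V) {η : Sec n} {m : ℕ} (hm : 2 ≤ m)
    (hA : AgreesBelow V 2 A) (hls : IsSmooth V lam) (hηs : IsSmooth V η)
    (hl : ∀ x ∈ V, OrdGE 1 1 3 (lam x)) (hη : ∀ x ∈ V, OrdGE 1 1 (m + 1) (η x)) (k : ℕ)
    (μ : Fin n) {x : Pt n} (hx : x ∈ V) :
    OrdGE 1 1 (m + 1) (gaugeTerm (fun z => lam z + η z) A k μ x - gaugeTerm lam A k μ x +
      if k = 1 then dY μ (η x) else 0) := by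
  have hA1 : ∀ μ, ∀ x ∈ V, OrdGE 1 1 1 (A μ x) := fun μ x hx => hA.ordGE (by omega) μ hx
  have hadd : ∀ f g g' : Weyl n, bracket f (g + g') = bracket f g + bracket f g' :=
    fun f g g' => by simp [bracket_eq]
  have hdY : OrdGE 1 1 m (dY μ (η x)) := by
    intro d hd
    rw [dY, coeff_pderiv, hη x hx, zero_mul]
    rw [wt_add]
    simp only [wt, yWt_y, pWt_y] at hd ⊢
    omega
  have h1 : OrdGE 1 1 (m + 1) (gaugeTerm (fun z => lam z + η z) A 1 μ x -
      gaugeTerm lam A 1 μ x + dY μ (η x)) := by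
    have e : gaugeTerm (fun z => lam z + η z) A 1 μ x - gaugeTerm lam A 1 μ x + dY μ (η x) =
        bracket (A μ x - X (pVar μ)) (η x) + dX μ η x := by
      have hp := p_bracket μ (η x)
      rw [gaugeTerm_succ_eq, gaugeTerm_succ_eq, if_pos rfl, if_pos rfl, dX_add hV hls hηs μ hx]
      simp only [gaugeTerm, hadd, Nat.cast_zero, zero_add, inv_one, one_smul]
      rw [bracket_eq (_ - _), map_sub, LinearMap.sub_apply, ← bracket_eq, ← bracket_eq, hp]
      abel
    rw [e]
    exact ((hA μ x hx).bracket (hη x hx) (by omega)).add (OrdGE.dX hV hη μ hx)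
  have key : ∀ k, OrdGE 1 1 m (gaugeTerm (fun z => lam z + η z) A (k + 1) μ x -
      gaugeTerm lam A (k + 1) μ x) → OrdGE 1 1 (m + 1)
        (gaugeTerm (fun z => lam z + η z) A (k + 1 + 1) μ x -
          gaugeTerm lam A (k + 1 + 1) μ x) := by
    intro k hk
    rw [gaugeTerm_succ_eq _ _ (k + 1), gaugeTerm_succ_eq _ _ (k + 1), if_neg (Nat.succ_ne_zero k),
      if_neg (Nat.succ_ne_zero k), add_zero, add_zero, ← smul_sub]
    have e : bracket (gaugeTerm (fun z => lam z + η z) A (k + 1) μ x) (lam x + η x) -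
        bracket (gaugeTerm lam A (k + 1) μ x) (lam x) =
        bracket (gaugeTerm (fun z => lam z + η z) A (k + 1) μ x -
          gaugeTerm lam A (k + 1) μ x) (lam x + η x) +
          bracket (gaugeTerm lam A (k + 1) μ x) (η x) := by
      rw [bracket_eq (_ - _), map_sub, LinearMap.sub_apply, ← bracket_eq, ← bracket_eq,
        hadd (gaugeTerm lam A (k + 1) μ x)]
      abel
    rw [e]
    refine OrdGE.smul _ ((hk.bracket ((hl x hx).add ((hη x hx).mono (by omega)))
      (by omega)).add ?_)
    exact (ordGE_gaugeTerm hV hA1 hl k μ hx).bracket (hη x hx) (by omega)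
  -- Order zero is the same for both parameters, order one is `h1`, and from there `key` gains a
  -- degree at each order.
  rcases k with _ | _ | k
  · simp only [gaugeTerm, sub_self, zero_ne_one, if_false, add_zero]
    exact OrdGE.zero
  · simpa using h1
  · rw [if_neg (by omega), add_zero]
    induction k with
    | zero =>
      refine key 0 ?_
      have := (h1.mono (m' := m) (by omega)).sub hdY
      rwa [add_sub_cancel_right] at this
    | succ k ih => exact key (k + 1) (ih.mono (by omega))

theorem gaugeSum_add (hV : IsOpen V) {η : Sec n} {m : ℕ} (hm : 2 ≤ m)
    (hA : AgreesBelow V 2 A) (hls : IsSmooth V lam) (hηs : IsSmooth V η)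
    (hl : ∀ x ∈ V, OrdGE 1 1 3 (lam x)) (hη : ∀ x ∈ V, OrdGE 1 1 (m + 1) (η x))
    (μ : Fin n) {x : Pt n} (hx : x ∈ V) :
    OrdGE 1 1 (m + 1) (gaugeSum (fun z => lam z + η z) A μ x - gaugeSum lam A μ x +
      dY μ (η x)) := by
  intro d hd
  have hl' : ∀ x ∈ V, OrdGE 1 1 3 (lam x + η x) :=
    fun x hx => (hl x hx).add ((hη x hx).mono (by omega))
  obtain ⟨K₁, hK₁⟩ := gaugeFinite_of_ordGE (i := 1) (j := 1) (A := A) hl d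
  obtain ⟨K₂, hK₂⟩ := gaugeFinite_of_ordGE (i := 1) (j := 1) (A := A)
    (lam := fun z => lam z + η z) hl' d
  have e1 := coeff_gaugeSum (K := K₁ + K₂ + 2) fun k hk => hK₁ k (by omega) μ x hx
  have e2 := coeff_gaugeSum (K := K₁ + K₂ + 2) fun k hk => hK₂ k (by omega) μ x hx
  have e3 : coeff d (dY μ (η x)) =
      ∑ k ∈ Finset.range (K₁ + K₂ + 2), coeff d (if k = 1 then dY μ (η x) else 0) := by
    rw [Finset.sum_eq_single 1]
    · simp
    · intro k _ hk
      simp [hk]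
    · intro h
      exact absurd (Finset.mem_range.2 (by omega)) h
  rw [map_add, map_sub, e1, e2, e3, ← Finset.sum_sub_distrib, ← Finset.sum_add_distrib]
  refine Finset.sum_eq_zero fun k _ => ?_
  rw [← map_sub, ← map_add]
  exact gaugeTerm_add hV hm hA hls hηs hl hη k μ hx d hd

/-- Flatness in degree `m - 1`. The derivatives in `x` see only the constant `p_μ`, and the bracket
of the two discrepancies starts in degree `2 * m - 2 ≥ m`. What is left are the brackets with `p_μ`
and `p_ν`, that is, the `y`-derivatives. -/
theorem AgreesBelow.closed (hV : IsOpen V) {m : ℕ} (hm : 2 ≤ m)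
    (hA : AgreesBelow V m A) (hflat : IsFlat V A) (μ ν : Fin n) {x : Pt n} (hx : x ∈ V)
    {e : Expo n} (he : fedosovDegree e + 1 = m) :
    coeff e (dY ν (A μ x)) = coeff e (dY μ (A ν x)) := by
  have hwt : wt 1 1 e < m := by rw [wt_one_one]; omega
  have hd : ∀ μ ν : Fin n, coeff e (dX μ (A ν) x) = 0 := by
    intro μ ν
    have : coeff e (dX μ (A ν) x) = coeff e (dX μ (fun _ => X (pVar ν)) x) := by
      rw [coeff_dX, coeff_dX]
      refine partialDeriv_congr hV (fun z hz => ?_) μ hx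
      have := hA ν z hz e hwt
      rwa [map_sub, sub_eq_zero] at this
    rw [this, dX_const, map_zero]
  have h := congrArg (coeff e) (hflat μ ν x hx)
  rw [map_add, map_sub, hd, hd, sub_self, zero_add, map_zero] at h
  have hR := ((hA μ x hx).bracket (hA ν x hx) (l := m) (by omega)) e hwt
  have hp : ∀ a b : Fin n, dY a (X (pVar b) : Weyl n) = 0 := by
    intro a b
    rw [(isLin_p b).dY_eq]
    simp
  have hexp : bracket (A μ x - X (pVar μ)) (A ν x - X (pVar ν)) =
      bracket (A μ x) (A ν x) + dY μ (A ν x) - dY ν (A μ x) := by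
    have h1 := p_bracket μ (A ν x)
    have h2 := p_bracket ν (A μ x)
    have h3 := p_bracket μ (X (pVar ν) : Weyl n)
    rw [bracket_swap] at h2
    simp only [bracket_eq, map_sub, LinearMap.sub_apply] at h1 h2 h3 ⊢
    rw [h1, h3, neg_inj.1 h2, hp]
    abel
  rw [hexp, map_sub, map_add, h, zero_add, sub_eq_zero] at hR
  exact hR.symm

/-- The Euler operator of one variable is diagonal on monomials; this supplies the denominators of
the homotopy formula. -/
theorem coeff_X_mul_pderiv (v : WeylVar n) (f : Weyl n) (e : Expo n) :
    coeff e (X v * pderiv ℝ v f) = e v * coeff e f := by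
  by_cases h : e v = 0
  · rw [h, Nat.cast_zero, zero_mul]
    change coeff e (monomial _ 1 * _) = 0
    rw [coeff_monomial_mul, if_neg]
    intro hle
    rw [Finsupp.single_le_iff] at hle
    omega
  · have hle : Finsupp.single v 1 ≤ e := by
      rw [Finsupp.single_le_iff]
      omega
    obtain ⟨e', rfl⟩ := exists_add_of_le hle
    change coeff _ (monomial _ 1 * _) = _
    rw [coeff_add_monomial_mul, one_mul, coeff_pderiv, add_comm e']
    simp only [Finsupp.add_apply, Finsupp.single_eq_same]
    push_cast
    ring

theorem coeff_X_mul_congr (v : WeylVar n) {f g : Weyl n} {e : Expo n}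
    (h : ∀ e', e = Finsupp.single v 1 + e' → coeff e' f = coeff e' g) :
    coeff e (X v * f) = coeff e (X v * g) := by
  change coeff e (monomial _ 1 * _) = coeff e (monomial _ 1 * _)
  rw [coeff_monomial_mul, coeff_monomial_mul]
  split_ifs with hle
  · obtain ⟨e', rfl⟩ := exists_add_of_le hle
    rw [add_tsub_cancel_left, h e' rfl]
  · rfl

/-- The primitive, with respect to the `y`-derivatives, of the component of Fedosov degree `m`
of a one-form. -/
def yPrimitive (m : ℕ) (A : Conn n) : Sec n := fun x d =>
  if fedosovDegree d = m + 1 then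
    -- For a monomial free of `y` the inverse is `0` by convention; the other factor vanishes there
    -- too.
    (∑ a, (d (yVar a) : ℝ))⁻¹ * coeff d (∑ μ, X (yVar μ) * A μ x)
  else 0

theorem coeff_yPrimitive (m : ℕ) (A : Conn n) (x : Pt n) (d : Expo n) :
    coeff d (yPrimitive m A x) = if fedosovDegree d = m + 1 then
      (∑ a, (d (yVar a) : ℝ))⁻¹ * coeff d (∑ μ, X (yVar μ) * A μ x) else 0 := rfl

theorem ordGE_yPrimitive (m : ℕ) (A : Conn n) (x : Pt n) :
    OrdGE 1 1 (m + 1) (yPrimitive m A x) := by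
  intro d hd
  rw [wt_one_one] at hd
  rw [coeff_yPrimitive, if_neg (by omega)]

theorem isSmooth_yPrimitive (m : ℕ) (hA : ∀ μ, IsSmooth V (A μ)) :
    IsSmooth V (yPrimitive m A) := by
  intro d
  simp only [coeff_yPrimitive]
  split_ifs
  · refine contDiffOn_const.mul ?_
    exact IsSmooth.sum _ (fun μ _ => IsFinBil.mul.isSmooth (isSmooth_const _) (hA μ)) d
  · exact contDiffOn_const

/-- Poincaré lemma in the `y`-directions: by closedness, `∂_ν (∑ y^μ A_μ) = A_ν + ∑ y^μ ∂_μ A_ν`,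
which is `A_ν` times one plus its `y`-degree. The normalization of the primitive divides by the same
number. -/
theorem coeff_dY_yPrimitive (hV : IsOpen V) {m : ℕ} (hm : 2 ≤ m)
    (hA : AgreesBelow V m A) (hflat : IsFlat V A) (ν : Fin n) {x : Pt n} (hx : x ∈ V)
    {e : Expo n} (he : fedosovDegree e = m) :
    coeff e (dY ν (yPrimitive m A x)) = coeff e (A ν x) := by
  have hfe : fedosovDegree (e + Finsupp.single (yVar ν) 1) = m + 1 := by
    rw [← wt_one_one, wt_add, wt_one_one, he]
    simp [wt]
  have hsum : ∑ a, ((e + Finsupp.single (yVar ν) 1 : Expo n) (yVar a) : ℝ) =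
      ∑ a, (e (yVar a) : ℝ) + 1 := by
    simp only [Finsupp.add_apply, Nat.cast_add, Finset.sum_add_distrib]
    congr 1
    simp [Finsupp.single_apply]
  have hpos : ∑ a, (e (yVar a) : ℝ) + 1 ≠ 0 := by positivity
  have hG : coeff e (dY ν (∑ μ, X (yVar μ) * A μ x)) =
      (∑ a, (e (yVar a) : ℝ) + 1) * coeff e (A ν x) := by
    have h1 : ∀ μ, coeff e (dY ν (X (yVar μ) * A μ x)) =
        (if μ = ν then coeff e (A ν x) else 0) + e (yVar μ) * coeff e (A ν x) := by
      intro μ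
      rw [(isLin_y μ).dY_mul, map_add]
      congr 1
      · by_cases h : μ = ν
        · subst h; simp
        · simp [h, Ne.symm h]
      · rw [← coeff_X_mul_pderiv]
        refine coeff_X_mul_congr _ fun e' he' => ?_
        refine hA.closed hV hm hflat μ ν hx ?_
        rw [he', ← wt_one_one, wt_add, wt_one_one e'] at he
        simp [wt] at he
        omega
    rw [dY_sum, map_sum]
    simp only [h1]
    rw [Finset.sum_add_distrib, ← Finset.sum_mul, Finset.sum_ite_eq' Finset.univ ν]
    simp only [Finset.mem_univ, if_true]
    ring
  rw [dY, coeff_pderiv] at hG ⊢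
  rw [coeff_yPrimitive, if_pos hfe, hsum, mul_assoc, hG]
  field_simp

/-- Successive approximations to the parameter that brings `A` to `dx^a p_a`. -/
def normalizer (A : Conn n) : ℕ → Sec n
  | 0 => fun _ => 0
  | k + 1 => fun x => normalizer A k x + yPrimitive (k + 2) (gaugeSum (normalizer A k) A) x

/-- The discrepancy of degree `k + 2` left at stage `k` is closed since the transform is still flat.
By `gaugeSum_add`, adding its primitive to the parameter subtracts exactly this term and changes
nothing below. -/
theorem normalizer_spec (hV : IsOpen V) (hA : ∀ μ, IsSmooth V (A μ)) (hA2 : AgreesBelow V 2 A)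
    (hflat : IsFlat V A) (k : ℕ) :
    IsSmooth V (normalizer A k) ∧ (∀ x ∈ V, OrdGE 1 1 3 (normalizer A k x)) ∧
      AgreesBelow V (k + 2) (gaugeSum (normalizer A k) A) := by
  have hA1 : ∀ μ, ∀ x ∈ V, OrdGE 1 1 1 (A μ x) := fun μ x hx => hA2.ordGE (by omega) μ hx
  induction k with
  | zero =>
    refine ⟨isSmooth_const 0, fun x _ => OrdGE.zero, fun μ x hx d hd => ?_⟩
    have hl : ∀ x ∈ V, OrdGE 1 1 3 (normalizer A 0 x) := fun x _ => OrdGE.zero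
    rw [map_sub, coeff_gaugeSum (K := 1), Finset.sum_range_one]
    · have := hA2 μ x hx d hd
      rwa [map_sub] at this
    · intro k hk
      obtain ⟨k, rfl⟩ : ∃ k', k = k' + 1 := ⟨k - 1, by omega⟩
      exact ordGE_gaugeTerm hV hA1 hl k μ hx d hd
  | succ k ih =>
    obtain ⟨h1, h2, h3⟩ := ih
    have hfin := gaugeFinite_of_ordGE (i := 1) (j := 1) (A := A) h2
    have hs := hfin.isSmooth hV hA h1
    have hfl := hfin.isFlat hV hA h1 hflat
    have h4 := isSmooth_yPrimitive (k + 2) hs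
    refine ⟨h1.add h4, fun x hx => (h2 x hx).add
      ((ordGE_yPrimitive (k + 2) _ x).mono (by omega)), fun μ x hx d hd => ?_⟩
    have h5 := gaugeSum_add hV (m := k + 2) (by omega) hA2 h1 h4 h2
      (fun x _ => ordGE_yPrimitive (k + 2) _ x) μ hx d (by omega)
    have h6 : coeff d (gaugeSum (normalizer A k) A μ x) -
        coeff d (dY μ (yPrimitive (k + 2) (gaugeSum (normalizer A k) A) x)) =
        coeff d (X (pVar μ) : Weyl n) := by
      rcases Nat.lt_or_ge (wt 1 1 d) (k + 2) with hlt | hge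
      · have h7 := h3 μ x hx d hlt
        rw [map_sub, sub_eq_zero] at h7
        rw [h7, dY, coeff_pderiv, ordGE_yPrimitive, zero_mul, sub_zero]
        rw [wt_add]
        simp only [wt, yWt_y, pWt_y] at hlt ⊢
        omega
      · have hd' : fedosovDegree d = k + 2 := by
          rw [← wt_one_one]
          omega
        rw [coeff_dY_yPrimitive hV (by omega) h3 hfl μ hx hd', sub_self]
        classical
        rw [coeff_X, if_neg]
        rintro rfl
        simp [fedosovDegree_eq] at hd'
    rw [map_add, map_sub] at h5
    rw [map_sub, ← h6]
    change coeff d (gaugeSum (fun x => normalizer A k x +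
      yPrimitive (k + 2) (gaugeSum (normalizer A k) A) x) A μ x) - _ = 0
    linarith

/-- The correction made at stage `l` has degree `l + 3`, so a given coefficient eventually stops
changing. -/
theorem coeff_normalizer_of_le (A : Conn n) {k l : ℕ} (hkl : k ≤ l) (x : Pt n) {d : Expo n}
    (hd : fedosovDegree d < k + 3) : coeff d (normalizer A l x) = coeff d (normalizer A k x) := by
  induction l, hkl using Nat.le_induction with
  | base => rfl
  | succ l hl ih =>
    rw [← ih]
    change coeff d (normalizer A l x + _) = _
    rw [map_add, ordGE_yPrimitive _ _ _ d (by rw [wt_one_one]; omega), add_zero]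

theorem gaugeStep_segalConn (hV : IsOpen V) (hA : ∀ μ, IsSmooth V (A μ))
    (hA2 : AgreesBelow V 2 A) (hflat : IsFlat V A) : GaugeStep V A (segalConn n) := by
  -- The coefficientwise limit of the approximations: the coefficient at `d` is already stable at
  -- stage `fedosovDegree d`.
  let L : Sec n := fun x d => coeff d (normalizer A (fedosovDegree d) x)
  have hL : ∀ x d, coeff d (L x) = coeff d (normalizer A (fedosovDegree d) x) := fun _ _ => rfl
  have hdiff : ∀ k x, OrdGE 1 1 (k + 2 + 1) (L x - normalizer A k x) := by
    intro k x d hd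
    rw [wt_one_one] at hd
    rw [map_sub, hL, sub_eq_zero]
    rcases le_total k (fedosovDegree d) with h | h
    · exact coeff_normalizer_of_le A h x (by omega)
    · exact (coeff_normalizer_of_le A h x (by omega)).symm
  have hLs : IsSmooth V L := fun d => (normalizer_spec hV hA hA2 hflat _).1 d
  have hLo : ∀ x ∈ V, OrdGE 1 1 3 (L x) := fun x hx d hd => by
    rw [hL]
    exact (normalizer_spec hV hA hA2 hflat _).2.1 x hx d hd
  have hfin := gaugeFinite_of_ordGE (i := 1) (j := 1) (A := A) hLo
  have heq : ∀ μ, ∀ x ∈ V, gaugeSum L A μ x = segalConn n μ x := by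
    intro μ x hx
    ext d
    obtain ⟨h1, h2, h3⟩ := normalizer_spec hV hA hA2 hflat (fedosovDegree d)
    have h4 := gaugeSum_add hV (m := fedosovDegree d + 2) (by omega) hA2 h1 (hLs.sub h1) h2
      (fun x _ => hdiff _ x) μ hx d (by rw [wt_one_one]; omega)
    have h5 := h3 μ x hx d (by rw [wt_one_one]; omega)
    have h6 : coeff d (dY μ (L x - normalizer A (fedosovDegree d) x)) = 0 := by
      rw [dY, coeff_pderiv, hdiff, zero_mul]
      rw [wt_add, wt_one_one]
      simp [wt]
    rw [map_add, map_sub, h6] at h4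
    rw [map_sub] at h5
    have h7 : (fun z => normalizer A (fedosovDegree d) z +
        (L z - normalizer A (fedosovDegree d) z)) = L := by
      funext z
      abel
    rw [h7] at h4
    change _ = coeff d (X (pVar μ) : Weyl n)
    linarith
  refine ⟨hA, fun μ => isSmooth_const _, L, hLs, Or.inl fun x hx d hd => ?_, fun μ x hx d => ?_⟩
  · exact hLo x hx d (by rw [wt_one_one]; omega)
  · have := hfin.isGaugeTransform μ x hx d
    rwa [heq μ x hx] at this

end

/-! ### Restriction to smaller sets -/

theorem IsPolyP.mono {n : ℕ} {V W : Set (Pt n)} {F : Sec n} (h : IsPolyP V F) (hW : W ⊆ V) :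
    IsPolyP W F := fun m => by
  obtain ⟨N, hN⟩ := h m
  exact ⟨N, fun x hx => hN x (hW hx)⟩

theorem IsFlat.mono {n : ℕ} {V W : Set (Pt n)} {A : Conn n} (h : IsFlat V A) (hW : W ⊆ V) :
    IsFlat W A := fun μ ν x hx => h μ ν x (hW hx)

theorem GaugeStep.mono {n : ℕ} {V W : Set (Pt n)} {A A' : Conn n} (h : GaugeStep V A A')
    (hW : W ⊆ V) : GaugeStep W A A' := by
  obtain ⟨h1, h2, lam, h3, h4, h5⟩ := h
  refine ⟨fun μ => (h1 μ).mono hW, fun μ => (h2 μ).mono hW, lam, h3.mono hW, ?_,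
    fun μ x hx => h5 μ x (hW hx)⟩
  rcases h4 with h4 | ⟨h4, h6⟩
  · exact Or.inl fun x hx => h4 x (hW hx)
  · exact Or.inr ⟨fun x hx => h4 x (hW hx), fun μ => (h6 μ).mono hW⟩

theorem GaugeEquivalent.mono {n : ℕ} {V W : Set (Pt n)} {A A' : Conn n}
    (h : GaugeEquivalent V A A') (hW : W ⊆ V) : GaugeEquivalent W A A' :=
  Relation.EqvGen.mono (fun _ _ h => GaugeStep.mono h hW) _ _ h

theorem GaugeStep.equivalent {n : ℕ} {V : Set (Pt n)} {A A' : Conn n} (h : GaugeStep V A A') :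
    GaugeEquivalent V A A' := Relation.EqvGen.rel _ _ h

theorem GaugeEquivalent.trans {n : ℕ} {V : Set (Pt n)} {A A' A'' : Conn n}
    (h : GaugeEquivalent V A A') (h' : GaugeEquivalent V A' A'') : GaugeEquivalent V A A'' :=
  Relation.EqvGen.trans _ _ _ h h'

/-! ### Smooth matrices -/

/-- All entries of `M` are smooth on `V`. -/
def SmoothMat {n : ℕ} (V : Set (Pt n)) (M : Pt n → Matrix (Fin n) (Fin n) ℝ) : Prop :=
  ∀ i j, ContDiffOn ℝ ∞ (fun x => M x i j) V

namespace SmoothMat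

variable {n : ℕ} {V : Set (Pt n)} {M N : Pt n → Matrix (Fin n) (Fin n) ℝ}

theorem mono {W : Set (Pt n)} (h : SmoothMat V M) (hW : W ⊆ V) : SmoothMat W M :=
  fun i j => (h i j).mono hW

theorem mul (hM : SmoothMat V M) (hN : SmoothMat V N) : SmoothMat V fun x => M x * N x := by
  intro i j
  simp only [Matrix.mul_apply]
  exact ContDiffOn.sum fun k _ => (hM i k).mul (hN k j)

theorem det (hM : SmoothMat V M) : ContDiffOn ℝ ∞ (fun x => (M x).det) V := by
  simp only [Matrix.det_apply]
  refine ContDiffOn.sum fun σ _ => ContDiffOn.const_smul _ ?_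
  exact contDiffOn_prod fun i _ => hM (σ i) i

theorem adjugate (hM : SmoothMat V M) : SmoothMat V fun x => (M x).adjugate := by
  intro i j
  simp only [Matrix.adjugate_apply]
  refine SmoothMat.det (M := fun x => (M x).updateRow j (Pi.single i 1)) fun k l => ?_
  simp only [Matrix.updateRow_apply]
  split_ifs
  · exact contDiffOn_const
  · exact hM k l

theorem inv (hM : SmoothMat V M) (h : ∀ x ∈ V, (M x).det ≠ 0) :
    SmoothMat V fun x => (M x)⁻¹ := by
  intro i j
  simp only [Matrix.inv_def, Matrix.smul_apply, Ring.inverse_eq_inv', smul_eq_mul]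
  exact (hM.det.inv h).mul (hM.adjugate i j)

end SmoothMat

/-! ### Linear parts of connections -/

/-- The coefficients of `y^a` in `A_μ (x)`. -/
def yFrame {n : ℕ} (A : Conn n) (x : Pt n) : Matrix (Fin n) (Fin n) ℝ :=
  Matrix.of fun μ a => coeff (Finsupp.single (yVar a) 1) (A μ x)

/-- Smooth flat connections on `V` whose component of Fedosov degree zero vanishes. -/
structure IsFlatCentered {n : ℕ} (V : Set (Pt n)) (A : Conn n) : Prop where
  smooth : ∀ μ, IsSmooth V (A μ)
  flat : IsFlat V A
  centered : ∀ μ, ∀ x ∈ V, coeff 0 (A μ x) = 0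

theorem IsFlatCentered.mono {n : ℕ} {V W : Set (Pt n)} {A : Conn n} (h : IsFlatCentered V A)
    (hW : W ⊆ V) : IsFlatCentered W A :=
  ⟨fun μ => (h.smooth μ).mono hW, h.flat.mono hW, fun μ x hx => h.centered μ x (hW hx)⟩

/-- The quadratic parameter `½ ∑ s_{ab} v^a v^b` in the variables `v`. -/
def quadParam {n : ℕ} (v : Fin n → WeylVar n) (s : Pt n → Matrix (Fin n) (Fin n) ℝ) : Sec n :=
  fun x => ∑ a, ∑ b, (2⁻¹ * s x a b) • (X (v a) * X (v b))

theorem isSmooth_quadParam {n : ℕ} {V : Set (Pt n)} (v : Fin n → WeylVar n)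
    {s : Pt n → Matrix (Fin n) (Fin n) ℝ} (hs : SmoothMat V s) :
    IsSmooth V (quadParam v s) :=
  IsSmooth.sum _ fun a _ => IsSmooth.sum _ fun b _ =>
    (isSmooth_const _).fun_smul (contDiffOn_const.mul (hs a b))

theorem coeff_single_X_mul {n : ℕ} (v w : WeylVar n) (f : Weyl n) :
    coeff (Finsupp.single w 1) (X v * f) = if v = w then coeff 0 f else 0 := by
  classical
  change coeff _ (monomial _ 1 * _) = _
  rw [coeff_monomial_mul, one_mul]
  by_cases h : v = w
  · subst h
    simp
  · rw [if_neg, if_neg h]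
    rw [Finsupp.single_le_iff, Finsupp.single_eq_of_ne h]
    omega

theorem coeff_zero_pderiv {n : ℕ} (v : WeylVar n) (f : Weyl n) :
    coeff 0 (pderiv ℝ v f) = coeff (Finsupp.single v 1) f := by
  rw [coeff_pderiv]
  simp

section

variable {n : ℕ} {V : Set (Pt n)} {A : Conn n} {s : Pt n → Matrix (Fin n) (Fin n) ℝ}

theorem ordGE_quadParam {i j m : ℕ} {v : Fin n → WeylVar n}
    (hv : ∀ a, 2 * wt i j (Finsupp.single (v a) 1) = m) (x : Pt n) :
    OrdGE i j m (quadParam v s x) := by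
  classical
  intro d hd
  rw [quadParam, map_sum]
  refine Finset.sum_eq_zero fun a _ => ?_
  rw [map_sum]
  refine Finset.sum_eq_zero fun b _ => ?_
  have : (X (v a) * X (v b) : Weyl n) =
      monomial (Finsupp.single (v a) 1 + Finsupp.single (v b) 1) 1 := by
    rw [X, X, monomial_mul_monomial, one_mul]
  rw [map_smul, this, coeff_monomial, if_neg, smul_zero]
  rintro rfl
  rw [wt_add] at hd
  have h1 := hv a
  have h2 := hv b
  omega

/-- In the applications `w` is conjugate to `v` and `ε = ±1` is the sign of the Poisson bracket. The
symmetry of `s` merges the two Leibniz terms and absorbs the factor `1/2`. -/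
theorem bracket_quadParam {v w : Fin n → WeylVar n} {ε : ℝ}
    (hvw : ∀ a b f, bracket f (X (v a) * X (v b) : Weyl n) =
      -(ε • (X (v a) * pderiv ℝ (w b) f + X (v b) * pderiv ℝ (w a) f))) {x : Pt n}
    (hs : (s x).IsSymm) (f : Weyl n) :
    bracket f (quadParam v s x) =
      -(ε • ∑ a, ∑ b, s x a b • (X (v b) * pderiv ℝ (w a) f)) := by
  have h1 : bracket f (quadParam v s x) =
      ∑ a, ∑ b, (2⁻¹ * s x a b) • bracket f (X (v a) * X (v b)) := by
    simp only [quadParam, bracket_eq, map_sum, map_smul]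
  have h2 : ∑ a, ∑ b, s x a b • (X (v a) * pderiv ℝ (w b) f : Weyl n) =
      ∑ a, ∑ b, s x a b • (X (v b) * pderiv ℝ (w a) f) := by
    rw [Finset.sum_comm]
    refine Finset.sum_congr rfl fun a _ => Finset.sum_congr rfl fun b _ => ?_
    rw [hs.apply]
  have h3 : ∑ a, ∑ b, (2⁻¹ * s x a b) • bracket f (X (v a) * X (v b)) =
      -((2⁻¹ * ε) • (∑ a, ∑ b, s x a b • (X (v a) * pderiv ℝ (w b) f : Weyl n) +
        ∑ a, ∑ b, s x a b • (X (v b) * pderiv ℝ (w a) f))) := by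
    simp only [hvw, ← Finset.sum_add_distrib, Finset.smul_sum, ← Finset.sum_neg_distrib]
    refine Finset.sum_congr rfl fun a _ => Finset.sum_congr rfl fun b _ => ?_
    module
  rw [h1, h3, h2]
  module

/-- The effect on the linear part of a gauge transformation whose parameter is quadratic in one
half of the variables. -/
theorem exists_gaugeStep_quad (hV : IsOpen V) (hA : IsFlatCentered V A) {i j : ℕ}
    {v w : Fin n → WeylVar n} {ε : ℝ} (hv : Function.Injective v) (hvw' : ∀ a b, v a ≠ w b)
    (hvwt : ∀ a, 2 * wt i j (Finsupp.single (v a) 1) = i + j + 1)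
    (hvf : ∀ a, wt 1 1 (Finsupp.single (v a) 1) = 1)
    (hwf : ∀ a, wt 1 1 (Finsupp.single (w a) 1) = 1)
    (hvw : ∀ a b f, bracket f (X (v a) * X (v b) : Weyl n) =
      -(ε • (X (v a) * pderiv ℝ (w b) f + X (v b) * pderiv ℝ (w a) f)))
    (hsm : SmoothMat V s) (hs : ∀ x ∈ V, (s x).IsSymm) :
    ∃ A', GaugeStep V A A' ∧ IsFlatCentered V A' ∧ ∀ μ, ∀ x ∈ V, ∀ c,
      coeff (Finsupp.single (w c) 1) (A' μ x) = coeff (Finsupp.single (w c) 1) (A μ x) ∧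
      coeff (Finsupp.single (v c) 1) (A' μ x) = coeff (Finsupp.single (v c) 1) (A μ x) -
        ε * ∑ a, coeff (Finsupp.single (w a) 1) (A μ x) * s x a c := by
  have hls := isSmooth_quadParam (V := V) v hsm
  have hfin : GaugeFinite V (quadParam v s) A :=
    gaugeFinite_of_ordGE (i := i) (j := j) fun x _ => ordGE_quadParam hvwt x
  have hl2 : ∀ x ∈ V, OrdGE 1 1 2 (quadParam v s x) := fun x _ => ordGE_quadParam (fun a => by rw [hvf]) x
  have hb0 : ∀ x ∈ V, ∀ f, coeff 0 (bracket f (quadParam v s x)) = 0 := by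
    intro x hx f
    rw [bracket_quadParam hvw (hs x hx)]
    simp
  have hbw : ∀ x ∈ V, ∀ f c,
      coeff (Finsupp.single (w c) 1) (bracket f (quadParam v s x)) = 0 := by
    intro x hx f c
    rw [bracket_quadParam hvw (hs x hx)]
    simp [coeff_single_X_mul, hvw']
  have hbv : ∀ x ∈ V, ∀ f c,
      coeff (Finsupp.single (v c) 1) (bracket f (quadParam v s x)) =
        -(ε * ∑ a, coeff (Finsupp.single (w a) 1) f * s x a c) := by
    intro x hx f c
    rw [bracket_quadParam hvw (hs x hx)]
    simp [coeff_single_X_mul, coeff_zero_pderiv, hv.eq_iff, mul_comm]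
  -- The inhomogeneous term `dlam` is quadratic, so it does not touch degrees zero and one.
  have hd : ∀ μ, ∀ x ∈ V, ∀ d, wt 1 1 d < 2 → ∀ k : ℕ,
      coeff d (if k = 0 then dX μ (quadParam v s) x else 0) = 0 := by
    intro μ x hx d hd k
    split_ifs
    · exact OrdGE.dX hV hl2 μ hx d hd
    · exact map_zero _
  have ht : ∀ k μ, ∀ x ∈ V, ∀ d, wt 1 1 d < 2 →
      coeff d (gaugeTerm (quadParam v s) A (k + 1) μ x) = (k + 1 : ℝ)⁻¹ *
        coeff d (bracket (gaugeTerm (quadParam v s) A k μ x) (quadParam v s x)) := by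
    intro k μ x hx d hwt
    rw [gaugeTerm_succ_eq, map_smul, map_add, hd μ x hx d hwt k, add_zero, smul_eq_mul]
  have htw : ∀ k μ, ∀ x ∈ V, ∀ c,
      coeff (Finsupp.single (w c) 1) (gaugeTerm (quadParam v s) A (k + 1) μ x) = 0 := by
    intro k μ x hx c
    rw [ht k μ x hx _ (by rw [hwf]; omega), hbw x hx, mul_zero]
  refine ⟨gaugeSum (quadParam v s) A, hfin.gaugeStep hV hA.smooth hls (Or.inl fun x hx d hd => ?_),
    ⟨hfin.isSmooth hV hA.smooth hls, hfin.isFlat hV hA.smooth hls hA.flat, fun μ x hx => ?_⟩,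
    fun μ x hx c => ⟨?_, ?_⟩⟩
  · exact hl2 x hx d (by rw [wt_one_one]; omega)
  · rw [coeff_gaugeSum (K := 1), Finset.sum_range_one]
    · exact hA.centered μ x hx
    · intro k hk
      obtain ⟨k, rfl⟩ : ∃ k', k = k' + 1 := ⟨k - 1, by omega⟩
      rw [ht k μ x hx _ (by simp [wt, yWt, pWt]), hb0 x hx, mul_zero]
  · rw [coeff_gaugeSum (K := 1), Finset.sum_range_one]
    · rfl
    · intro k hk
      obtain ⟨k, rfl⟩ : ∃ k', k = k' + 1 := ⟨k - 1, by omega⟩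
      exact htw k μ x hx c
  -- The bracket turns `w`-coefficients into `v`-coefficients and produces no linear
  -- `w`-coefficients. On linear parts it is thus nilpotent of order two, and the series stops after
  -- first order.
  · rw [coeff_gaugeSum (K := 2), Finset.sum_range_succ, Finset.sum_range_one]
    · rw [ht 0 μ x hx _ (by rw [hvf]; omega), hbv x hx]
      simp only [gaugeTerm]
      simp [sub_eq_add_neg]
    · intro k hk
      obtain ⟨k, rfl⟩ : ∃ k', k = k' + 1 + 1 := ⟨k - 2, by omega⟩
      rw [ht (k + 1) μ x hx _ (by rw [hvf]; omega), hbv x hx]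
      simp [htw k μ x hx]

theorem exists_gaugeStep_yy (hV : IsOpen V) (hA : IsFlatCentered V A) (hsm : SmoothMat V s)
    (hs : ∀ x ∈ V, (s x).IsSymm) :
    ∃ A', GaugeStep V A A' ∧ IsFlatCentered V A' ∧ ∀ x ∈ V,
      vielbein A' x = vielbein A x ∧ yFrame A' x = yFrame A x - vielbein A x * s x := by
  -- Weights `y ↦ 2`, `p ↦ 1`, `ħ ↦ 3` give `y^a y^b` the weight `4 = 2 + 1 + 1` required for a
  -- finite series.
  obtain ⟨A', h1, h2, h3⟩ := exists_gaugeStep_quad (i := 2) (j := 1) (ε := 1) (v := yVar)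
    (w := pVar) hV hA Sum.inl_injective (by simp) (by simp [wt]) (by simp [wt]) (by simp [wt])
    (fun a b f => by
      rw [bracket_lin_mul_lin (isLin_y a) (isLin_y b), linHam_y, linHam_y, one_smul]
      rfl) hsm hs
  refine ⟨A', h1, h2, fun x hx => ⟨?_, ?_⟩⟩
  · ext μ c
    exact (h3 μ x hx c).1
  · ext μ c
    rw [Matrix.sub_apply, Matrix.mul_apply]
    have := (h3 μ x hx c).2
    rwa [one_mul] at this

theorem exists_gaugeStep_pp (hV : IsOpen V) (hA : IsFlatCentered V A) (hsm : SmoothMat V s)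
    (hs : ∀ x ∈ V, (s x).IsSymm) :
    ∃ A', GaugeStep V A A' ∧ IsFlatCentered V A' ∧ ∀ x ∈ V,
      yFrame A' x = yFrame A x ∧ vielbein A' x = vielbein A x + yFrame A x * s x := by
  -- The roles of `y` and `p` are exchanged: `p_a p_b` has weight `4`, and the conjugate pair in the
  -- opposite order gives the sign `ε = -1`.
  obtain ⟨A', h1, h2, h3⟩ := exists_gaugeStep_quad (i := 1) (j := 2) (ε := -1) (v := pVar)
    (w := yVar) hV hA (Sum.inr_injective.comp Sum.inl_injective) (by simp) (by simp [wt])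
    (by simp [wt]) (by simp [wt])
    (fun a b f => by
      rw [bracket_lin_mul_lin (isLin_p a) (isLin_p b), linHam_p, linHam_p]
      simp only [mul_neg, neg_smul, one_smul, neg_add, neg_neg]
      rfl) hsm hs
  refine ⟨A', h1, h2, fun x hx => ⟨?_, ?_⟩⟩
  · ext μ c
    exact (h3 μ x hx c).1
  · ext μ c
    rw [Matrix.add_apply, Matrix.mul_apply]
    have := (h3 μ x hx c).2
    rwa [neg_mul, one_mul, sub_neg_eq_add] at this

/-! ### Isotropy of the linear part and removal of its `y`-components -/

theorem coeff_zero_bracket (f g : Weyl n) :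
    coeff 0 (bracket f g) =
      ∑ a, (coeff (Finsupp.single (yVar a) 1) f * coeff (Finsupp.single (pVar a) 1) g -
        coeff (Finsupp.single (pVar a) 1) f * coeff (Finsupp.single (yVar a) 1) g) := by
  have h : ∀ f g : Weyl n, coeff (Finsupp.single hVar 1) (star f g) =
      coeff (Finsupp.single hVar 1) (f * g) + 2⁻¹ *
      ∑ a, (coeff (Finsupp.single (yVar a) 1) f * coeff (Finsupp.single (pVar a) 1) g -
        coeff (Finsupp.single (pVar a) 1) f * coeff (Finsupp.single (yVar a) 1) g) := by
    intro f g
    rw [star, coeff_hbarSum _ _ (N := 2) (by simp), Finset.sum_range_succ, Finset.sum_range_one,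
      pow_zero, one_mul, moyalCoeff_zero, one_smul, pow_one, coeff_single_X_mul, if_pos rfl,
      map_smul]
    have h0 : ∀ u v : Weyl n, coeff 0 (u * v) = coeff 0 u * coeff 0 v := fun u v => by
      simp only [coeff_zero_eq_constantCoeff, map_mul]
    congr 1
    simp only [poissonPow, moyalCoeff, map_sum, map_sub, h0, dY, dP, coeff_zero_pderiv]
    simp
  have h' : coeff 0 (bracket f g) = coeff (Finsupp.single hVar 1) (star f g - star g f) := by
    have : coeff 0 (bracket f g) = coeff (0 + Finsupp.single hVar 1) (star f g - star g f) := rfl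
    rw [this, zero_add]
  rw [h', map_sub, h, h, mul_comm g f, ← sub_eq_zero]
  have e : ∑ a, (coeff (Finsupp.single (yVar a) 1) g * coeff (Finsupp.single (pVar a) 1) f -
        coeff (Finsupp.single (pVar a) 1) g * coeff (Finsupp.single (yVar a) 1) f) =
      -∑ a, (coeff (Finsupp.single (yVar a) 1) f * coeff (Finsupp.single (pVar a) 1) g -
        coeff (Finsupp.single (pVar a) 1) f * coeff (Finsupp.single (yVar a) 1) g) := by
    rw [← Finset.sum_neg_distrib]
    exact Finset.sum_congr rfl fun a _ => by ring
  rw [e]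
  ring

/-- The degree-zero part of flatness: with no degree-zero component of `A`, only the symplectic
pairing of the linear parts of `A_μ` and `A_ν` remains, and it must vanish. -/
theorem IsFlatCentered.isotropic (hV : IsOpen V) (hA : IsFlatCentered V A) {x : Pt n}
    (hx : x ∈ V) :
    yFrame A x * (vielbein A x).transpose = vielbein A x * (yFrame A x).transpose := by
  ext μ ν
  have h := congrArg (coeff 0) (hA.flat μ ν x hx)
  rw [map_add, map_sub, coeff_dX_eq_zero hV (hA.centered ν) μ hx,
    coeff_dX_eq_zero hV (hA.centered μ) ν hx, sub_self, zero_add, coeff_zero_bracket,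
    Finset.sum_sub_distrib, map_zero, sub_eq_zero] at h
  rw [Matrix.mul_apply, Matrix.mul_apply]
  exact h

theorem smoothMat_vielbein (hA : ∀ μ, IsSmooth V (A μ)) : SmoothMat V (vielbein A) :=
  fun μ _ => hA μ _

theorem smoothMat_yFrame (hA : ∀ μ, IsSmooth V (A μ)) : SmoothMat V (yFrame A) :=
  fun μ _ => hA μ _

/-- The shear by `s = e⁻¹ Y`, with `e` the vielbein and `Y` the matrix of `y`-components, subtracts
`e s = Y`. Isotropy `Y eᵀ = e Yᵀ` is precisely the symmetry of `s`. -/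
theorem exists_gaugeStep_yFrame_eq_zero (hV : IsOpen V) (hA : IsFlatCentered V A)
    (hdet : ∀ x ∈ V, (vielbein A x).det ≠ 0) :
    ∃ A', GaugeStep V A A' ∧ IsFlatCentered V A' ∧ ∀ x ∈ V,
      vielbein A' x = vielbein A x ∧ yFrame A' x = 0 := by
  obtain ⟨A', h1, h2, h3⟩ := exists_gaugeStep_yy (s := fun x => (vielbein A x)⁻¹ * yFrame A x) hV hA
    (((smoothMat_vielbein hA.smooth).inv hdet).mul (smoothMat_yFrame hA.smooth)) (by
      intro x hx
      have hu : IsUnit (vielbein A x).det := isUnit_iff_ne_zero.2 (hdet x hx)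
      have hu' : IsUnit (vielbein A x).transpose.det := by rwa [Matrix.det_transpose]
      rw [Matrix.IsSymm, Matrix.transpose_mul, Matrix.transpose_nonsing_inv]
      have h := hA.isotropic hV hx
      calc (yFrame A x).transpose * (vielbein A x).transpose⁻¹
          = (vielbein A x)⁻¹ * (vielbein A x * (yFrame A x).transpose) *
              (vielbein A x).transpose⁻¹ := by
            rw [Matrix.nonsing_inv_mul_cancel_left _ _ hu]
        _ = (vielbein A x)⁻¹ * yFrame A x := by
            rw [← h, ← Matrix.mul_assoc, Matrix.mul_nonsing_inv_cancel_right _ _ hu'])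
  refine ⟨A', h1, h2, fun x hx => ⟨(h3 x hx).1, ?_⟩⟩
  rw [(h3 x hx).2, Matrix.mul_nonsing_inv_cancel_left _ _ (isUnit_iff_ne_zero.2 (hdet x hx)),
    sub_self]

/-! ### Gaussian elimination on the vielbein by symplectic shears -/

/-- Flat connections whose component of Fedosov degree one is `dx^μ e_μ^a p_a` with an invertible
vielbein `e`. -/
structure IsFlatAligned (V : Set (Pt n)) (A : Conn n) : Prop extends IsFlatCentered V A where
  yFrame_eq : ∀ x ∈ V, yFrame A x = 0
  det_ne : ∀ x ∈ V, (vielbein A x).det ≠ 0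

theorem IsFlatAligned.mono {W : Set (Pt n)} (h : IsFlatAligned V A) (hW : W ⊆ V) :
    IsFlatAligned W A :=
  ⟨h.toIsFlatCentered.mono hW, fun x hx => h.yFrame_eq x (hW hx), fun x hx => h.det_ne x (hW hx)⟩

/-- The `yy` shear creates `y`-components `-e s`, and the `pp` shear feeds them back into the
vielbein as `-e s t`. A final `yy` shear clears the `y`-components again, which needs the new
vielbein to be invertible. -/
theorem IsFlatAligned.exists_mul (hV : IsOpen V) (hA : IsFlatAligned V A)
    {t : Pt n → Matrix (Fin n) (Fin n) ℝ} (hsm : SmoothMat V s) (hs : ∀ x ∈ V, (s x).IsSymm)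
    (htm : SmoothMat V t) (ht : ∀ x ∈ V, (t x).IsSymm)
    (hdet : ∀ x ∈ V, (1 - s x * t x).det ≠ 0) :
    ∃ A', GaugeEquivalent V A A' ∧ IsFlatAligned V A' ∧ ∀ x ∈ V,
      vielbein A' x = vielbein A x * (1 - s x * t x) := by
  obtain ⟨A₁, h1, h2, h3⟩ := exists_gaugeStep_yy hV hA.toIsFlatCentered hsm hs
  obtain ⟨A₂, h4, h5, h6⟩ := exists_gaugeStep_pp hV h2 htm ht
  have e : ∀ x ∈ V, vielbein A₂ x = vielbein A x * (1 - s x * t x) := by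
    intro x hx
    rw [(h6 x hx).2, (h3 x hx).1, (h3 x hx).2, hA.yFrame_eq x hx, zero_sub, mul_sub, mul_one,
      neg_mul, Matrix.mul_assoc, sub_eq_add_neg]
  have hd : ∀ x ∈ V, (vielbein A₂ x).det ≠ 0 := by
    intro x hx
    rw [e x hx, Matrix.det_mul]
    exact mul_ne_zero (hA.det_ne x hx) (hdet x hx)
  obtain ⟨A₃, h7, h8, h9⟩ := exists_gaugeStep_yFrame_eq_zero hV h5 hd
  refine ⟨A₃, (h1.equivalent.trans h4.equivalent).trans h7.equivalent,
    ⟨h8, fun x hx => (h9 x hx).2, fun x hx => ?_⟩, fun x hx => ?_⟩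
  · rw [(h9 x hx).1]
    exact hd x hx
  · rw [(h9 x hx).1, e x hx]

/-- Column operations on the vielbein: subtract multiples of the column `a`. -/
theorem IsFlatAligned.exists_column (hV : IsOpen V) (hA : IsFlatAligned V A) (a : Fin n)
    {v : Fin n → Pt n → ℝ} (hv : ∀ b, ContDiffOn ℝ ∞ (v b) V) (hva : ∀ x ∈ V, v a x ≠ 1) :
    ∃ A', GaugeEquivalent V A A' ∧ IsFlatAligned V A' ∧ ∀ x ∈ V, ∀ μ b,
      vielbein A' x μ b = vielbein A x μ b - vielbein A x μ a * v b x := by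
  let s : Pt n → Matrix (Fin n) (Fin n) ℝ := fun _ => Matrix.single a a 1
  let t : Pt n → Matrix (Fin n) (Fin n) ℝ := fun x => Matrix.of fun i j =>
    if i = a then v j x else if j = a then v i x else 0
  -- With `s` the projection on `e_a`, only row `a` of `t` matters. Any row extends to a symmetric
  -- matrix, so `s t` is an arbitrary rank-one matrix `e_a vᵀ`, and `det (1 - e_a vᵀ) = 1 - v_a`.
  have hst : ∀ x, s x * t x = Matrix.vecMulVec (Pi.single a 1) (fun j => v j x) := by
    intro x
    ext i j
    by_cases h : i = a
    · subst h
      simp [s, t, Matrix.vecMulVec_apply]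
    · rw [Matrix.single_mul_apply_of_ne _ _ _ _ _ h]
      simp [Matrix.vecMulVec_apply, h]
  obtain ⟨A', h1, h2, h3⟩ := hA.exists_mul hV (s := s) (t := t) (fun i j => contDiffOn_const)
    (fun x _ => by
      ext i j
      simp only [s, Matrix.transpose_apply, Matrix.single_apply]
      exact if_congr and_comm rfl rfl)
    (fun i j => by
      simp only [t, Matrix.of_apply]
      split_ifs
      · exact hv j
      · exact hv i
      · exact contDiffOn_const)
    (fun x _ => by
      ext i j
      simp only [t, Matrix.transpose_apply, Matrix.of_apply]
      split_ifs with h h' <;> simp_all)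
    (fun x hx => by
      rw [hst, sub_eq_add_neg, ← Matrix.neg_vecMulVec, Matrix.vecMulVec_eq Unit,
        Matrix.det_one_add_replicateCol_mul_replicateRow]
      have := hva x hx
      simp only [dotProduct_neg, dotProduct_single, mul_one]
      intro h
      apply this
      linarith)
  refine ⟨A', h1, h2, fun x hx μ b => ?_⟩
  rw [h3 x hx, hst, mul_sub, mul_one, Matrix.sub_apply, Matrix.mul_vecMulVec,
    Matrix.vecMulVec_apply]
  simp

theorem IsFlatAligned.exists_pivot {k : ℕ} (hk : k < n) (hA : IsFlatAligned V A) {x₀ : Pt n}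
    (hx₀ : x₀ ∈ V) (hrow : ∀ i j : Fin n, i.val < k → vielbein A x₀ i j = if i = j then 1 else 0) :
    ∃ b : Fin n, k ≤ b.val ∧ vielbein A x₀ ⟨k, hk⟩ b ≠ 0 := by
  by_contra hc
  push Not at hc
  -- If row `k` vanished from column `k` on, it would be the combination of the earlier unit rows
  -- with its own entries as coefficients, which gives a left null vector.
  refine hA.det_ne x₀ hx₀ (Matrix.exists_vecMul_eq_zero_iff.1
    ⟨fun i => (if i = ⟨k, hk⟩ then 1 else 0) -
      if i.val < k then vielbein A x₀ ⟨k, hk⟩ i else 0, ?_, ?_⟩)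
  · intro h
    have := congrFun h ⟨k, hk⟩
    simp at this
  · funext j
    rw [Matrix.vecMul, dotProduct]
    have h1 : ∀ i : Fin n, ((if i = ⟨k, hk⟩ then 1 else 0) -
        if i.val < k then vielbein A x₀ ⟨k, hk⟩ i else 0) * vielbein A x₀ i j =
        (if i = ⟨k, hk⟩ then vielbein A x₀ ⟨k, hk⟩ j else 0) -
          if i = j then (if j.val < k then vielbein A x₀ ⟨k, hk⟩ j else 0) else 0 := by
      intro i
      rw [sub_mul]
      congr 1
      · split_ifs with h
        · rw [h, one_mul]
        · rw [zero_mul]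
      · by_cases h : i.val < k
        · rw [if_pos h, hrow i j h]
          by_cases h' : i = j
          · subst h'
            simp [h]
          · simp [h']
        · rw [if_neg h, zero_mul]
          by_cases h' : i = j
          · subst h'
            simp [h]
          · simp [h']
    simp only [h1, Finset.sum_sub_distrib, Finset.sum_ite_eq', Finset.mem_univ, if_true]
    simp only [Pi.zero_apply]
    split_ifs with h
    · exact sub_self _
    · rw [hc j (by omega), sub_zero]

/-- Rows are normalized one at a time. The operations used for row `k` add multiples of columns of
index at least `k`, whose entries in the finished rows are zero, so these rows persist. -/
theorem IsFlatAligned.exists_rows (hV : IsOpen V) (hA : IsFlatAligned V A) {x₀ : Pt n}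
    (hx₀ : x₀ ∈ V) (k : ℕ) (hk : k ≤ n) :
    ∃ (W : Set (Pt n)) (A' : Conn n), IsOpen W ∧ x₀ ∈ W ∧ W ⊆ V ∧ GaugeEquivalent W A A' ∧
      IsFlatAligned W A' ∧ ∀ x ∈ W, ∀ i j : Fin n, i.val < k →
        vielbein A' x i j = if i = j then 1 else 0 := by
  induction k with
  | zero =>
    exact ⟨V, A, hV, hx₀, subset_rfl, Relation.EqvGen.refl _, hA,
      fun _ _ i _ hi => absurd hi (Nat.not_lt_zero _)⟩
  | succ k ih =>
    obtain ⟨W, B, hW, hxW, hWV, hAB, hB, hrow⟩ := ih (by omega)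
    let a : Fin n := ⟨k, by omega⟩
    obtain ⟨B', hBB', hB', hrow', hpiv⟩ : ∃ B', GaugeEquivalent W B B' ∧ IsFlatAligned W B' ∧
        (∀ x ∈ W, ∀ i j : Fin n, i.val < k → vielbein B' x i j = if i = j then 1 else 0) ∧
        vielbein B' x₀ a a ≠ 0 := by
      by_cases h : vielbein B x₀ a a = 0
      · obtain ⟨b, hkb, hb⟩ := hB.exists_pivot (k := k) (by omega) hxW (hrow x₀ hxW)
        have hab : a ≠ b := by
          rintro rfl
          exact hb h
        -- Adds column `b` to column `a`, so that the entry `(a, a)` at `x₀` becomes the nonzero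
        -- pivot.
        obtain ⟨B', h1, h2, h3⟩ := hB.exists_column hW b
          (v := fun c _ => if c = a then -1 else 0) (fun _ => contDiffOn_const)
          (fun x _ => by simp [hab.symm])
        refine ⟨B', h1, h2, fun x hx i j hi => ?_, ?_⟩
        · rw [h3 x hx, hrow x hx i b hi, if_neg, hrow x hx i j hi, zero_mul, sub_zero]
          rintro rfl
          omega
        · rw [h3 x₀ hxW, h]
          simpa using hb
      · exact ⟨B, Relation.EqvGen.refl _, hB, hrow, h⟩
    let W' : Set (Pt n) := W ∩ (fun x => vielbein B' x a a) ⁻¹' {0}ᶜ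
    have hsm := smoothMat_vielbein hB'.smooth
    have hW' : IsOpen W' := (hsm a a).continuousOn.isOpen_inter_preimage hW isOpen_compl_singleton
    have hWW' : W' ⊆ W := Set.inter_subset_left
    have hne : ∀ x ∈ W', vielbein B' x a a ≠ 0 := fun x hx => hx.2
    have hB'' := hB'.mono hWW'
    have hsm' := hsm.mono hWW'
    -- These coefficients turn row `a` into the unit row. The one for column `a` itself is `1 -
    -- 1/e_{aa}`, with `e_{aa}` the diagonal entry, hence never `1`.
    obtain ⟨B₂, h1, h2, h3⟩ := hB''.exists_column hW' a
      (v := fun b x => (vielbein B' x a b - if a = b then 1 else 0) * (vielbein B' x a a)⁻¹)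
      (fun b => ((hsm' a b).sub contDiffOn_const).mul ((hsm' a a).inv hne))
      (fun x hx h => by
        have := hne x hx
        rw [if_pos rfl] at h
        field_simp at h
        linarith)
    refine ⟨W', B₂, hW', ⟨hxW, hpiv⟩, hWW'.trans hWV,
      ((hAB.mono hWW').trans (hBB'.mono hWW')).trans h1, h2, fun x hx i j hi => ?_⟩
    rw [h3 x hx]
    by_cases hik : i.val < k
    · rw [hrow' x (hWW' hx) i a hik, if_neg, zero_mul, sub_zero, hrow' x (hWW' hx) i j hik]
      rintro rfl
      exact lt_irrefl k hik
    · obtain rfl : i = a := Fin.ext (by simp only [a]; omega)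
      rw [mul_left_comm, mul_inv_cancel₀ (hne x hx)]
      ring

theorem eq_of_fedosovDegree_lt_two {d : Expo n} (h : fedosovDegree d < 2) :
    d = 0 ∨ (∃ a, d = Finsupp.single (yVar a) 1) ∨ ∃ a, d = Finsupp.single (pVar a) 1 := by
  by_cases h0 : d = 0
  · exact Or.inl h0
  · right
    obtain ⟨v, hv⟩ := Finsupp.ne_iff.1 h0
    have hle : Finsupp.single v 1 ≤ d := by
      rw [Finsupp.single_le_iff]
      exact Nat.one_le_iff_ne_zero.2 hv
    obtain ⟨e, rfl⟩ := exists_add_of_le hle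
    have hzero : ∀ e : Expo n, fedosovDegree e = 0 → e = 0 := by
      intro e he
      unfold fedosovDegree at he
      ext w
      rcases w with a | a | ⟨⟩
      · have := Finset.single_le_sum (f := fun a => e (yVar a)) (fun _ _ => Nat.zero_le _)
          (Finset.mem_univ a)
        change e (yVar a) = 0
        omega
      · have := Finset.single_le_sum (f := fun a => e (pVar a)) (fun _ _ => Nat.zero_le _)
          (Finset.mem_univ a)
        change e (pVar a) = 0
        omega
      · change e hVar = 0
        omega
    rw [← wt_one_one, wt_add, wt_one_one e] at h
    rcases v with a | a | ⟨⟩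
    · refine Or.inl ⟨a, ?_⟩
      rw [hzero e, add_zero]
      simp [wt] at h
      omega
    · refine Or.inr ⟨a, ?_⟩
      rw [hzero e, add_zero]
      simp [wt] at h
      omega
    · change wt 1 1 (Finsupp.single hVar 1) + _ < 2 at h
      simp [wt] at h
      omega

/-- After all `n` rows are normalized, the terms of degree below two, namely `1`, `y^a` and `p_a`,
agree with those of `dx^a p_a`, and Fedosov's iteration takes over. -/
theorem IsFlatAligned.exists_equivalent (hV : IsOpen V) (hA : IsFlatAligned V A) {x₀ : Pt n}
    (hx₀ : x₀ ∈ V) :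
    ∃ W : Set (Pt n), IsOpen W ∧ x₀ ∈ W ∧ W ⊆ V ∧ GaugeEquivalent W A (segalConn n) := by
  classical
  obtain ⟨W, B, hW, hxW, hWV, hAB, hB, hrow⟩ := hA.exists_rows hV hx₀ n le_rfl
  refine ⟨W, hW, hxW, hWV, hAB.trans (gaugeStep_segalConn hW hB.smooth ?_ hB.flat).equivalent⟩
  intro μ x hx d hd
  rw [wt_one_one] at hd
  rw [map_sub, sub_eq_zero, coeff_X]
  rcases eq_of_fedosovDegree_lt_two hd with rfl | ⟨a, rfl⟩ | ⟨a, rfl⟩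
  · rw [hB.centered μ x hx, if_neg]
    intro h
    simpa using congrArg (fun d => d (pVar μ)) h
  · rw [if_neg]
    · exact congrFun (congrFun (hB.yFrame_eq x hx) μ) a
    · intro h
      simpa using congrArg (fun d => d (pVar μ)) h
  · have h := hrow x hx μ a μ.2
    change coeff _ _ = _ at h
    rw [h]
    refine if_congr ⟨fun h => by rw [h], fun h => ?_⟩ rfl rfl
    have := Finsupp.single_left_injective one_ne_zero h
    simpa using this.symm

end

/-! ### A smooth implicit function theorem -/

open Topology in
-- Smoothness of the implicit function at the base point alone gives neighbourhoods that may shrink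
-- with the order of differentiability. To get one neighbourhood, the implicit function theorem is
-- applied afresh at each nearby point of the graph, and local uniqueness identifies the two
-- solutions.
theorem exists_smooth_implicitFunction {E₁ E₂ F : Type*}
    [NormedAddCommGroup E₁] [NormedSpace ℝ E₁] [CompleteSpace E₁]
    [NormedAddCommGroup E₂] [NormedSpace ℝ E₂] [CompleteSpace E₂]
    [NormedAddCommGroup F] [NormedSpace ℝ F] [CompleteSpace F]
    {f : E₁ × E₂ → F} {S : Set (E₁ × E₂)} (hS : IsOpen S) (hf : ContDiffOn ℝ ∞ f S)
    {u : E₁ × E₂} (hu : u ∈ S) (hinv : (fderiv ℝ f u ∘L .inr ℝ E₁ E₂).IsInvertible) :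
    ∃ (W : Set E₁) (g : E₁ → E₂), IsOpen W ∧ u.1 ∈ W ∧ ContDiffOn ℝ ∞ g W ∧ g u.1 = u.2 ∧
      ∀ x ∈ W, (x, g x) ∈ S ∧ f (x, g x) = f u := by
  have hat : ∀ v ∈ S, ContDiffAt ℝ ∞ f v := fun v hv => hf.contDiffAt (hS.mem_nhds hv)
  have h0 : (∞ : WithTop ℕ∞) ≠ 0 := by simp
  let g := (hat u hu).implicitFunction h0 hinv
  have hgu : g u.1 = u.2 := (hat u hu).implicitFunction_apply_self h0 hinv
  have hgc : ContinuousAt g u.1 := ((hat u hu).contDiffAt_implicitFunction h0 hinv).continuousAt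
  have hpair : ContinuousAt (fun x => (x, g x)) u.1 := continuousAt_id.prodMk hgc
  have hpu : (u.1, g u.1) = u := by rw [hgu]
  have e1 : ∀ᶠ x in 𝓝 u.1, f (x, g x) = f u := (hat u hu).eventually_apply_implicitFunction h0 hinv
  have hD : ContinuousAt (fun v => fderiv ℝ f v ∘L .inr ℝ E₁ E₂) u := by
    have : ContinuousAt (fderiv ℝ f) u :=
      ((hat u hu).fderiv_right (m := 0) (by simp)).continuousAt
    exact this.clm_comp continuousAt_const
  have e2 : ∀ᶠ v in 𝓝 u, v ∈ S ∧ (fderiv ℝ f v ∘L .inr ℝ E₁ E₂).IsInvertible ∧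
      ∀ᶠ w in 𝓝 v, f w = f u ↔ g w.1 = w.2 := by
    filter_upwards [hS.mem_nhds hu, hD.eventually (ContinuousLinearEquiv.isOpen.mem_nhds hinv),
      ((hat u hu).eventually_apply_eq_iff_implicitFunction h0 hinv).eventually_nhds]
      with v h1 h2 h3
    exact ⟨h1, h2, h3⟩
  have e3 : ∀ᶠ x in 𝓝 u.1, f (x, g x) = f u ∧ (x, g x) ∈ S ∧
      (fderiv ℝ f (x, g x) ∘L .inr ℝ E₁ E₂).IsInvertible ∧
      ∀ᶠ w in 𝓝 (x, g x), f w = f u ↔ g w.1 = w.2 := by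
    rw [ContinuousAt, hpu] at hpair
    filter_upwards [e1, hpair.eventually e2] with x h h'
    exact ⟨h, h'⟩
  obtain ⟨W, hW, hWo, huW⟩ := eventually_nhds_iff.1 e3
  refine ⟨W, g, hWo, huW, fun x hx => ?_, hgu, fun x hx => ⟨(hW x hx).2.1, (hW x hx).1⟩⟩
  obtain ⟨h1, h2, h3, h4⟩ := hW x hx
  let g' := (hat _ h2).implicitFunction h0 h3
  have hg' : ContDiffAt ℝ ∞ g' x := (hat _ h2).contDiffAt_implicitFunction h0 h3
  have hgx : g' x = g x := (hat _ h2).implicitFunction_apply_self h0 h3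
  have h5 : ∀ᶠ z in 𝓝 x, f (z, g' z) = f (x, g x) :=
    (hat _ h2).eventually_apply_implicitFunction h0 h3
  have hpair' : Filter.Tendsto (fun z => (z, g' z)) (𝓝 x) (𝓝 (x, g x)) := by
    have : ContinuousAt (fun z => (z, g' z)) x := continuousAt_id.prodMk hg'.continuousAt
    rwa [ContinuousAt, hgx] at this
  -- `g'` solves the same equation near `x` and its graph stays where solutions are unique, by `h4`.
  have h6 : g =ᶠ[𝓝 x] g' := by
    filter_upwards [h5, hpair'.eventually h4] with z hz hz'
    exact hz'.1 (hz.trans h1)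
  exact (hg'.congr_of_eventuallyEq h6).contDiffWithinAt

/-! ### Translations of the momenta -/

/-- The derivative `∑ π_a ∂/∂p_a`. -/
def dPDir {n : ℕ} (q : Fin n → ℝ) (f : Weyl n) : Weyl n := ∑ a, q a • dP a f

section

variable {n : ℕ}

theorem dPDir_add (q : Fin n → ℝ) (f g : Weyl n) : dPDir q (f + g) = dPDir q f + dPDir q g := by
  simp only [dPDir, dP_add, smul_add, Finset.sum_add_distrib]

theorem dPDir_smul (q : Fin n → ℝ) (r : ℝ) (f : Weyl n) : dPDir q (r • f) = r • dPDir q f := by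
  simp only [dPDir, dP_smul, Finset.smul_sum]
  exact Finset.sum_congr rfl fun a _ => smul_comm _ _ _

theorem coeff_dPDir (q : Fin n → ℝ) (f : Weyl n) (d : Expo n) :
    coeff d (dPDir q f) =
      ∑ a, q a * (coeff (d + Finsupp.single (pVar a) 1) f * (d (pVar a) + 1)) := by
  simp only [dPDir, map_sum, map_smul, dP, coeff_pderiv, smul_eq_mul]

/-- Each derivative uses up one power of `p` and leaves the order in `ħ` alone; bounded `p`-degree
is what makes translations finite. -/
theorem coeff_iterate_dPDir_eq_zero (q : Fin n → ℝ) {f : Weyl n} {m N : ℕ}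
    (hf : ∀ d : Expo n, d hVar = m → N < ∑ a, d (pVar a) → coeff d f = 0) (k : ℕ) {d : Expo n}
    (hd : d hVar = m) (hN : N < ∑ a, d (pVar a) + k) : coeff d ((dPDir q)^[k] f) = 0 := by
  induction k generalizing d with
  | zero => exact hf d hd hN
  | succ k ih =>
    rw [Function.iterate_succ_apply', coeff_dPDir]
    refine Finset.sum_eq_zero fun a _ => ?_
    rw [ih, zero_mul, mul_zero]
    · simpa using hd
    · have : ∑ b, (d + Finsupp.single (pVar a) 1 : Expo n) (pVar b) = ∑ b, d (pVar b) + 1 := by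
        simp only [Finsupp.add_apply, Finset.sum_add_distrib]
        congr 1
        simp [Finsupp.single_apply]
      omega

/-- The parameter `c(x) - ∑ π_a(x) y^a` of the translation `p ↦ p + π(x)`. -/
def transParam (c : Pt n → ℝ) (q : Pt n → Fin n → ℝ) : Sec n := fun x =>
  C (c x) - ∑ a, q x a • X (yVar a)

theorem coeff_zero_transParam (c : Pt n → ℝ) (q : Pt n → Fin n → ℝ) (x : Pt n) :
    coeff 0 (transParam c q x) = c x := by
  simp [transParam]

theorem coeff_transParam_eq_zero (c : Pt n → ℝ) (q : Pt n → Fin n → ℝ) (x : Pt n) {d : Expo n}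
    (hd : d ≠ 0) (hd' : ∀ a, d ≠ Finsupp.single (yVar a) 1) :
    coeff d (transParam c q x) = 0 := by
  classical
  rw [transParam, map_sub, coeff_C, if_neg hd, map_sum, zero_sub, neg_eq_zero]
  refine Finset.sum_eq_zero fun a _ => ?_
  rw [map_smul, coeff_X, if_neg (hd' a), smul_zero]

theorem isSmooth_transParam {V : Set (Pt n)} {c : Pt n → ℝ} {q : Pt n → Fin n → ℝ}
    (hc : ContDiffOn ℝ ∞ c V) (hq : ContDiffOn ℝ ∞ q V) : IsSmooth V (transParam c q) := by
  have h1 : IsSmooth V fun x => C (c x) := by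
    intro d
    classical
    simp only [coeff_C]
    split_ifs
    · exact hc
    · exact contDiffOn_const
  exact h1.sub (IsSmooth.sum _ fun a _ =>
    (isSmooth_const _).fun_smul ((contDiffOn_pi.1 hq) a))

theorem bracket_transParam (c : Pt n → ℝ) (q : Pt n → Fin n → ℝ) (x : Pt n) (f : Weyl n) :
    bracket f (transParam c q x) = dPDir (q x) f := by
  have h1 : bracket f (C (c x)) = 0 := by
    rw [← mul_one (C (c x)), ← smul_eq_C_mul, bracket_eq, map_smul, ← bracket_eq, bracket_one,
      smul_zero]
  rw [transParam, bracket_eq, map_sub, ← bracket_eq, h1, map_sum]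
  simp only [map_smul, ← bracket_eq, bracket_y, smul_neg, Finset.sum_neg_distrib, zero_sub, neg_neg]
  rfl

theorem coeff_dX_transParam_eq_zero {V : Set (Pt n)} (hV : IsOpen V) (c : Pt n → ℝ)
    (q : Pt n → Fin n → ℝ) (μ : Fin n) {x : Pt n} (hx : x ∈ V) {d : Expo n} {a : Fin n}
    (hd : d (pVar a) ≠ 0) : coeff d (dX μ (transParam c q) x) = 0 := by
  refine coeff_dX_eq_zero hV (fun z _ => coeff_transParam_eq_zero c q z ?_ ?_) μ hx
  · rintro rfl
    exact hd rfl
  · rintro b rfl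
    simp at hd

/-- The Taylor expansion of `A(p + π)`. The extra `dlam` appears only at first order since it is
free of `p` and thus killed by further derivatives. -/
theorem gaugeTerm_transParam {V : Set (Pt n)} (hV : IsOpen V) (c : Pt n → ℝ)
    (q : Pt n → Fin n → ℝ) (A : Conn n) (k : ℕ) (μ : Fin n) {x : Pt n} (hx : x ∈ V) :
    gaugeTerm (transParam c q) A k μ x =
      ((k ! : ℕ) : ℝ)⁻¹ • (dPDir (q x))^[k] (A μ x) +
        if k = 1 then dX μ (transParam c q) x else 0 := by
  have h0 : dPDir (q x) (dX μ (transParam c q) x) = 0 := by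
    ext d
    rw [coeff_dPDir, map_zero]
    refine Finset.sum_eq_zero fun a _ => ?_
    rw [coeff_dX_transParam_eq_zero hV c q μ hx (a := a) (by simp), zero_mul, mul_zero]
  have h00 : dPDir (q x) (0 : Weyl n) = 0 := by
    simp [dPDir, dP]
  induction k with
  | zero => simp [gaugeTerm]
  | succ k ih =>
    rw [gaugeTerm_succ_eq, ih, bracket_transParam, dPDir_add, dPDir_smul]
    have h1 : dPDir (q x) (if k = 1 then dX μ (transParam c q) x else 0) = 0 := by
      split_ifs
      · exact h0
      · exact h00
    rw [h1, add_zero, smul_add, Function.iterate_succ_apply', smul_smul]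
    congr 1
    · congr 1
      rw [Nat.factorial_succ]
      push_cast
      rw [mul_inv]
    · by_cases h : k = 0
      · subst h
        simp
      · rw [if_neg h, if_neg (by omega), smul_zero]

theorem gaugeFinite_transParam {V : Set (Pt n)} (hV : IsOpen V) (c : Pt n → ℝ)
    (q : Pt n → Fin n → ℝ) {A : Conn n} (hA : ∀ μ, IsPolyP V (A μ)) :
    GaugeFinite V (transParam c q) A := by
  intro d
  choose N hN using fun μ => hA μ (d hVar)
  -- Beyond all the `p`-degrees, and past `k = 1` so that `dlam` has already been counted.
  refine ⟨∑ μ, N μ + 2, fun k hk μ x hx => ?_⟩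
  have hle : N μ ≤ ∑ μ, N μ := Finset.single_le_sum (fun _ _ => Nat.zero_le _) (Finset.mem_univ μ)
  rw [gaugeTerm_transParam hV c q A k μ hx, if_neg (by omega), add_zero, map_smul,
    coeff_iterate_dPDir_eq_zero (q x) (hN μ x hx) k rfl (by omega), smul_zero]

/-- The value at `y = 0`, `ħ = 0`, `p = π` of `f`, up to terms of degree at least `K` in `p`. -/
def evalP (K : ℕ) (q : Fin n → ℝ) (f : Weyl n) : ℝ :=
  ∑ k ∈ Finset.range K, ((k ! : ℕ) : ℝ)⁻¹ * coeff 0 ((dPDir q)^[k] f)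

theorem contDiffOn_evalP {U : Set (Pt n)} (K : ℕ) {F : Sec n} (hF : IsSmooth U F) :
    ContDiffOn ℝ ∞ (fun u : Pt n × (Fin n → ℝ) => evalP K u.2 (F u.1)) (U ×ˢ Set.univ) := by
  have h : ∀ k : ℕ, ∀ d, ContDiffOn ℝ ∞
      (fun u : Pt n × (Fin n → ℝ) => coeff d ((dPDir u.2)^[k] (F u.1))) (U ×ˢ Set.univ) := by
    intro k
    induction k with
    | zero => exact fun d => (hF d).comp contDiffOn_fst fun u hu => hu.1
    | succ k ih =>
      intro d
      simp only [Function.iterate_succ_apply', coeff_dPDir]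
      refine ContDiffOn.sum fun a _ => ContDiffOn.mul ?_ ((ih _).mul contDiffOn_const)
      exact (contDiff_apply ℝ ℝ a).comp_contDiffOn contDiffOn_snd
  exact ContDiffOn.sum fun k _ => contDiffOn_const.mul (h k 0)

theorem iterate_dPDir_smul (s : ℝ) (q : Fin n → ℝ) (f : Weyl n) (k : ℕ) :
    (dPDir (s • q))^[k] f = s ^ k • (dPDir q)^[k] f := by
  induction k with
  | zero => simp
  | succ k ih =>
    rw [Function.iterate_succ_apply', ih, Function.iterate_succ_apply', dPDir_smul]
    have : ∀ g : Weyl n, dPDir (s • q) g = s • dPDir q g := by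
      intro g
      simp only [dPDir, Finset.smul_sum, smul_smul, Pi.smul_apply, smul_eq_mul]
    rw [this, smul_smul, pow_succ]

/-- Only the term linear in the scaling parameter contributes; `K + 2` guarantees that it is within
the truncation. -/
theorem hasDerivAt_evalP (K : ℕ) (q : Fin n → ℝ) (f : Weyl n) :
    HasDerivAt (fun s : ℝ => evalP (K + 2) (s • q) f)
      (∑ a, coeff (Finsupp.single (pVar a) 1) f * q a) 0 := by
  have h : HasDerivAt (fun s : ℝ => ∑ k ∈ Finset.range (K + 2),
      ((k ! : ℕ) : ℝ)⁻¹ * (s ^ k * coeff 0 ((dPDir q)^[k] f)))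
      (∑ k ∈ Finset.range (K + 2),
        ((k ! : ℕ) : ℝ)⁻¹ * ((k * (0 : ℝ) ^ (k - 1)) * coeff 0 ((dPDir q)^[k] f))) 0 :=
    HasDerivAt.fun_sum fun k _ => ((hasDerivAt_pow k (0 : ℝ)).mul_const _).const_mul _
  simp only [evalP, iterate_dPDir_smul, map_smul, smul_eq_mul]
  convert h using 1
  symm
  rw [Finset.sum_eq_single 1]
  · simp [coeff_dPDir, mul_comm]
  · intro k _ hk
    rcases Nat.eq_zero_or_pos k with rfl | hk'
    · simp
    · rw [zero_pow (by omega)]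
      simp
  · intro h
    exact absurd (Finset.mem_range.2 (by omega)) h

/-! ### Removal of the degree-zero part and the local normal form -/

theorem IsFlatFramed.exists_centered {U : Set (Pt n)} {A : Conn n} (hU : IsOpen U)
    (hA : IsFlatFramed U A) {x₀ : Pt n} (hx₀ : x₀ ∈ U) :
    ∃ (W : Set (Pt n)) (A' : Conn n), IsOpen W ∧ x₀ ∈ W ∧ W ⊆ U ∧ GaugeStep W A A' ∧
      IsFlatCentered W A' ∧ ∀ x ∈ W, (vielbein A' x).det ≠ 0 := by
  choose N hN using fun μ => hA.polyP μ 0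
  let K : ℕ := ∑ μ, N μ
  have hK : ∀ μ, N μ ≤ K := fun μ =>
    Finset.single_le_sum (fun _ _ => Nat.zero_le _) (Finset.mem_univ μ)
  -- The value of `A_μ` at `y = 0`, `ħ = 0`, `p = π`, exact on `U` because `K` bounds all the
  -- `p`-degrees there at order zero in `ħ`. Its derivative in `π` at `(x₀, 0)` is the vielbein.
  let f : Pt n × (Fin n → ℝ) → Fin n → ℝ := fun u μ => evalP (K + 2) u.2 (A μ u.1)
  have hf : ContDiffOn ℝ ∞ f (U ×ˢ Set.univ) :=
    contDiffOn_pi.2 fun μ => contDiffOn_evalP _ (hA.smooth μ)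
  have hS : IsOpen (U ×ˢ (Set.univ : Set (Fin n → ℝ))) := hU.prod isOpen_univ
  have hu : ((x₀, 0) : Pt n × (Fin n → ℝ)) ∈ U ×ˢ (Set.univ : Set (Fin n → ℝ)) := ⟨hx₀, trivial⟩
  have hdiff : DifferentiableAt ℝ f (x₀, 0) :=
    (hf.contDiffAt (hS.mem_nhds hu)).differentiableAt (by simp)
  let L := fderiv ℝ f (x₀, 0) ∘L .inr ℝ (Pt n) (Fin n → ℝ)
  have hL : ∀ q, L q = (vielbein A x₀).mulVec q := by
    intro q
    have h1 : HasDerivAt (fun s : ℝ => ((x₀, s • q) : Pt n × (Fin n → ℝ))) (0, q) 0 := by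
      have h2 : HasDerivAt (fun s : ℝ => s • q) q 0 := by
        simpa using (hasDerivAt_id (0 : ℝ)).smul_const q
      exact (hasDerivAt_const (0 : ℝ) x₀).prodMk h2
    have h3 : HasDerivAt (fun s : ℝ => f (x₀, s • q)) (L q) 0 := by
      have h4 : HasFDerivAt f (fderiv ℝ f (x₀, 0)) ((fun s : ℝ => ((x₀, s • q) :
          Pt n × (Fin n → ℝ))) 0) := by
        simpa using hdiff.hasFDerivAt
      exact h4.comp_hasDerivAt 0 h1
    funext μ
    exact (hasDerivAt_pi.1 h3 μ).unique (hasDerivAt_evalP K q (A μ x₀))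
  have hinv : L.IsInvertible := by
    have hinj : Function.Injective L := by
      have h1 := Matrix.mulVec_injective_iff_isUnit.2
        ((Matrix.isUnit_iff_isUnit_det _).2 (hA.invertible x₀ hx₀))
      intro q q' h
      rw [hL, hL] at h
      exact h1 h
    refine ⟨(LinearEquiv.ofInjectiveEndo L.toLinearMap hinj).toContinuousLinearEquiv, ?_⟩
    ext q
    rfl
  -- Choose `π(x)`, here `q`, so that the degree-zero part after translation keeps its value at
  -- `x₀`.
  obtain ⟨W, q, hW, hxW, hq, hq0, hfq⟩ := exists_smooth_implicitFunction hS hf hu hinv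
  have hWU : W ⊆ U := fun x hx => (hfq x hx).1.1
  -- The constants left over are the components of an exact form, and adding `dc` cancels them.
  let c : Pt n → ℝ := fun x => -∑ μ, coeff 0 (A μ x₀) * x μ
  have hc : ContDiff ℝ ∞ c :=
    (ContDiff.sum fun μ _ => contDiff_const.mul (contDiff_apply ℝ ℝ μ)).neg
  have hcd : ∀ μ x, partialDeriv μ c x = -coeff 0 (A μ x₀) := by
    intro μ x
    have : HasFDerivAt c (-∑ ν, coeff 0 (A ν x₀) •
        (ContinuousLinearMap.proj ν : Pt n →L[ℝ] ℝ)) x := by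
      refine (HasFDerivAt.fun_sum fun ν _ => ?_).neg
      exact (hasFDerivAt_apply ν x).const_mul _
    rw [partialDeriv, this.fderiv]
    simp [Pi.single_apply]
  let lam := transParam c q
  have hls : IsSmooth W lam := isSmooth_transParam hc.contDiffOn hq
  have hAs : ∀ μ, IsSmooth W (A μ) := fun μ => (hA.smooth μ).mono hWU
  have hAp : ∀ μ, IsPolyP W (A μ) := fun μ => (hA.polyP μ).mono hWU
  have hfin : GaugeFinite W lam A := gaugeFinite_transParam hW c q hAp
  have hcent : ∀ μ, ∀ x ∈ W, coeff 0 (gaugeSum lam A μ x) = 0 := by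
    intro μ x hx
    have h1 : ∀ k, K + 2 ≤ k → coeff 0 (gaugeTerm lam A k μ x) = 0 := by
      intro k hk
      have := hK μ
      rw [gaugeTerm_transParam hW c q A k μ hx, if_neg (by omega), add_zero, map_smul,
        coeff_iterate_dPDir_eq_zero (q x) (hN μ x (hWU hx)) k rfl (by simp; omega), smul_zero]
    have h2 : ∑ k ∈ Finset.range (K + 2), coeff 0 (if k = 1 then dX μ lam x else 0) =
        partialDeriv μ c x := by
      rw [Finset.sum_eq_single 1]
      · rw [if_pos rfl, coeff_dX]
        simp only [lam, coeff_zero_transParam]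
      · intro k _ hk
        rw [if_neg hk, map_zero]
      · intro h
        exact absurd (Finset.mem_range.2 (by omega)) h
    have h3 : evalP (K + 2) (q x) (A μ x) = evalP (K + 2) 0 (A μ x₀) :=
      congrFun (hfq x hx).2 μ
    have h4 : evalP (K + 2) 0 (A μ x₀) = coeff 0 (A μ x₀) := by
      rw [evalP, Finset.sum_eq_single 0]
      · simp
      · intro k _ hk
        obtain ⟨k, rfl⟩ := Nat.exists_eq_succ_of_ne_zero hk
        rw [Function.iterate_succ_apply', coeff_dPDir]
        simp
      · intro h
        exact absurd (Finset.mem_range.2 (by omega)) h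
    rw [coeff_gaugeSum h1]
    simp only [lam, gaugeTerm_transParam hW c q A _ μ hx, map_add, map_smul, smul_eq_mul,
      Finset.sum_add_distrib]
    change evalP (K + 2) (q x) (A μ x) + _ = 0
    rw [h2, hcd, h3, h4, add_neg_cancel]
  -- Since `π(x₀) = 0`, the vielbein at `x₀` is untouched; it stays invertible on a smaller
  -- neighbourhood by continuity.
  have hviel : vielbein (gaugeSum lam A) x₀ = vielbein A x₀ := by
    ext μ a
    change coeff (Finsupp.single (pVar a) 1) (gaugeSum lam A μ x₀) =
      coeff (Finsupp.single (pVar a) 1) (A μ x₀)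
    rw [coeff_gaugeSum (K := 1), Finset.sum_range_one]
    · rfl
    · intro k hk
      obtain ⟨k, rfl⟩ : ∃ k', k = k' + 1 := ⟨k - 1, by omega⟩
      have h1 : (dPDir (q x₀))^[k + 1] (A μ x₀) = 0 := by
        rw [Function.iterate_succ_apply', show q x₀ = 0 from hq0]
        simp [dPDir]
      rw [gaugeTerm_transParam hW c q A _ μ hxW, h1, smul_zero, zero_add]
      split_ifs
      · exact coeff_dX_transParam_eq_zero hW c q μ hxW (a := a) (by simp)
      · exact map_zero _
  have hs := hfin.isSmooth hW hAs hls
  let W' : Set (Pt n) := W ∩ (fun x => (vielbein (gaugeSum lam A) x).det) ⁻¹' {0}ᶜ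
  have hW' : IsOpen W' :=
    (smoothMat_vielbein hs).det.continuousOn.isOpen_inter_preimage hW isOpen_compl_singleton
  have hWW' : W' ⊆ W := Set.inter_subset_left
  refine ⟨W', gaugeSum lam A, hW', ⟨hxW, ?_⟩, hWW'.trans hWU,
    (hfin.gaugeStep hW hAs hls (Or.inr ⟨fun x _ d hd hd' => ?_, hAp⟩)).mono hWW',
    IsFlatCentered.mono ⟨hs, hfin.isFlat hW hAs hls (hA.flat.mono hWU), hcent⟩ hWW',
    fun x hx => hx.2⟩
  · change (vielbein (gaugeSum lam A) x₀).det ≠ 0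
    rw [hviel]
    exact (hA.invertible x₀ hx₀).ne_zero
  · exact coeff_transParam_eq_zero c q x hd hd'

/-- Locally, every smooth flat connection with invertible vielbein is gauge equivalent to
`dx^a p_a`. -/
theorem IsFlatFramed.exists_equivalent {U : Set (Pt n)} {A : Conn n} (hU : IsOpen U)
    (hA : IsFlatFramed U A) {x₀ : Pt n} (hx₀ : x₀ ∈ U) :
    ∃ V : Set (Pt n), IsOpen V ∧ x₀ ∈ V ∧ V ⊆ U ∧ GaugeEquivalent V A (segalConn n) := by
  obtain ⟨W, A₁, hW, hxW, hWU, h1, h2, h3⟩ := hA.exists_centered hU hx₀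
  obtain ⟨A₂, h4, h5, h6⟩ := exists_gaugeStep_yFrame_eq_zero hW h2 h3
  have hal : IsFlatAligned W A₂ := ⟨h5, fun x hx => (h6 x hx).2, fun x hx => by
    rw [(h6 x hx).1]
    exact h3 x hx⟩
  obtain ⟨V, hV, hxV, hVW, h7⟩ := hal.exists_equivalent hW hxW
  exact ⟨V, hV, hxV, hVW.trans hWU,
    ((h1.equivalent.trans h4.equivalent).mono hVW).trans h7⟩

end

/-! ### Mixed partial derivatives -/

section

variable {n : ℕ} {V : Set (Pt n)} {g h : Pt n → ℝ}

theorem iterate_partialDeriv_congr (hV : IsOpen V) (hgh : ∀ x ∈ V, g x = h x) (a : Fin n) (k : ℕ) :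
    ∀ x ∈ V, (partialDeriv a)^[k] g x = (partialDeriv a)^[k] h x := by
  induction k with
  | zero => exact hgh
  | succ k ih =>
    intro x hx
    rw [Function.iterate_succ_apply', Function.iterate_succ_apply']
    exact partialDeriv_congr hV ih a hx

theorem contDiffOn_iterate_partialDeriv (hV : IsOpen V) (hg : ContDiffOn ℝ ∞ g V) (a : Fin n)
    (k : ℕ) : ContDiffOn ℝ ∞ ((partialDeriv a)^[k] g) V := by
  induction k with
  | zero => exact hg
  | succ k ih =>
    rw [Function.iterate_succ_apply']
    exact contDiffOn_partialDeriv hV ih a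

theorem partialDeriv_iterate_comm (hV : IsOpen V) (hg : ContDiffOn ℝ ∞ g V) (μ a : Fin n) (k : ℕ) :
    ∀ x ∈ V, partialDeriv μ ((partialDeriv a)^[k] g) x =
      (partialDeriv a)^[k] (partialDeriv μ g) x := by
  induction k with
  | zero => exact fun _ _ => rfl
  | succ k ih =>
    intro x hx
    rw [Function.iterate_succ_apply', Function.iterate_succ_apply',
      partialDeriv_comm hV (contDiffOn_iterate_partialDeriv hV hg a k) μ a hx]
    exact partialDeriv_congr hV ih a hx

/-- The mixed partial derivative in the variables of a list. -/
def listPartial (l : List (Fin n)) (α : Fin n → ℕ) (g : Pt n → ℝ) : Pt n → ℝ :=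
  l.foldr (fun a h => (partialDeriv a)^[α a] h) g

theorem listPartial_cons (a : Fin n) (l : List (Fin n)) (α : Fin n → ℕ) (g : Pt n → ℝ) :
    listPartial (a :: l) α g = (partialDeriv a)^[α a] (listPartial l α g) := rfl

theorem mixedPartial_eq (α : Fin n → ℕ) (g : Pt n → ℝ) :
    mixedPartial α g = listPartial (List.finRange n) α g := rfl

theorem listPartial_congr (hV : IsOpen V) (hgh : ∀ x ∈ V, g x = h x) (l : List (Fin n))
    (α : Fin n → ℕ) : ∀ x ∈ V, listPartial l α g x = listPartial l α h x := by
  induction l with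
  | nil => exact hgh
  | cons a l ih => exact iterate_partialDeriv_congr hV ih a _

theorem contDiffOn_listPartial (hV : IsOpen V) (hg : ContDiffOn ℝ ∞ g V) (l : List (Fin n))
    (α : Fin n → ℕ) : ContDiffOn ℝ ∞ (listPartial l α g) V := by
  induction l with
  | nil => exact hg
  | cons a l ih => exact contDiffOn_iterate_partialDeriv hV ih a _

theorem partialDeriv_listPartial (hV : IsOpen V) (hg : ContDiffOn ℝ ∞ g V) (μ : Fin n)
    (l : List (Fin n)) (α : Fin n → ℕ) :
    ∀ x ∈ V, partialDeriv μ (listPartial l α g) x = listPartial l α (partialDeriv μ g) x := by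
  induction l with
  | nil => exact fun _ _ => rfl
  | cons a l ih =>
    intro x hx
    rw [listPartial_cons, listPartial_cons,
      partialDeriv_iterate_comm hV (contDiffOn_listPartial hV hg l α) μ a _ x hx]
    exact iterate_partialDeriv_congr hV ih a _ x hx

theorem listPartial_of_notMem {μ : Fin n} {l : List (Fin n)} (hμ : μ ∉ l) {α β : Fin n → ℕ}
    (hαβ : ∀ a, a ≠ μ → β a = α a) (g : Pt n → ℝ) : listPartial l β g = listPartial l α g := by
  induction l with
  | nil => rfl
  | cons a l ih =>
    rw [List.mem_cons, not_or] at hμ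
    rw [listPartial_cons, listPartial_cons, ih hμ.2, hαβ a (Ne.symm hμ.1)]

/-- The extra `∂_μ` sits at the place of `μ` in the fixed order of differentiation and is commuted
inwards past the later variables. No repetition in the list ensures that it is counted once. -/
theorem listPartial_succ (hV : IsOpen V) (hg : ContDiffOn ℝ ∞ g V) {μ : Fin n}
    {l : List (Fin n)} (hl : l.Nodup) (hμ : μ ∈ l) {α β : Fin n → ℕ} (hμ' : β μ = α μ + 1)
    (hαβ : ∀ a, a ≠ μ → β a = α a) :
    ∀ x ∈ V, listPartial l β g x = listPartial l α (partialDeriv μ g) x := by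
  induction l with
  | nil => simp at hμ
  | cons a l ih =>
    rw [List.nodup_cons] at hl
    intro x hx
    rw [listPartial_cons, listPartial_cons]
    by_cases ha : a = μ
    · subst ha
      rw [hμ', listPartial_of_notMem hl.1 hαβ, Function.iterate_succ_apply]
      exact iterate_partialDeriv_congr hV (partialDeriv_listPartial hV hg a l α) a _ x hx
    · rw [hαβ a ha]
      refine iterate_partialDeriv_congr hV (ih hl.2 ?_) a _ x hx
      rcases List.mem_cons.1 hμ with h | h
      · exact absurd h.symm ha
      · exact h

theorem mixedPartial_congr (hV : IsOpen V) (hgh : ∀ x ∈ V, g x = h x) (α : Fin n → ℕ) {x : Pt n}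
    (hx : x ∈ V) : mixedPartial α g x = mixedPartial α h x :=
  listPartial_congr hV hgh _ α x hx

theorem contDiffOn_mixedPartial (hV : IsOpen V) (hg : ContDiffOn ℝ ∞ g V) (α : Fin n → ℕ) :
    ContDiffOn ℝ ∞ (mixedPartial α g) V := contDiffOn_listPartial hV hg _ α

theorem partialDeriv_mixedPartial (hV : IsOpen V) (hg : ContDiffOn ℝ ∞ g V) (μ : Fin n)
    (α : Fin n → ℕ) {x : Pt n} (hx : x ∈ V) :
    partialDeriv μ (mixedPartial α g) x = mixedPartial α (partialDeriv μ g) x :=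
  partialDeriv_listPartial hV hg μ _ α x hx

theorem mixedPartial_succ (hV : IsOpen V) (hg : ContDiffOn ℝ ∞ g V) {μ : Fin n} {α β : Fin n → ℕ}
    (hμ' : β μ = α μ + 1) (hαβ : ∀ a, a ≠ μ → β a = α a) {x : Pt n} (hx : x ∈ V) :
    mixedPartial β g x = mixedPartial α (partialDeriv μ g) x :=
  listPartial_succ hV hg (List.nodup_finRange n) (List.mem_finRange μ) hμ' hαβ x hx

theorem partialDeriv_mul_add (hV : IsOpen V) (hg : ContDiffOn ℝ ∞ g V) (hh : ContDiffOn ℝ ∞ h V)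
    (c : ℝ) (μ : Fin n) {x : Pt n} (hx : x ∈ V) :
    partialDeriv μ (fun z => c * g z + h z) x = c * partialDeriv μ g x + partialDeriv μ h x := by
  have h1 : DifferentiableAt ℝ g x := (hg.contDiffAt (hV.mem_nhds hx)).differentiableAt (by simp)
  have h2 : DifferentiableAt ℝ h x := (hh.contDiffAt (hV.mem_nhds hx)).differentiableAt (by simp)
  unfold partialDeriv
  rw [fderiv_fun_add (h1.const_mul c) h2, fderiv_const_mul h1]
  rfl

theorem mixedPartial_mul_add (hV : IsOpen V) (hg : ContDiffOn ℝ ∞ g V) (hh : ContDiffOn ℝ ∞ h V)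
    (c : ℝ) (α : Fin n → ℕ) {x : Pt n} (hx : x ∈ V) :
    mixedPartial α (fun z => c * g z + h z) x = c * mixedPartial α g x + mixedPartial α h x := by
  have h1 : ∀ (g h : Pt n → ℝ), ContDiffOn ℝ ∞ g V → ContDiffOn ℝ ∞ h V → ∀ (a : Fin n) (k : ℕ),
      ∀ x ∈ V, (partialDeriv a)^[k] (fun z => c * g z + h z) x =
        c * (partialDeriv a)^[k] g x + (partialDeriv a)^[k] h x := by
    intro g h hg hh a k
    induction k with
    | zero => exact fun _ _ => rfl
    | succ k ih =>
      intro x hx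
      simp only [Function.iterate_succ_apply']
      rw [partialDeriv_congr hV ih a hx, partialDeriv_mul_add hV
        (contDiffOn_iterate_partialDeriv hV hg a k) (contDiffOn_iterate_partialDeriv hV hh a k)
        c a hx]
  have h2 : ∀ l : List (Fin n), ∀ x ∈ V, listPartial l α (fun z => c * g z + h z) x =
      c * listPartial l α g x + listPartial l α h x := by
    intro l
    induction l with
    | nil => exact fun _ _ => rfl
    | cons a l ih =>
      intro x hx
      simp only [listPartial_cons]
      rw [iterate_partialDeriv_congr hV ih a _ x hx,
        h1 _ _ (contDiffOn_listPartial hV hg l α) (contDiffOn_listPartial hV hh l α) a _ x hx]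
  exact h2 _ x hx

theorem mixedPartial_zero_fun (α : Fin n → ℕ) (x : Pt n) :
    mixedPartial α (fun _ => (0 : ℝ)) x = 0 := by
  have := mixedPartial_mul_add (V := Set.univ) (g := fun _ : Pt n => (0 : ℝ))
    (h := fun _ => 0) isOpen_univ contDiffOn_const contDiffOn_const 1 α (Set.mem_univ x)
  simpa using this

theorem mixedPartial_const_mul (hV : IsOpen V) (hg : ContDiffOn ℝ ∞ g V)
    (c : ℝ) (α : Fin n → ℕ) {x : Pt n} (hx : x ∈ V) :
    mixedPartial α (fun z => c * g z) x = c * mixedPartial α g x := by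
  have := mixedPartial_mul_add hV hg (contDiffOn_const (c := (0 : ℝ))) c α hx
  simpa [mixedPartial_zero_fun] using this

theorem mixedPartial_of_eq_zero {α : Fin n → ℕ} (hα : ∀ a, α a = 0) (g : Pt n → ℝ) :
    mixedPartial α g = g := by
  rw [mixedPartial_eq]
  induction List.finRange n with
  | nil => rfl
  | cons a l ih => rw [listPartial_cons, ih, hα a, Function.iterate_zero, id]

end

/-! ### The lift `f(x + y, p)` -/

section

variable {n : ℕ} {V : Set (Pt n)} {F f g : Sec n}

theorem eraseY_y (d : Expo n) (a : Fin n) : eraseY d (yVar a) = 0 := by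
  simp [eraseY]

theorem eraseY_inr (d : Expo n) (v : Fin n ⊕ Unit) : eraseY d (Sum.inr v) = d (Sum.inr v) :=
  Finsupp.filter_apply_pos _ _ rfl

theorem eraseY_add (d e : Expo n) : eraseY (d + e) = eraseY d + eraseY e := Finsupp.filter_add

theorem eraseY_single_y (a : Fin n) (k : ℕ) : eraseY (Finsupp.single (yVar a) k) = 0 := by
  simp [eraseY]

theorem eraseY_single_inr (v : Fin n ⊕ Unit) (k : ℕ) :
    eraseY (Finsupp.single (Sum.inr v : WeylVar n) k) = Finsupp.single (Sum.inr v) k :=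
  Finsupp.filter_single_of_pos _ rfl

theorem eraseY_eq_self {d : Expo n} (hd : ∀ a, d (yVar a) = 0) : eraseY d = d := by
  ext v
  rcases v with a | v
  · exact (eraseY_y d a).trans (hd a).symm
  · exact eraseY_inr d v

theorem coeff_taylorLift (f : Sec n) (x : Pt n) (d : Expo n) :
    coeff d (taylorLift f x) = (∏ a, ((d (yVar a))! : ℝ))⁻¹ *
      mixedPartial (fun a => d (yVar a)) (fun z => coeff (eraseY d) (f z)) x := rfl

theorem coeff_taylorLift_of_eq_zero (f : Sec n) (x : Pt n) {d : Expo n}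
    (hd : ∀ a, d (yVar a) = 0) : coeff d (taylorLift f x) = coeff d (f x) := by
  rw [coeff_taylorLift, mixedPartial_of_eq_zero hd, eraseY_eq_self hd]
  simp [hd]

theorem taylorLift_congr (hV : IsOpen V) (hfg : ∀ x ∈ V, f x = g x) {x : Pt n} (hx : x ∈ V) :
    taylorLift f x = taylorLift g x := by
  ext d
  rw [coeff_taylorLift, coeff_taylorLift,
    mixedPartial_congr hV (fun z hz => by rw [hfg z hz]) _ hx]

theorem isSmooth_taylorLift (hV : IsOpen V) (hf : IsSmooth V f) : IsSmooth V (taylorLift f) :=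
  fun d => contDiffOn_const.mul (contDiffOn_mixedPartial hV (hf (eraseY d)) _)

theorem dX_taylorLift (hV : IsOpen V) (hf : IsSmooth V f) (μ : Fin n) {x : Pt n} (hx : x ∈ V) :
    dX μ (taylorLift f) x = taylorLift (dX μ f) x := by
  ext d
  have h1 := contDiffOn_mixedPartial hV (hf (eraseY d)) (fun a => d (yVar a))
  have h2 := partialDeriv_mul_add hV h1 (contDiffOn_const (c := (0 : ℝ)))
    (∏ a, ((d (yVar a))! : ℝ))⁻¹ μ hx
  have h3 : partialDeriv μ (fun _ : Pt n => (0 : ℝ)) x = 0 := by simp [partialDeriv]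
  simp only [add_zero, h3] at h2
  rw [coeff_dX, coeff_taylorLift]
  simp only [coeff_taylorLift]
  rw [h2, partialDeriv_mixedPartial hV (hf (eraseY d)) μ _ hx]
  rfl

/-- The factor from differentiating `y^{α_μ + 1}` cancels against the factorial, which shifts the
Taylor series by one derivative in `x^μ`. -/
theorem dY_taylorLift (hV : IsOpen V) (hf : IsSmooth V f) (μ : Fin n) {x : Pt n} (hx : x ∈ V) :
    dY μ (taylorLift f x) = taylorLift (dX μ f) x := by
  ext d
  have h1 : ∏ a, (((d + Finsupp.single (yVar μ) 1 : Expo n) (yVar a))! : ℝ) =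
      (d (yVar μ) + 1) * ∏ a, ((d (yVar a))! : ℝ) := by
    rw [← Finset.mul_prod_erase _ _ (Finset.mem_univ μ),
      ← Finset.mul_prod_erase Finset.univ (fun a => ((d (yVar a))! : ℝ)) (Finset.mem_univ μ),
      ← mul_assoc]
    congr 1
    · simp [Nat.factorial_succ]
    · refine Finset.prod_congr rfl fun a ha => ?_
      simp [(Finset.ne_of_mem_erase ha).symm]
  rw [dY, coeff_pderiv, coeff_taylorLift, coeff_taylorLift, eraseY_add, eraseY_single_y, add_zero,
    h1, mixedPartial_succ (μ := μ) (α := fun a => d (yVar a)) hV (hf (eraseY d)) (by simp)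
      (fun a ha => by simp [ha.symm]) hx, mul_inv]
  have h2 : (d (yVar μ) + 1 : ℝ) ≠ 0 := by positivity
  change _ = _ * mixedPartial _ (partialDeriv μ fun z => coeff (eraseY d) (f z)) x
  field_simp

theorem dP_taylorLift (hV : IsOpen V) (hf : IsSmooth V f) (a : Fin n) {x : Pt n} (hx : x ∈ V) :
    dP a (taylorLift f x) = taylorLift (dPSec a f) x := by
  ext d
  have h1 : (fun z => coeff (eraseY d) (dPSec a f z)) = fun z =>
      (d (pVar a) + 1 : ℝ) * coeff (eraseY d + Finsupp.single (pVar a) 1) (f z) := by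
    funext z
    rw [dPSec, dP, coeff_pderiv, mul_comm, eraseY_inr]
  rw [dP, coeff_pderiv, coeff_taylorLift, coeff_taylorLift, h1,
    mixedPartial_const_mul hV (hf _) _ _ hx, eraseY_add, eraseY_single_inr]
  simp only [Finsupp.add_apply, Finsupp.single_apply, reduceCtorEq, if_false, add_zero]
  ring

/-! ### Covariantly constant sections of `dx^a p_a` -/

theorem covDeriv_segalConn (F : Sec n) (μ : Fin n) (x : Pt n) :
    covDeriv (segalConn n) F μ x = dX μ F x - dY μ (F x) := by
  rw [covDeriv, segalConn, p_bracket, sub_eq_add_neg]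

theorem isCovConst_taylorLift (hV : IsOpen V) (hf : IsSmooth V f) :
    IsCovConst V (segalConn n) (taylorLift f) := by
  intro μ x hx
  rw [covDeriv_segalConn, dX_taylorLift hV hf μ hx, dY_taylorLift hV hf μ hx, sub_self]

theorem IsCovConst.dX_eq (h : IsCovConst V (segalConn n) F) (μ : Fin n) {x : Pt n} (hx : x ∈ V) :
    dX μ F x = dY μ (F x) := by
  have := h μ x hx
  rwa [covDeriv_segalConn, sub_eq_zero] at this

/-- Restriction to `y = 0` in the Weyl algebra. -/
def restrictY (f : Weyl n) : Weyl n := atYZero (fun _ => f) 0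

open Classical in
theorem coeff_restrictY (f : Weyl n) (d : Expo n) :
    coeff d (restrictY f) = if ∀ a, d (yVar a) = 0 then coeff d f else 0 := rfl

theorem atYZero_apply (F : Sec n) (x : Pt n) : atYZero F x = restrictY (F x) := rfl

theorem isSmooth_atYZero (hF : IsSmooth V F) : IsSmooth V (atYZero F) := by
  classical
  intro d
  simp only [atYZero_apply, coeff_restrictY]
  split_ifs
  · exact hF d
  · exact contDiffOn_const

theorem isSymbol_atYZero (F : Sec n) : IsSymbol V (atYZero F) := by
  rintro x - d ⟨a, ha⟩
  rw [atYZero_apply, coeff_restrictY, if_neg fun h => ha (h a)]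

theorem restrictY_taylorLift (hf : IsSymbol V f) {x : Pt n} (hx : x ∈ V) :
    restrictY (taylorLift f x) = f x := by
  ext d
  rw [coeff_restrictY]
  split_ifs with h
  · exact coeff_taylorLift_of_eq_zero f x h
  · push Not at h
    exact (hf x hx d h).symm

/-- Induction on the `y`-degree: `∂_y F = ∂_x F` expresses the coefficients of degree `N + 1`
through `x`-derivatives of those of degree `N`, starting from the restriction to `y = 0`. -/
theorem IsCovConst.eq_taylorLift (hV : IsOpen V) (hF : IsSmooth V F)
    (h : IsCovConst V (segalConn n) F) {x : Pt n} (hx : x ∈ V) :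
    F x = taylorLift (atYZero F) x := by
  have hs := isSmooth_atYZero hF
  have key : ∀ N : ℕ, ∀ d : Expo n, ∑ a, d (yVar a) = N → ∀ x ∈ V,
      coeff d (F x) = coeff d (taylorLift (atYZero F) x) := by
    intro N
    induction N with
    | zero =>
      intro d hd x hx
      have hd' : ∀ a, d (yVar a) = 0 := fun a => by
        have := Finset.single_le_sum (f := fun a => d (yVar a)) (fun _ _ => Nat.zero_le _)
          (Finset.mem_univ a)
        omega
      rw [coeff_taylorLift_of_eq_zero _ _ hd', atYZero_apply, coeff_restrictY, if_pos hd']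
    | succ N ih =>
      intro d hd x hx
      obtain ⟨a, -, ha⟩ : ∃ a ∈ Finset.univ, d (yVar a) ≠ 0 := by
        by_contra hc
        push Not at hc
        rw [Finset.sum_eq_zero hc] at hd
        omega
      have hle : Finsupp.single (yVar a) 1 ≤ d := by
        rw [Finsupp.single_le_iff]
        omega
      obtain ⟨e, rfl⟩ := exists_add_of_le hle
      have he : ∑ b, e (yVar b) = N := by
        simp only [Finsupp.add_apply, Finset.sum_add_distrib] at hd
        have : ∑ b, (Finsupp.single (yVar a) 1 : Expo n) (yVar b) = 1 := by
          simp [Finsupp.single_apply]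
        omega
      have h1 : coeff e (dY a (F x)) = coeff e (dY a (taylorLift (atYZero F) x)) := by
        rw [← h.dX_eq a hx, ← (isCovConst_taylorLift hV hs).dX_eq a hx, coeff_dX, coeff_dX]
        exact partialDeriv_congr hV (fun z hz => ih e he z hz) a hx
      rw [dY, dY, coeff_pderiv, coeff_pderiv] at h1
      rw [add_comm]
      exact mul_right_cancel₀ (by positivity) h1
  ext d
  exact key _ d rfl x hx

/-- Derivatives in `x` of a coefficient that vanishes on the open set vanish as well, so the lift
has the same bound on the `p`-degree. Conversely, `f` is the part of the lift free of `y`. -/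
theorem isPolyP_taylorLift_iff (hV : IsOpen V) (hf : IsSymbol V f) :
    IsPolyP V (taylorLift f) ↔ IsPolyP V f := by
  constructor
  · intro h m
    obtain ⟨N, hN⟩ := h m
    refine ⟨N, fun x hx d hd hp => ?_⟩
    by_cases hy : ∀ a, d (yVar a) = 0
    · rw [← coeff_taylorLift_of_eq_zero f x hy]
      exact hN x hx d hd hp
    · push Not at hy
      exact hf x hx d hy
  · intro h m
    obtain ⟨N, hN⟩ := h m
    refine ⟨N, fun x hx d hd hp => ?_⟩
    rw [coeff_taylorLift, mixedPartial_congr (h := fun _ => 0) hV (fun z hz => ?_) _ hx,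
      mixedPartial_zero_fun, mul_zero]
    refine hN z hz (eraseY d) ((eraseY_inr d _).trans hd) ?_
    simpa only [eraseY_inr] using hp

/-! ### The star product of lifts -/

theorem restrictY_mul (f g : Weyl n) : restrictY (f * g) = restrictY f * restrictY g := by
  classical
  ext d
  rw [coeff_restrictY, coeff_mul, coeff_mul]
  split_ifs with h
  · refine Finset.sum_congr rfl fun p hp => ?_
    rw [Finset.HasAntidiagonal.mem_antidiagonal] at hp
    have h1 : ∀ a, p.1 (yVar a) = 0 ∧ p.2 (yVar a) = 0 := by
      intro a
      have := h a
      rw [← hp, Finsupp.add_apply] at this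
      omega
    rw [coeff_restrictY, coeff_restrictY, if_pos fun a => (h1 a).1, if_pos fun a => (h1 a).2]
  · symm
    refine Finset.sum_eq_zero fun p hp => ?_
    rw [Finset.HasAntidiagonal.mem_antidiagonal] at hp
    rw [coeff_restrictY, coeff_restrictY]
    by_cases h1 : ∀ a, p.1 (yVar a) = 0
    · rw [if_neg (c := ∀ a, p.2 (yVar a) = 0), mul_zero]
      intro h2
      apply h
      intro a
      rw [← hp, Finsupp.add_apply, h1, h2]
    · rw [if_neg h1, zero_mul]

/-- Restriction to `y = 0` as a linear map. -/
def restrictYL : Weyl n →ₗ[ℝ] Weyl n where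
  toFun := restrictY
  map_add' f g := by
    classical
    ext d
    simp only [map_add, coeff_restrictY]
    split_ifs <;> simp
  map_smul' r f := by
    classical
    ext d
    simp only [map_smul, coeff_restrictY, RingHom.id_apply]
    split_ifs <;> simp

theorem restrictY_eq (f : Weyl n) : restrictY f = restrictYL f := rfl

theorem restrictY_hbarSum (c : ℕ → Weyl n) :
    restrictY (hbarSum c) = hbarSum fun k => restrictY (c k) := by
  classical
  ext d
  have h : ∀ k a, (d - Finsupp.single hVar k : Expo n) (yVar a) = d (yVar a) := by
    intro k a
    simp
  have h1 : coeff d (hbarSum fun k => restrictY (c k)) = ∑ k ∈ Finset.range (d hVar + 1),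
      coeff (d - Finsupp.single hVar k) (restrictY (c k)) := rfl
  have h2 : coeff d (hbarSum c) = ∑ k ∈ Finset.range (d hVar + 1),
      coeff (d - Finsupp.single hVar k) (c k) := rfl
  rw [h1, coeff_restrictY, h2]
  simp only [coeff_restrictY, h]
  split_ifs
  · rfl
  · exact Finset.sum_const_zero.symm

theorem IsSymbol.dX (hV : IsOpen V) (hf : IsSymbol V f) (μ : Fin n) : IsSymbol V (dX μ f) :=
  fun _ hx d hd => coeff_dX_eq_zero hV (fun z hz => hf z hz d hd) μ hx

theorem IsSymbol.dPSec (hf : IsSymbol V f) (a : Fin n) : IsSymbol V (dPSec a f) := by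
  rintro x hx d ⟨b, hb⟩
  rw [SegalGauge.dPSec, dP, coeff_pderiv, hf x hx _ ⟨b, by simpa using hb⟩, zero_mul]

theorem IsSmooth.dPSec (hf : IsSmooth V f) (a : Fin n) : IsSmooth V (dPSec a f) := by
  intro d
  simp only [SegalGauge.dPSec, dP, coeff_pderiv]
  exact (hf _).mul contDiffOn_const

/-- On lifts `∂_y` is the lift of `∂_x`, and `∂_p` commutes with lifting, so the two bidifferential
operators correspond before `y` is set to zero. -/
theorem restrictY_poissonPow (hV : IsOpen V) (hf : IsSmooth V f) (hf' : IsSymbol V f)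
    (hg : IsSmooth V g) (hg' : IsSymbol V g) (k : ℕ) {x : Pt n} (hx : x ∈ V) :
    restrictY (poissonPow dY dP k (taylorLift f x) (taylorLift g x)) =
      poissonPow dX dPSec k f g x := by
  induction k generalizing f g with
  | zero =>
    simp only [poissonPow]
    rw [restrictY_mul, restrictY_taylorLift hf' hx, restrictY_taylorLift hg' hx]
    rfl
  | succ k ih =>
    simp only [poissonPow]
    rw [Finset.sum_apply, restrictY_eq, map_sum]
    refine Finset.sum_congr rfl fun a _ => ?_
    rw [map_sub, ← restrictY_eq, ← restrictY_eq, dY_taylorLift hV hf a hx,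
      dY_taylorLift hV hg a hx, dP_taylorLift hV hf a hx, dP_taylorLift hV hg a hx,
      ih (hf.dX hV a) (hf'.dX hV a) (hg.dPSec a) (hg'.dPSec a),
      ih (hf.dPSec a) (hf'.dPSec a) (hg.dX hV a) (hg'.dX hV a)]
    rfl

theorem restrictY_star_taylorLift (hV : IsOpen V) (hf : IsSmooth V f) (hf' : IsSymbol V f)
    (hg : IsSmooth V g) (hg' : IsSymbol V g) {x : Pt n} (hx : x ∈ V) :
    restrictY (star (taylorLift f x) (taylorLift g x)) = phaseStar f g x := by
  rw [star, restrictY_hbarSum, phaseStar]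
  congr 1
  funext k
  rw [restrictY_eq, map_smul, ← restrictY_eq, restrictY_poissonPow hV hf hf' hg hg' k hx]

theorem star_taylorLift (hV : IsOpen V) (hf : IsSmooth V f) (hf' : IsSymbol V f)
    (hg : IsSmooth V g) (hg' : IsSymbol V g) {x : Pt n} (hx : x ∈ V) :
    star (taylorLift f x) (taylorLift g x) = taylorLift (phaseStar f g) x := by
  have h1 := isSmooth_taylorLift hV hf
  have h2 := isSmooth_taylorLift hV hg
  -- Both `∂_x` and `∂_y` are derivations of the fibrewise product, so products of covariantly
  -- constant sections are covariantly constant and hence determined at `y = 0`.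
  have h3 : IsCovConst V (segalConn n) fun z => star (taylorLift f z) (taylorLift g z) := by
    intro μ z hz
    rw [covDeriv_segalConn, isFinBil_star.dX hV h1 h2 μ hz, dY_star,
      (isCovConst_taylorLift hV hf).dX_eq μ hz, (isCovConst_taylorLift hV hg).dX_eq μ hz, sub_self]
  refine (h3.eq_taylorLift hV (h1.star h2) hx).trans (taylorLift_congr hV (fun z hz => ?_) hx)
  rw [atYZero_apply, restrictY_star_taylorLift hV hf hf' hg hg' hz]

theorem isSmooth_phaseStar (hV : IsOpen V) (hf : IsSmooth V f) (hf' : IsSymbol V f)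
    (hg : IsSmooth V g) (hg' : IsSymbol V g) : IsSmooth V (phaseStar f g) :=
  (isSmooth_atYZero ((isSmooth_taylorLift hV hf).star (isSmooth_taylorLift hV hg))).congr
    fun _ hx => (restrictY_star_taylorLift hV hf hf' hg hg' hx).symm

/-! ### Linearity of the lift and the residual gauge variations -/

theorem taylorLift_smul_add (hV : IsOpen V) (hf : IsSmooth V f) (hg : IsSmooth V g) (c : ℝ)
    {x : Pt n} (hx : x ∈ V) :
    taylorLift (fun z => c • f z + g z) x = c • taylorLift f x + taylorLift g x := by
  ext d
  rw [map_add, map_smul, coeff_taylorLift, coeff_taylorLift, coeff_taylorLift]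
  simp only [map_add, map_smul, smul_eq_mul]
  rw [mixedPartial_mul_add hV (hf _) (hg _) c _ hx]
  ring

theorem taylorLift_add (hV : IsOpen V) (hf : IsSmooth V f) (hg : IsSmooth V g)
    {x : Pt n} (hx : x ∈ V) :
    taylorLift (fun z => f z + g z) x = taylorLift f x + taylorLift g x := by
  simpa only [one_smul] using taylorLift_smul_add hV hf hg 1 hx

theorem taylorLift_sub (hV : IsOpen V) (hf : IsSmooth V f) (hg : IsSmooth V g)
    {x : Pt n} (hx : x ∈ V) :
    taylorLift (fun z => f z - g z) x = taylorLift f x - taylorLift g x := by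
  have := taylorLift_smul_add hV hg hf (-1) hx
  simp only [neg_smul, one_smul, neg_add_eq_sub] at this
  exact this

theorem coeff_divHbar (f : Weyl n) (d : Expo n) :
    coeff d (divHbar f) = coeff (d + Finsupp.single hVar 1) f := rfl

/-- Lifting acts on `x` and `y` only, so it commutes with shifting the exponent of `ħ`; this carries
the commutator part of the variation. -/
theorem taylorLift_divHbar (f : Sec n) (x : Pt n) :
    taylorLift (fun z => divHbar (f z)) x = divHbar (taylorLift f x) := by
  ext d
  rw [coeff_divHbar, coeff_taylorLift, coeff_taylorLift, eraseY_add, eraseY_single_inr]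
  simp only [coeff_divHbar]
  simp

theorem IsSmooth.divHbar (hf : IsSmooth V f) : IsSmooth V fun x => divHbar (f x) :=
  fun d => hf (d + Finsupp.single hVar 1)

theorem parentVariation_taylorLift {ξ w : Sec n} (hV : IsOpen V)
    (hf : IsSmooth V f) (hf' : IsSymbol V f) (hξ : IsSmooth V ξ) (hξ' : IsSymbol V ξ)
    (hw : IsSmooth V w) (hw' : IsSymbol V w) {x : Pt n} (hx : x ∈ V) :
    parentVariation (taylorLift f) (taylorLift ξ) (taylorLift w) x =
      taylorLift (segalVariation f ξ w) x := by
  have s1 := isSmooth_phaseStar hV hf hf' hξ hξ'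
  have s2 := isSmooth_phaseStar hV hξ hξ' hf hf'
  have s3 := isSmooth_phaseStar hV hf hf' hw hw'
  have s4 := isSmooth_phaseStar hV hw hw' hf hf'
  have e : taylorLift (segalVariation f ξ w) x =
      divHbar (taylorLift (phaseStar f ξ) x - taylorLift (phaseStar ξ f) x) +
        (taylorLift (phaseStar f w) x + taylorLift (phaseStar w f) x) := by
    change taylorLift (fun z => divHbar (phaseStar f ξ z - phaseStar ξ f z) +
      (phaseStar f w z + phaseStar w f z)) x = _
    rw [taylorLift_add hV (s1.sub s2).divHbar (s3.add s4) hx, taylorLift_add hV s3 s4 hx,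
      taylorLift_divHbar (fun z => phaseStar f ξ z - phaseStar ξ f z),
      taylorLift_sub hV s1 s2 hx]
  rw [e, parentVariation, bracket, star_taylorLift hV hf hf' hξ hξ' hx,
    star_taylorLift hV hξ hξ' hf hf' hx, star_taylorLift hV hf hf' hw hw' hx,
    star_taylorLift hV hw hw' hf hf' hx]

end

end SegalGauge

end

theorem mainTheorem5 (n : ℕ) :
    -- every flat connection with invertible vielbein is locally equivalent to `dx^a p_a`
    (∀ (U : Set (SegalGauge.Pt n)) (A : SegalGauge.Conn n), IsOpen U →
      SegalGauge.IsFlatFramed U A → ∀ x₀ ∈ U,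
        ∃ V : Set (SegalGauge.Pt n), IsOpen V ∧ x₀ ∈ V ∧ V ⊆ U ∧
          SegalGauge.GaugeEquivalent V A (SegalGauge.segalConn n)) ∧
    -- any two of them locally belong to the same gauge orbit
    (∀ (U : Set (SegalGauge.Pt n)) (A A' : SegalGauge.Conn n), IsOpen U →
      SegalGauge.IsFlatFramed U A → SegalGauge.IsFlatFramed U A' → ∀ x₀ ∈ U,
        ∃ V : Set (SegalGauge.Pt n), IsOpen V ∧ x₀ ∈ V ∧ V ⊆ U ∧
          SegalGauge.GaugeEquivalent V A A') ∧
    (∀ V : Set (SegalGauge.Pt n), IsOpen V →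
      -- covariantly constant sections are exactly the `f(x + y, p)`
      (∀ F : SegalGauge.Sec n, SegalGauge.IsSmooth V F →
        (SegalGauge.IsCovConst V (SegalGauge.segalConn n) F ↔
          ∃ f : SegalGauge.Sec n, SegalGauge.IsSmooth V f ∧ SegalGauge.IsSymbol V f ∧
            ∀ x ∈ V, F x = SegalGauge.taylorLift f x)) ∧
      -- `f` is unconstrained, and `f(x + y, p)` is the unique solution with initial data `f`
      (∀ f : SegalGauge.Sec n, SegalGauge.IsSmooth V f → SegalGauge.IsSymbol V f →
        SegalGauge.IsSmooth V (SegalGauge.taylorLift f) ∧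
        SegalGauge.IsCovConst V (SegalGauge.segalConn n) (SegalGauge.taylorLift f) ∧
        (∀ x ∈ V, SegalGauge.atYZero (SegalGauge.taylorLift f) x = f x) ∧
        (SegalGauge.IsPolyP V (SegalGauge.taylorLift f) ↔ SegalGauge.IsPolyP V f) ∧
        ∀ F : SegalGauge.Sec n, SegalGauge.IsSmooth V F →
          SegalGauge.IsCovConst V (SegalGauge.segalConn n) F →
          (∀ x ∈ V, SegalGauge.atYZero F x = f x) →
          ∀ x ∈ V, F x = SegalGauge.taylorLift f x) ∧
      -- the fibrewise star product induces the one of phase space functions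
      (∀ f g : SegalGauge.Sec n, SegalGauge.IsSmooth V f → SegalGauge.IsSymbol V f →
        SegalGauge.IsSmooth V g → SegalGauge.IsSymbol V g → ∀ x ∈ V,
          SegalGauge.star (SegalGauge.taylorLift f x) (SegalGauge.taylorLift g x) =
            SegalGauge.taylorLift (SegalGauge.phaseStar f g) x) ∧
      -- the residual gauge symmetry is that of the off-shell Segal system
      (∀ f ξ w : SegalGauge.Sec n, SegalGauge.IsSmooth V f → SegalGauge.IsSymbol V f →
        SegalGauge.IsSmooth V ξ → SegalGauge.IsSymbol V ξ →
        SegalGauge.IsSmooth V w → SegalGauge.IsSymbol V w → ∀ x ∈ V,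
          SegalGauge.parentVariation (SegalGauge.taylorLift f) (SegalGauge.taylorLift ξ)
              (SegalGauge.taylorLift w) x =
            SegalGauge.taylorLift (SegalGauge.segalVariation f ξ w) x)) := by
  refine ⟨fun U A hU hA x₀ hx₀ => hA.exists_equivalent hU hx₀, ?_, fun V hV => ⟨?_, ?_, ?_, ?_⟩⟩
  · intro U A A' hU hA hA' x₀ hx₀
    obtain ⟨V, hV, hxV, hVU, h⟩ := hA.exists_equivalent hU hx₀
    obtain ⟨W, hW, hxW, -, h'⟩ := hA'.exists_equivalent hU hx₀
    exact ⟨V ∩ W, hV.inter hW, ⟨hxV, hxW⟩, Set.inter_subset_left.trans hVU,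
      (h.mono Set.inter_subset_left).trans
        (Relation.EqvGen.symm _ _ (h'.mono Set.inter_subset_right))⟩
  · intro F hF
    constructor
    · exact fun h => ⟨SegalGauge.atYZero F, SegalGauge.isSmooth_atYZero hF,
        SegalGauge.isSymbol_atYZero F, fun x hx => h.eq_taylorLift hV hF hx⟩
    · rintro ⟨f, hf, -, h⟩ μ x hx
      rw [← SegalGauge.isCovConst_taylorLift hV hf μ x hx, SegalGauge.covDeriv_segalConn,
        SegalGauge.covDeriv_segalConn, SegalGauge.dX_congr hV h μ hx, h x hx]
  · intro f hf hf'
    refine ⟨SegalGauge.isSmooth_taylorLift hV hf, SegalGauge.isCovConst_taylorLift hV hf,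
      fun x hx => SegalGauge.restrictY_taylorLift hf' hx,
      SegalGauge.isPolyP_taylorLift_iff hV hf', fun F hF h h0 x hx => ?_⟩
    rw [h.eq_taylorLift hV hF hx, SegalGauge.taylorLift_congr hV h0 hx]
  · exact fun f g hf hf' hg hg' x hx => SegalGauge.star_taylorLift hV hf hf' hg hg' hx
  · exact fun f ξ w hf hf' hξ hξ' hw hw' x hx =>
      SegalGauge.parentVariation_taylorLift hV hf hf' hξ hξ' hw hw' hx
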